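/- Let $n,m\ge 1$ be integers, let $1\le p_0<\infty$ with conjugate exponent $p_0'$ ($p_0'=\infty$ if $p_0=1$), and let $$T:\mathcal S(\mathbb R^n)\times\cdots\times\mathcal S(\mathbb R^n)\to\mathcal S'(\mathbb R^n)$$ be an $m$-linear operator with associated kernel $K$: a function $K(x,y_1,\dots,y_m)$ defined away from the diagonal $x=y_1=\dots=y_m$ such that, with an absolutely convergent integral, $$T(f_1,\dots,f_m)(x)=\int_{(\mathbb R^n)^m}K(x,y_1,\dots,y_m)f_1(y_1)\cdots f_m(y_m)\,dy_1\cdots dy_m$$ for all $f_1,\dots,f_m\in\mathcal S(\mathbb R^n)$ and almost every $x\notin\bigcap_{j}\operatorname{supp}f_j$. Assume: (H1) $T$ maps $L^{p_0}\times\cdots\times L^{p_0}$ into $L^{p_0/m,\infty}$: for Schwartz $f_1,\dots,f_m$ the distribution $T(f_1,\dots,f_m)$ is given by a function, and $T$ extends to a bounded $m$-linear operator from $L^{p_0}\times\cdots\times L^{p_0}$ to $L^{p_0/m,\infty}$, again denoted by $T$. (H2) There are $\delta>n/p_0$ and $C>0$ such that for all balls $B$, all $x,\bar x\in\frac12B$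 and all $(j_1,\dots,j_m)\in\mathbb Z_{\ge0}^m\setminus\{0\}$, with $j_0=\max_k j_k$, $$\Big(\int_{S_{j_m}(B)}\!\!\cdots\int_{S_{j_1}(B)}|K(x,\vec y)-K(\bar x,\vec y)|^{p_0'}\,d\vec y\Big)^{1/p_0'}\le C\,\frac{|x-\bar x|^{m(\delta-n/p_0)}}{|B|^{m\delta/n}}\,2^{-m\delta j_0}$$ (an essential supremum if $p_0=1$), where $S_0(B)=B$ and $S_j(B)=2^jB\setminus2^{j-1}B$ for $j\ge1$. A dyadic grid $\mathscr D$ is a collection of half-open cubes in $\mathbb R^n$ with sides parallel to the axes and side lengths $2^k$, $k\in\mathbb Z$, any two of which are nested or disjoint, and such that for each $k\in\mathbb Z$ the cubes of $\mathscr D$ of side length $2^k$ partition $\mathbb R^n$. A family $S\subset\mathscr D$ is sparse if there are pairwise disjoint measurable sets $E_Q\subset Q$ ($Q\in S$) with $|Q|\le2|E_Q|$. For $f_1,\dots,f_m\in L^{p_0}(\mathbb R^n)$ let $$\mathcal A^{p_0}_{\mathscr D,S}(\vec f)(x)=\sum_{Q\in S}\Big[\prod_{i=1}^m\Big(\frac1{|Q|}\int_Q|f_i|^{p_0}\Big)^{1/p_0}\Big]\chi_Q(x).$$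 A quasi-Banach function space $\mathbb X$ over $\mathbb R^n$ (with Lebesgue measure) is a space of measurable functions that is complete under a quasi-norm $\|\cdot\|_{\mathbb X}$, defined with values in $[0,\infty]$ on all measurable functions, which is definite and homogeneous, satisfies $\|f+g\|_{\mathbb X}\le\kappa_{\mathbb X}(\|f\|_{\mathbb X}+\|g\|_{\mathbb X})$ for a constant $\kappa_{\mathbb X}$, and satisfies $\|f\|_{\mathbb X}\le\|g\|_{\mathbb X}$ whenever $|f|\le|g|$ almost everywhere. Then for every $\kappa\ge 0$ there is a constant $C$, depending only on $T$, $m$, $n$ (with the data $p_0$, $K$ of (H1) and (H2)) and $\kappa$, such that for every quasi-Banach function space $\mathbb X$ with $\kappa_{\mathbb X}\le\kappa$ and all $f_1,\dots,f_m\in L^{p_0}(\mathbb R^n)$, $$\|T(\vec f)\|_{\mathbb X}\le C\,\sup_{\mathscr D,S}\big\|\mathcal A^{p_0}_{\mathscr D,S}(\vec f)\big\|_{\mathbb X},$$ the supremum being over all dyadic grids $\mathscr D$ and all sparse families $S\subset\mathscr D$. -/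

import Mathlib

open MeasureTheory Filter Topology Set
open scoped ENNReal NNReal SchwartzMap

noncomputable section

namespace SparseDomination

/-- Euclidean space `ℝⁿ`. -/
abbrev Space (n : ℕ) : Type := EuclideanSpace ℝ (Fin n)

/-! ### Quasi-Banach function spaces -/

/-- A quasi-Banach function space over `ℝⁿ` with Lebesgue measure. It is given by its quasi-norm
`rho`, a functional on measurable functions `ℝⁿ → [0, ∞]`; the space itself consists of the
measurable functions `u` with `‖u‖_X = rho |u| < ∞`. The axioms are: definiteness, homogeneity, the
quasi-triangle inequality (with constant `const`), the lattice property, and completeness. -/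
structure QuasiBanachFunctionSpace (n : ℕ) where
  /-- The quasi-norm of a nonnegative measurable function. -/
  rho : (Space n → ℝ≥0∞) → ℝ≥0∞
  /-- The constant in the quasi-triangle inequality. -/
  const : ℝ≥0
  definite : ∀ f, Measurable f → rho f = 0 → f =ᵐ[volume] 0
  smul_eq : ∀ (c : ℝ≥0) (f), Measurable f → rho (fun x => c * f x) = c * rho f
  add_le : ∀ f g, Measurable f → Measurable g →
    rho (fun x => f x + g x) ≤ const * (rho f + rho g)
  mono : ∀ f g, Measurable f → Measurable g → (∀ᵐ x ∂volume, f x ≤ g x) → rho f ≤ rho g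
  complete : ∀ u : ℕ → Space n → ℂ, (∀ k, Measurable (u k)) →
    (∀ k, rho (fun x => ‖u k x‖ₑ) < ∞) →
    (∀ ε : ℝ≥0∞, 0 < ε → ∃ N, ∀ j ≥ N, ∀ k ≥ N, rho (fun x => ‖u j x - u k x‖ₑ) ≤ ε) →
    ∃ v : Space n → ℂ, Measurable v ∧
      Tendsto (fun k => rho (fun x => ‖u k x - v x‖ₑ)) atTop (𝓝 0)

/-! ### Dyadic grids, sparse families, sparse operators -/

/-- `Q` is a (half-open) cube of side length `s`, with sides parallel to the axes. -/
def IsCubeOfSide {n : ℕ} (Q : Set (Space n)) (s : ℝ) : Prop :=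
  ∃ a : Space n, Q = {x | ∀ i, a i ≤ x i ∧ x i < a i + s}

/-- A general dyadic grid in `ℝⁿ`: every cube has side length `2 ^ k` for some integer `k`; two
cubes are nested or disjoint; for each `k`, the cubes of side length `2 ^ k` partition `ℝⁿ`. -/
structure IsDyadicGrid {n : ℕ} (D : Set (Set (Space n))) : Prop where
  side : ∀ Q ∈ D, ∃ k : ℤ, IsCubeOfSide Q ((2 : ℝ) ^ k)
  nested : ∀ Q ∈ D, ∀ R ∈ D, Q ∩ R = Q ∨ Q ∩ R = R ∨ Q ∩ R = ∅
  partition : ∀ (k : ℤ) (x : Space n), ∃! Q, Q ∈ D ∧ IsCubeOfSide Q ((2 : ℝ) ^ k) ∧ x ∈ Q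

/-- `S` is sparse: there are pairwise disjoint measurable `E_Q ⊆ Q` with `|Q| ≤ 2 |E_Q|`. -/
def IsSparse {n : ℕ} (S : Set (Set (Space n))) : Prop :=
  ∃ E : Set (Space n) → Set (Space n),
    (∀ Q ∈ S, MeasurableSet (E Q) ∧ E Q ⊆ Q ∧ volume Q ≤ 2 * volume (E Q)) ∧
    S.PairwiseDisjoint E

/-- The average `⟨f⟩_{Q,p} = (|Q|⁻¹ ∫_Q |f|^p)^{1/p}`. -/
def average {n : ℕ} (p : ℝ) (f : Space n → ℂ) (Q : Set (Space n)) : ℝ≥0∞ :=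
  ((volume Q)⁻¹ * ∫⁻ x in Q, ‖f x‖ₑ ^ p) ^ (1 / p)

/-- The sparse operator `A^p_S(f₁, …, f_m)(x) = ∑_{Q ∈ S} (∏ᵢ ⟨fᵢ⟩_{Q,p}) χ_Q(x)`. -/
def sparseOperator {n m : ℕ} (p : ℝ) (S : Set (Set (Space n))) (f : Fin m → Space n → ℂ)
    (x : Space n) : ℝ≥0∞ :=
  ∑' Q : S, (Q : Set (Space n)).indicator (fun _ => ∏ i, average p (f i) (Q : Set (Space n))) x

/-! ### The multilinear operators -/

/-- The tempered distribution `u` is given by the function `g`. -/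
def IsGivenBy {n : ℕ} (u : 𝓢'(Space n, ℂ)) (g : Space n → ℂ) : Prop :=
  ∀ φ : 𝓢(Space n, ℂ), Integrable (fun x => φ x * g x) volume ∧ u φ = ∫ x, φ x * g x

/-- The weak Lebesgue quasi-norm `‖g‖_{L^{q,∞}} = sup_{t > 0} t |{|g| > t}|^{1/q}`. -/
def weakNorm {n : ℕ} (q : ℝ) (g : Space n → ℂ) : ℝ≥0∞ :=
  ⨆ t : ℝ≥0, (t : ℝ≥0∞) * volume {x | (t : ℝ≥0∞) < ‖g x‖ₑ} ^ (1 / q)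

/-- Multilinear operators from `m`-tuples of Schwartz functions to tempered distributions. -/
abbrev SchwartzOperator (n m : ℕ) : Type :=
  MultilinearMap ℂ (fun _ : Fin m => 𝓢(Space n, ℂ)) 𝓢'(Space n, ℂ)

/-- Multilinear operators from `m`-tuples of `L^p` functions to measurable functions, modulo
equality almost everywhere. -/
abbrev LpOperator (n m : ℕ) (p : ℝ) : Type :=
  MultilinearMap ℂ (fun _ : Fin m => Lp ℂ (ENNReal.ofReal p) (volume : Measure (Space n)))
    (Space n →ₘ[volume] ℂ)

/-- `T` maps `L^p × ⋯ × L^p` into `L^{p/m,∞}`: the operator `Text` is the (necessarily unique)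
bounded multilinear extension of `T` to `L^p × ⋯ × L^p` with values in `L^{p/m,∞}`. -/
structure IsWeakBoundedExtension {n m : ℕ} (p : ℝ) (T : SchwartzOperator n m)
    (Text : LpOperator n m p) : Prop where
  agrees : ∀ f : Fin m → 𝓢(Space n, ℂ),
    IsGivenBy (T f) (Text fun i => (f i).toLp (ENNReal.ofReal p) volume)
  bounded : ∃ A : ℝ≥0, ∀ f, weakNorm (p / m) (Text f) ≤
    A * ∏ i, eLpNorm (f i) (ENNReal.ofReal p) volume

/-- `K` is the kernel of `T`: for Schwartz functions `f₁, …, f_m` and (almost) every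
`x ∉ ⋂ᵢ supp fᵢ`, one has `T(f₁, …, f_m)(x) = ∫ K(x, y₁, …, y_m) ∏ᵢ fᵢ(yᵢ) dy`, the integral being
absolutely convergent. The values of `K` on the diagonal, which is a null set, are irrelevant. -/
structure HasKernel {n m : ℕ} (T : SchwartzOperator n m)
    (K : Space n → (Fin m → Space n) → ℂ) : Prop where
  measurable : ∀ x, AEStronglyMeasurable (K x) volume
  representation : ∀ (f : Fin m → 𝓢(Space n, ℂ)) (g : Space n → ℂ), IsGivenBy (T f) g →
    ∀ᵐ x ∂volume, x ∉ ⋂ i, tsupport (f i) →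
      Integrable (fun y : Fin m → Space n => K x y * ∏ i, f i (y i)) volume ∧
      g x = ∫ y : Fin m → Space n, K x y * ∏ i, f i (y i)

/-- The annuli of the ball `B = B(c, r)`: `S_0(B) = B` and `S_j(B) = 2^j B \ 2^{j-1} B`. -/
def annulus {n : ℕ} (c : Space n) (r : ℝ) : ℕ → Set (Space n)
  | 0 => Metric.ball c r
  | j + 1 => Metric.ball c (2 ^ (j + 1) * r) \ Metric.ball c (2 ^ j * r)

/-- The kernel regularity condition: for some `δ > n / p` and `C`, for every ball `B = B(c, r)`, all
`x, x' ∈ (1/2) B` and all `(j₁, …, j_m) ≠ (0, …, 0)`, the `L^{p'}` norm of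
`K(x, ·) - K(x', ·)` on `S_{j₁}(B) × ⋯ × S_{j_m}(B)` is at most
`C |x - x'|^{m (δ - n/p)} |B|^{-m δ / n} 2^{-m δ max j}`. -/
def KernelRegularity {n m : ℕ} (p : ℝ) (K : Space n → (Fin m → Space n) → ℂ) : Prop :=
  ∃ δ : ℝ, n / p < δ ∧ ∃ C : ℝ, 0 < C ∧
    ∀ (c : Space n) (r : ℝ), 0 < r →
    ∀ x ∈ Metric.ball c (r / 2), ∀ x' ∈ Metric.ball c (r / 2),
    ∀ j : Fin m → ℕ, j ≠ 0 →
      eLpNorm (fun y => K x y - K x' y) (ENNReal.ofReal p).conjExponent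
          (volume.restrict (Set.univ.pi fun k => annulus c r (j k))) ≤
        ENNReal.ofReal
          (C * (dist x x' ^ (m * (δ - n / p)) /
              (volume (Metric.ball c r)).toReal ^ (m * δ / n)) *
            2 ^ (-(m * δ * (Finset.univ.sup j : ℕ))))

end SparseDomination

end

open SparseDomination

namespace SparseDomination

/-! The core is a pointwise bound: almost everywhere |T f| is at most a constant times a finite sum
of sparse operators, the number of summands being fixed before f. The quasi-triangle inequality then
costs only a fixed power of the constant.

Local step (`exists_stopping_family`). For a cube Q let g be f truncated to a large ball around Q.
The weak type bounds for the maximal function and for T give a set Ω of measure at most |Q|/4 such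
that every ball centred off Ω has controlled L^p size of each g_i and only a small proportion of
points where |T g| is large. The maximal grid cubes inside Ω are the children of Q. Off the
children, differentiation bounds |T g| by the product of the sizes of the f_i near Q. On a child P,
the difference of T g and of T applied to the truncation near P is a sum of terms in which some
entry vanishes near P. Kernel regularity bounds its oscillation over P, and P contains points where
both operators are small, so the difference itself is bounded (`exists_enorm_sub_truncate_le`). What
remains on P is the same problem one level down.

Tree. In the chosen grid the cubes containing the origin exhaust space. Linking them into a chain
makes one tree serve all of ℝⁿ. Each cube keeps a quarter of its measure outside its children, so
below a fixed origin cube almost every point lies in finitely many tree cubes and the estimates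
telescope (`IsChildMap.ae_enorm_le`). Along the chain the truncation error tends to 0, so f need not
have compact support.

Sparse families. The sizes live on balls larger than Q. The one-third trick puts each such ball in a
comparable cube of one of finitely many shifted grids (`exists_ball_subset_gridCube`). The enlarged
cubes satisfy only a Carleson condition with a larger constant, and `exists_sparse_cover` splits
them into families with the required constant 2. -/

/-! ### Shifted dyadic grids -/

/-- The sign `± (-1) ^ k` governing the shift of the cubes of side `2 ^ k`. -/
def gridSign {n : ℕ} (σ : Fin n → ℤˣ) (k : ℤ) (i : Fin n) : ℤ := ((σ i * (-1) ^ k : ℤˣ) : ℤ)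

lemma gridSign_eq {n : ℕ} (σ : Fin n → ℤˣ) (k : ℤ) (i : Fin n) :
    gridSign σ k i = 1 ∨ gridSign σ k i = -1 := by
  rcases Int.units_eq_one_or (σ i * (-1) ^ k) with h | h <;> simp [gridSign, h]

lemma gridSign_succ {n : ℕ} (σ : Fin n → ℤˣ) (k : ℤ) (i : Fin n) :
    gridSign σ (k + 1) i = -gridSign σ k i := by
  simp [gridSign, zpow_add]

/-- The label of the cube of side `2 ^ k` containing `x`. -/
noncomputable def gridIndex {n : ℕ} (σ : Fin n → ℤˣ) (k : ℤ) (x : Space n) (i : Fin n) : ℤ :=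
  ⌊x i / 2 ^ k - gridSign σ k i / 3⌋

/-- The cube with label `Q.2` of side `2 ^ Q.1`. -/
def gridCube {n : ℕ} (σ : Fin n → ℤˣ) (Q : ℤ × (Fin n → ℤ)) : Set (Space n) :=
  {x | gridIndex σ Q.1 x = Q.2}

/-- The lower corner of a cube. -/
noncomputable def gridCorner {n : ℕ} (σ : Fin n → ℤˣ) (Q : ℤ × (Fin n → ℤ)) : Space n :=
  WithLp.toLp 2 fun i => 2 ^ Q.1 * (Q.2 i + gridSign σ Q.1 i / 3)

/-- A dyadic grid with shifts `± 1 / 3`. -/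
def shiftedGrid {n : ℕ} (σ : Fin n → ℤˣ) : Set (Set (Space n)) := range (gridCube σ)

/-- The alternating sign is what makes the grid nested: since (-1/3 + 1)/2 = 1/3, the shifts of
consecutive levels fit together and the label of the parent depends only on the label of the child.
-/
lemma gridIndex_succ {n : ℕ} (σ : Fin n → ℤˣ) (k : ℤ) (x : Space n) (i : Fin n) :
    gridIndex σ (k + 1) x i = (gridIndex σ k x i + gridSign σ k i) / 2 := by
  unfold gridIndex
  rw [gridSign_succ, ← Int.floor_add_intCast]
  have h := Int.floor_div_natCast (x i / 2 ^ k - gridSign σ k i / 3 + gridSign σ k i : ℝ) 2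
  push_cast at h
  rw [← h, zpow_add₀ (by norm_num)]
  congr 1
  push_cast
  field_simp
  ring

lemma gridIndex_eq_of_le {n : ℕ} (σ : Fin n → ℤˣ) {k l : ℤ} (hkl : k ≤ l) {x y : Space n}
    (h : gridIndex σ k x = gridIndex σ k y) : gridIndex σ l x = gridIndex σ l y := by
  induction l, hkl using Int.leInduction with
  | base => exact h
  | succ l _ ih => ext i; rw [gridIndex_succ, gridIndex_succ, ih]

lemma mem_gridCube_iff {n : ℕ} {σ : Fin n → ℤˣ} {Q : ℤ × (Fin n → ℤ)} {x : Space n} :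
    x ∈ gridCube σ Q ↔
      ∀ i, gridCorner σ Q i ≤ x i ∧ x i < gridCorner σ Q i + 2 ^ Q.1 := by
  have h2 : (0 : ℝ) < 2 ^ Q.1 := by positivity
  simp only [gridCube, mem_ofPred_eq, funext_iff, gridIndex, Int.floor_eq_iff, gridCorner]
  refine forall_congr' fun i => ?_
  rw [le_sub_iff_add_le, sub_lt_iff_lt_add, le_div_iff₀' h2, div_lt_iff₀' h2]
  have : (2 : ℝ) ^ Q.1 * (Q.2 i + 1 + gridSign σ Q.1 i / 3) =
    2 ^ Q.1 * (Q.2 i + gridSign σ Q.1 i / 3) + 2 ^ Q.1 := by ring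
  rw [this]

lemma gridCorner_mem {n : ℕ} (σ : Fin n → ℤˣ) (Q : ℤ × (Fin n → ℤ)) :
    gridCorner σ Q ∈ gridCube σ Q :=
  mem_gridCube_iff.2 fun i => ⟨le_rfl, by simp; positivity⟩

lemma mem_gridCube_gridIndex {n : ℕ} (σ : Fin n → ℤˣ) (k : ℤ) (x : Space n) :
    x ∈ gridCube σ (k, gridIndex σ k x) := rfl

lemma isCubeOfSide_gridCube {n : ℕ} (σ : Fin n → ℤˣ) (Q : ℤ × (Fin n → ℤ)) :
    IsCubeOfSide (gridCube σ Q) (2 ^ Q.1) :=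
  ⟨gridCorner σ Q, by ext x; exact mem_gridCube_iff⟩

lemma volume_box {n : ℕ} (a : Space n) (s : ℝ) :
    volume {x : Space n | ∀ i, a i ≤ x i ∧ x i < a i + s} = ENNReal.ofReal s ^ n := by
  have : {x : Space n | ∀ i, a i ≤ x i ∧ x i < a i + s} =
      WithLp.ofLp ⁻¹' (univ.pi fun i => Ico (a i) (a i + s)) := by
    ext x; simp [Set.mem_pi]
  rw [this, (PiLp.volume_preserving_ofLp (Fin n)).measure_preimage
    (MeasurableSet.univ_pi fun i => measurableSet_Ico).nullMeasurableSet, volume_pi_pi]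
  simp

lemma volume_gridCube {n : ℕ} (σ : Fin n → ℤˣ) (Q : ℤ × (Fin n → ℤ)) :
    volume (gridCube σ Q) = ENNReal.ofReal (2 ^ Q.1) ^ n := by
  obtain ⟨a, ha⟩ := isCubeOfSide_gridCube σ Q
  rw [ha, volume_box]

lemma volume_gridCube_pos {n : ℕ} (σ : Fin n → ℤˣ) (Q : ℤ × (Fin n → ℤ)) :
    volume (gridCube σ Q) ≠ 0 := by
  rw [volume_gridCube]
  exact pow_ne_zero _ (by simp; positivity)

lemma volume_gridCube_ne_top {n : ℕ} (σ : Fin n → ℤˣ) (Q : ℤ × (Fin n → ℤ)) :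
    volume (gridCube σ Q) ≠ ∞ := by
  rw [volume_gridCube]
  exact ENNReal.pow_ne_top ENNReal.ofReal_ne_top

@[fun_prop]
lemma measurable_gridIndex {n : ℕ} (σ : Fin n → ℤˣ) (k : ℤ) : Measurable (gridIndex σ k) := by
  refine measurable_pi_lambda _ fun i => ?_
  unfold gridIndex
  fun_prop

lemma measurableSet_gridCube {n : ℕ} (σ : Fin n → ℤˣ) (Q : ℤ × (Fin n → ℤ)) :
    MeasurableSet (gridCube σ Q) :=
  measurable_gridIndex σ Q.1 (measurableSet_singleton Q.2)

lemma eq_of_isCubeOfSide {n : ℕ} (hn : 0 < n) {Q : Set (Space n)} {k l : ℤ}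
    (hk : IsCubeOfSide Q (2 ^ k)) (hl : IsCubeOfSide Q (2 ^ l)) : k = l := by
  obtain ⟨a, ha⟩ := hk
  obtain ⟨b, hb⟩ := hl
  have h : volume Q = volume Q := rfl
  nth_rewrite 1 [ha] at h
  rw [hb, volume_box, volume_box] at h
  have h1 : ENNReal.ofReal ((2 : ℝ) ^ k) = ENNReal.ofReal (2 ^ l) :=
    (ENNReal.pow_right_strictMono hn.ne').injective h
  rw [ENNReal.ofReal_eq_ofReal_iff (by positivity) (by positivity)] at h1
  exact zpow_right_injective₀ (by norm_num) (by norm_num) h1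

lemma gridCube_injective {n : ℕ} (hn : 0 < n) (σ : Fin n → ℤˣ) :
    Function.Injective (gridCube σ) := by
  intro Q R h
  have hk : Q.1 = R.1 := eq_of_isCubeOfSide hn (isCubeOfSide_gridCube σ Q)
    (h ▸ isCubeOfSide_gridCube σ R)
  have hm : gridCorner σ Q ∈ gridCube σ R := h ▸ gridCorner_mem σ Q
  have hm' : gridIndex σ Q.1 (gridCorner σ Q) = Q.2 := gridCorner_mem σ Q
  exact Prod.ext hk (by rw [← hm', hk]; exact hm)

lemma gridCube_subset_of_mem {n : ℕ} {σ : Fin n → ℤˣ} {Q R : ℤ × (Fin n → ℤ)} (hk : Q.1 ≤ R.1)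
    {x : Space n} (hQ : x ∈ gridCube σ Q) (hR : x ∈ gridCube σ R) :
    gridCube σ Q ⊆ gridCube σ R := fun _ hy =>
  (gridIndex_eq_of_le σ hk ((hy : _ = _).trans (hQ : _ = _).symm)).trans hR

lemma gridCube_nested {n : ℕ} (σ : Fin n → ℤˣ) (Q R : ℤ × (Fin n → ℤ)) :
    gridCube σ Q ⊆ gridCube σ R ∨ gridCube σ R ⊆ gridCube σ Q ∨
      Disjoint (gridCube σ Q) (gridCube σ R) := by
  by_cases h : Disjoint (gridCube σ Q) (gridCube σ R)
  · exact Or.inr (Or.inr h)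
  obtain ⟨x, hQ, hR⟩ := not_disjoint_iff.1 h
  rcases le_total Q.1 R.1 with hk | hk
  · exact Or.inl (gridCube_subset_of_mem hk hQ hR)
  · exact Or.inr (Or.inl (gridCube_subset_of_mem hk hR hQ))

lemma isDyadicGrid_shiftedGrid {n : ℕ} (hn : 0 < n) (σ : Fin n → ℤˣ) :
    IsDyadicGrid (shiftedGrid σ) where
  side := by
    rintro _ ⟨Q, rfl⟩
    exact ⟨Q.1, isCubeOfSide_gridCube σ Q⟩
  nested := by
    rintro _ ⟨Q, rfl⟩ _ ⟨R, rfl⟩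
    rcases gridCube_nested σ Q R with h | h | h
    · exact Or.inl (inter_eq_left.2 h)
    · exact Or.inr (Or.inl (inter_eq_right.2 h))
    · exact Or.inr (Or.inr h.inter_eq)
  partition := by
    intro k x
    refine ⟨gridCube σ (k, gridIndex σ k x), ⟨⟨_, rfl⟩, isCubeOfSide_gridCube σ _, rfl⟩, ?_⟩
    rintro _ ⟨⟨Q, rfl⟩, hQ, hx⟩
    have hk : Q.1 = k := eq_of_isCubeOfSide hn (isCubeOfSide_gridCube σ Q) hQ
    congr 1
    refine Prod.ext hk ?_
    rw [← (hx : _ = _), hk]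

lemma countable_shiftedGrid {n : ℕ} (σ : Fin n → ℤˣ) : (shiftedGrid σ).Countable :=
  countable_range _

lemma norm_le_of_abs_le {n : ℕ} {x : Space n} {s : ℝ} (h : ∀ i, |x i| ≤ s) (hs : 0 ≤ s) :
    ‖x‖ ≤ n * s := by
  rw [EuclideanSpace.norm_eq]
  refine Real.sqrt_le_iff.2 ⟨by positivity, ?_⟩
  calc ∑ i, ‖x i‖ ^ 2 ≤ ∑ _i : Fin n, s ^ 2 :=
        Finset.sum_le_sum fun i _ => pow_le_pow_left₀ (norm_nonneg _) (h i) 2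
    _ = n * s ^ 2 := by simp
    _ ≤ (n * s) ^ 2 := by
      rw [mul_pow]
      gcongr
      exact_mod_cast Nat.le_self_pow two_ne_zero n

lemma dist_le_of_mem_gridCube {n : ℕ} {σ : Fin n → ℤˣ} {Q : ℤ × (Fin n → ℤ)} {x y : Space n}
    (hx : x ∈ gridCube σ Q) (hy : y ∈ gridCube σ Q) : dist x y ≤ n * 2 ^ Q.1 := by
  rw [dist_eq_norm]
  refine norm_le_of_abs_le (fun i => ?_) (by positivity)
  have h1 := mem_gridCube_iff.1 hx i
  have h2 := mem_gridCube_iff.1 hy i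
  rw [PiLp.sub_apply, abs_le]
  constructor <;> linarith [h1.1, h1.2, h2.1, h2.2]

/-- At every scale the origin keeps a distance of one third of the side from the boundary of its
cube, so its cube contains any given point once the scale is large. -/
lemma gridIndex_eventually_eq {n : ℕ} (σ : Fin n → ℤˣ) (x : Space n) :
    ∀ᶠ k : ℤ in atTop, gridIndex σ k x = gridIndex σ k 0 := by
  obtain ⟨N, hN⟩ := pow_unbounded_of_one_lt (3 * ‖x‖) (by norm_num : (1 : ℝ) < 2)
  filter_upwards [eventually_ge_atTop (N : ℤ)] with k hk'
  have hk : 3 * ‖x‖ < 2 ^ k := by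
    refine hN.trans_le ?_
    rw [← zpow_natCast]
    gcongr
    norm_num
  have h2 : (0 : ℝ) < 2 ^ k := by positivity
  ext i
  have hx : |x i / 2 ^ k| < 1 / 3 := by
    rw [abs_div, abs_of_pos h2, div_lt_iff₀ h2]
    have := PiLp.norm_apply_le x i
    rw [Real.norm_eq_abs] at this
    linarith
  rw [abs_lt] at hx
  unfold gridIndex
  rcases gridSign_eq σ k i with h | h <;> rw [h]
  · trans -1
    · rw [Int.floor_eq_iff]
      push_cast
      constructor <;> linarith [hx.1, hx.2]
    · symm
      rw [Int.floor_eq_iff]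
      norm_num
  · trans 0
    · rw [Int.floor_eq_iff]
      push_cast
      constructor <;> linarith [hx.1, hx.2]
    · symm
      rw [Int.floor_eq_iff]
      norm_num

/-- Among the two shifts `± 1 / 3` there is one for which a short interval contains no end point
of the grid. -/
lemma exists_floor_eq (X Y : ℝ) (h : Y - X < 1 / 3) :
    ∃ e : ℤˣ, ∀ Z ∈ Icc X Y, ⌊Z - ((e : ℤ) : ℝ) / 3⌋ = ⌊X - ((e : ℤ) : ℝ) / 3⌋ := by
  by_contra! hcon
  obtain ⟨Z, hZ, h1⟩ := hcon 1
  obtain ⟨W, hW, h2⟩ := hcon (-1)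
  have hp : ⌊X - (((1 : ℤˣ) : ℤ) : ℝ) / 3⌋ < ⌊Z - (((1 : ℤˣ) : ℤ) : ℝ) / 3⌋ :=
    lt_of_le_of_ne (Int.floor_le_floor (by linarith [hZ.1])) (Ne.symm h1)
  have hq : ⌊X - (((-1 : ℤˣ) : ℤ) : ℝ) / 3⌋ < ⌊W - (((-1 : ℤˣ) : ℤ) : ℝ) / 3⌋ :=
    lt_of_le_of_ne (Int.floor_le_floor (by linarith [hW.1])) (Ne.symm h2)
  rw [Int.floor_lt] at hp hq
  have hp' := Int.floor_le (Z - (((1 : ℤˣ) : ℤ) : ℝ) / 3)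
  have hq' := Int.floor_le (W - (((-1 : ℤˣ) : ℤ) : ℝ) / 3)
  set p := ⌊Z - (((1 : ℤˣ) : ℤ) : ℝ) / 3⌋
  set q := ⌊W - (((-1 : ℤˣ) : ℤ) : ℝ) / 3⌋
  push_cast at hp hq hp' hq'
  -- The end points p + 1/3 and q - 1/3 both lie in (X, Y], so they differ by less than 1/3, which
  -- puts q - p strictly between 1/3 and 1.
  have h3 : (0 : ℝ) < q - p := by linarith [hZ.2, hW.2]
  have h4 : (q : ℝ) - p < 1 := by linarith [hZ.2, hW.2]
  have h3' : (0 : ℤ) < q - p := by exact_mod_cast h3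
  have h4' : q - p < (1 : ℤ) := by exact_mod_cast h4
  omega

lemma exists_ball_subset_gridCube {n : ℕ} (c : Space n) {r : ℝ} (k : ℤ) (hr : 6 * r < 2 ^ k) :
    ∃ (σ : Fin n → ℤˣ) (Q : ℤ × (Fin n → ℤ)), Q.1 = k ∧ Metric.ball c r ⊆ gridCube σ Q := by
  rcases le_or_gt r 0 with h0 | h0
  · exact ⟨1, (k, 0), rfl, by rw [Metric.ball_eq_empty.2 h0]; exact empty_subset _⟩
  have h2 : (0 : ℝ) < 2 ^ k := by positivity
  have h : ∀ i, ∃ e : ℤˣ, ∀ Z ∈ Icc ((c i - r) / 2 ^ k) ((c i + r) / 2 ^ k),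
      ⌊Z - ((e : ℤ) : ℝ) / 3⌋ = ⌊(c i - r) / 2 ^ k - ((e : ℤ) : ℝ) / 3⌋ := by
    intro i
    refine exists_floor_eq _ _ ?_
    rw [← sub_div, div_lt_iff₀ h2]
    linarith
  choose e he using h
  -- The second factor cancels the alternation, so that the sign at level k is exactly `e i`.
  refine ⟨fun i => e i * ((-1) ^ k)⁻¹,
    (k, fun i => ⌊(c i - r) / 2 ^ k - ((e i : ℤ) : ℝ) / 3⌋), rfl, fun x hx => ?_⟩
  ext i
  have hs : gridSign (fun i => e i * ((-1) ^ k)⁻¹) k i = e i := by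
    simp only [gridSign, inv_mul_cancel_right]
  simp only [gridIndex, hs]
  refine he i _ ?_
  have hxi : |x i - c i| < r := by
    have := PiLp.norm_apply_le (x - c) i
    rw [← dist_eq_norm] at this
    exact lt_of_le_of_lt (by simpa using this) hx
  rw [abs_lt] at hxi
  constructor <;> gcongr <;> linarith [hxi.1, hxi.2]

/-! ### Splitting families with a Carleson condition into sparse families -/

section Splitting

variable {n : ℕ} {σ : Fin n → ℤˣ} {F G : Set (Set (Space n))}

lemma shiftedGrid_nested {Q R : Set (Space n)} (hQ : Q ∈ shiftedGrid σ) (hR : R ∈ shiftedGrid σ) :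
    Q ⊆ R ∨ R ⊂ Q ∨ Disjoint Q R := by
  obtain ⟨Q, rfl⟩ := hQ
  obtain ⟨R, rfl⟩ := hR
  rcases gridCube_nested σ Q R with h | h | h
  · exact Or.inl h
  · by_cases h' : gridCube σ Q ⊆ gridCube σ R
    · exact Or.inl h'
    · exact Or.inr (Or.inl ⟨h, h'⟩)
  · exact Or.inr (Or.inr h)

lemma measurableSet_of_mem_shiftedGrid {Q : Set (Space n)} (hQ : Q ∈ shiftedGrid σ) :
    MeasurableSet Q := by
  obtain ⟨Q, rfl⟩ := hQ
  exact measurableSet_gridCube σ Q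

lemma volume_ne_top_of_mem_shiftedGrid {Q : Set (Space n)} (hQ : Q ∈ shiftedGrid σ) :
    volume Q ≠ ∞ := by
  obtain ⟨Q, rfl⟩ := hQ
  exact volume_gridCube_ne_top σ Q

/-- The set attached to R is R without its proper subcubes in the family; nestedness makes these
sets disjoint. -/
lemma isSparse_of_volume_iUnion_le (hG : G ⊆ shiftedGrid σ)
    (h : ∀ R ∈ G, 2 * volume (⋃ R' ∈ {R' ∈ G | R' ⊂ R}, R') ≤ volume R) : IsSparse G := by
  have hc : G.Countable := (countable_shiftedGrid σ).mono hG
  have hmeas : ∀ R, MeasurableSet (⋃ R' ∈ {R' ∈ G | R' ⊂ R}, R') := fun R =>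
    MeasurableSet.biUnion (hc.mono fun _ h => h.1) fun R' hR' =>
      measurableSet_of_mem_shiftedGrid (hG hR'.1)
  refine ⟨fun R => R \ ⋃ R' ∈ {R' ∈ G | R' ⊂ R}, R', fun R hR => ⟨?_, sdiff_subset, ?_⟩, ?_⟩
  · exact (measurableSet_of_mem_shiftedGrid (hG hR)).diff (hmeas R)
  · set U := ⋃ R' ∈ {R' ∈ G | R' ⊂ R}, R' with hU
    have hfin := volume_ne_top_of_mem_shiftedGrid (hG hR)
    have h1 : volume R ≤ volume (R \ U) + volume U := by
      rw [← measure_union disjoint_sdiff_left (hmeas R)]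
      exact measure_mono (by simp)
    have h2 : volume R + volume R ≤ 2 * volume (R \ U) + volume R := by
      calc volume R + volume R = 2 * volume R := (two_mul _).symm
        _ ≤ 2 * (volume (R \ U) + volume U) := by gcongr
        _ = 2 * volume (R \ U) + 2 * volume U := mul_add _ _ _
        _ ≤ _ := by gcongr; exact h R hR
    exact (ENNReal.add_le_add_iff_right hfin).1 h2
  · intro Q hQ R hR hne
    have key : ∀ Q ∈ G, ∀ R ∈ G, Q ⊂ R →
        Disjoint Q (R \ ⋃ R' ∈ {R' ∈ G | R' ⊂ R}, R') := by
      intro Q hQ R hR hlt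
      refine disjoint_left.2 fun x hx hx' => hx'.2 ?_
      exact mem_biUnion (show Q ∈ {R' ∈ G | R' ⊂ R} from ⟨hQ, hlt⟩) hx
    rcases shiftedGrid_nested (hG hQ) (hG hR) with h | h | h
    · exact (key Q hQ R hR (h.ssubset_of_ne hne)).mono_left sdiff_subset
    · exact ((key R hR Q hQ h).mono_left sdiff_subset).symm
    · exact h.mono sdiff_subset sdiff_subset

/-- Such cubes form a chain: the proper subcubes of R in the family all lie in the cube of half the
side around the origin, whose volume is 2^(-n) |R| ≤ |R|/2. -/
lemma isSparse_of_forall_zero_mem (hn : 0 < n) (hG : G ⊆ shiftedGrid σ) (h0 : ∀ R ∈ G, 0 ∈ R) :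
    IsSparse G := by
  refine isSparse_of_volume_iUnion_le hG fun R hR => ?_
  have hR0 := h0 R hR
  obtain ⟨⟨k, a⟩, rfl⟩ := hG hR
  have hsub : (⋃ R' ∈ {R' ∈ G | R' ⊂ gridCube σ (k, a)}, R') ⊆
      gridCube σ (k - 1, gridIndex σ (k - 1) 0) := by
    refine iUnion₂_subset fun R' hR' => ?_
    have hR0' := h0 R' hR'.1
    obtain ⟨⟨l, b⟩, rfl⟩ := hG hR'.1
    refine gridCube_subset_of_mem ?_ hR0' rfl
    by_contra! hcon
    refine hR'.2.2 (gridCube_subset_of_mem ?_ hR0 hR0')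
    simp only at hcon ⊢
    omega
  calc _ ≤ 2 * volume (gridCube σ (k - 1, gridIndex σ (k - 1) 0)) := by gcongr
    _ ≤ 2 ^ n * volume (gridCube σ (k - 1, gridIndex σ (k - 1) 0)) := by
        gcongr
        exact le_self_pow₀ (by norm_num) hn.ne'
    _ = _ := by
        have h2 : (2 : ℝ≥0∞) * ENNReal.ofReal (2 ^ (k - 1)) = ENNReal.ofReal (2 ^ k) := by
          rw [← ENNReal.ofReal_ofNat 2, ← ENNReal.ofReal_mul (by norm_num),
            zpow_sub_one₀ (by norm_num)]
          congr 1
          field_simp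
        rw [volume_gridCube, volume_gridCube, ← mul_pow, h2]

/-! ### Generations of cubes that avoid the origin. -/

/-- The strict ancestors of `R` in `F`. -/
def ancestors (F : Set (Set (Space n))) (R : Set (Space n)) : Set (Set (Space n)) :=
  {R' ∈ F | R ⊂ R'}

/-- All large cubes around a given point contain the origin, so ancestors avoiding it occur at
finitely many scales. This is why the cubes containing the origin are treated separately: their
number of ancestors may be infinite. -/
lemma finite_ancestors (hF : F ⊆ shiftedGrid σ) (h0 : ∀ R ∈ F, (0 : Space n) ∉ R)
    {R : Set (Space n)} (hR : R ∈ F) : (ancestors F R).Finite := by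
  obtain ⟨⟨k, a⟩, rfl⟩ := hF hR
  have hx := gridCorner_mem σ (k, a)
  set x := gridCorner σ (k, a)
  obtain ⟨k₀, hk₀⟩ := eventually_atTop.1 (gridIndex_eventually_eq σ x)
  refine ((finite_Icc k k₀).image fun l => gridCube σ (l, gridIndex σ l x)).subset ?_
  rintro R' ⟨hR', hlt⟩
  have hx' : x ∈ R' := hlt.1 hx
  have h0' := h0 R' hR'
  obtain ⟨⟨l, b⟩, rfl⟩ := hF hR'
  have hb : gridIndex σ l x = b := hx'
  refine ⟨l, ⟨?_, ?_⟩, by simp only [hb]⟩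
  · by_contra! hcon
    exact hlt.2 (gridCube_subset_of_mem hcon.le hx' hx)
  · by_contra! hcon
    exact h0' ((hk₀ l hcon.le).symm.trans hb)

lemma ncard_between (hF : F ⊆ shiftedGrid σ) (h0 : ∀ R ∈ F, (0 : Space n) ∉ R)
    {Q R : Set (Space n)} (hQ : Q ∈ F) (hR : R ∈ F) (hQR : Q ⊂ R) :
    {P ∈ F | Q ⊂ P ∧ P ⊆ R}.Finite ∧
      (ancestors F Q).ncard = (ancestors F R).ncard + {P ∈ F | Q ⊂ P ∧ P ⊆ R}.ncard := by
  have hfin : {P ∈ F | Q ⊂ P ∧ P ⊆ R}.Finite :=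
    (finite_ancestors hF h0 hQ).subset fun P hP => ⟨hP.1, hP.2.1⟩
  refine ⟨hfin, ?_⟩
  rw [← ncard_union_eq _ (finite_ancestors hF h0 hR) hfin]
  · congr 1
    ext P
    constructor
    · rintro ⟨hP, hlt⟩
      rcases shiftedGrid_nested (hF hP) (hF hR) with h | h | h
      · exact Or.inr ⟨hP, hlt, h⟩
      · exact Or.inl ⟨hP, h⟩
      · obtain ⟨Q, rfl⟩ := hF hQ
        exact absurd (hQR.1 (gridCorner_mem σ Q)) (disjoint_left.1 h (hlt.1 (gridCorner_mem σ Q)))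
    · rintro (⟨hP, hlt⟩ | ⟨hP, hlt, -⟩)
      · exact ⟨hP, hQR.trans hlt⟩
      · exact ⟨hP, hlt⟩
  · exact disjoint_left.2 fun P h1 h2 => h1.2.2 h2.2.2

lemma tsum_volume_le {Λ : ℝ≥0∞} {E : Set (Space n) → Set (Space n)} (hF : F ⊆ shiftedGrid σ)
    (hE : ∀ Q ∈ F, MeasurableSet (E Q) ∧ E Q ⊆ Q ∧ volume Q ≤ Λ * volume (E Q))
    (hd : F.PairwiseDisjoint E) (R : Set (Space n)) :
    ∑' P : {P ∈ F | P ⊆ R}, volume (P : Set (Space n)) ≤ Λ * volume R := by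
  have : Countable {P ∈ F | P ⊆ R} :=
    ((countable_shiftedGrid σ).mono (fun P hP => hF hP.1)).to_subtype
  calc ∑' P : {P ∈ F | P ⊆ R}, volume (P : Set (Space n))
      ≤ ∑' P : {P ∈ F | P ⊆ R}, Λ * volume (E P) :=
        ENNReal.tsum_le_tsum fun P => (hE P P.2.1).2.2
    _ = Λ * ∑' P : {P ∈ F | P ⊆ R}, volume (E P) := ENNReal.tsum_mul_left
    _ = Λ * volume (⋃ P : {P ∈ F | P ⊆ R}, E P) := by
        rw [measure_iUnion]
        · intro P Q hPQ
          exact hd P.2.1 Q.2.1 fun h => hPQ (Subtype.ext h)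
        · exact fun P => (hE P P.2.1).1
    _ ≤ Λ * volume R := by
        gcongr
        exact iUnion_subset fun P => (hE P P.2.1).2.1.trans P.2.2

/-- Keeping one generation in every 2N, a point covered by a proper subcube of R in the same class
lies in at least 2N cubes of `F` inside R. The volumes of all cubes of `F` inside R add up to at
most N |R|, so Chebyshev's inequality bounds the covered part by |R|/2. -/
lemma isSparse_of_ncard_modEq {N : ℕ} (hN : 0 < N) {E : Set (Space n) → Set (Space n)}
    (hF : F ⊆ shiftedGrid σ) (h0 : ∀ R ∈ F, (0 : Space n) ∉ R)
    (hE : ∀ Q ∈ F, MeasurableSet (E Q) ∧ E Q ⊆ Q ∧ volume Q ≤ N * volume (E Q))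
    (hd : F.PairwiseDisjoint E) (i : ℕ) :
    IsSparse {R ∈ F | (ancestors F R).ncard % (2 * N) = i} := by
  refine isSparse_of_volume_iUnion_le (fun R hR => hF hR.1) fun R hR => ?_
  set G := {R ∈ F | (ancestors F R).ncard % (2 * N) = i}
  set U := ⋃ R' ∈ {R' ∈ G | R' ⊂ R}, R'
  have hcount : Countable {P ∈ F | P ⊆ R} :=
    ((countable_shiftedGrid σ).mono (fun P hP => hF hP.1)).to_subtype
  have hUm : MeasurableSet U := by
    refine MeasurableSet.biUnion ((countable_shiftedGrid σ).mono fun P hP => hF hP.1.1) ?_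
    exact fun P hP => measurableSet_of_mem_shiftedGrid (hF hP.1.1)
  have hlow : ∀ x ∈ U, ((2 * N : ℕ) : ℝ≥0∞) ≤
      ∑' P : {P ∈ F | P ⊆ R}, (P : Set (Space n)).indicator 1 x := by
    intro x hx
    simp only [U, mem_iUnion] at hx
    obtain ⟨Q, ⟨⟨hQF, hQi⟩, hQR⟩, hxQ⟩ := hx
    obtain ⟨hfin, hcard⟩ := ncard_between hF h0 hQF hR.1 hQR
    set B := {P ∈ F | Q ⊂ P ∧ P ⊆ R}
    have hle : 2 * N ≤ B.ncard := by
      have h1 : (ancestors F R).ncard ≡ (ancestors F R).ncard + B.ncard [MOD 2 * N] := by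
        rw [← hcard]
        exact hR.2.trans hQi.symm
      have h2 : 2 * N ∣ B.ncard := by
        have := (Nat.modEq_iff_dvd' (Nat.le_add_right _ _)).1 h1
        simpa using this
      refine Nat.le_of_dvd ?_ h2
      exact (ncard_pos hfin).2 ⟨R, hR.1, hQR, le_rfl⟩
    have hBsub : B ⊆ {P ∈ F | P ⊆ R} := fun P hP => ⟨hP.1, hP.2.2⟩
    calc ((2 * N : ℕ) : ℝ≥0∞) ≤ (B.ncard : ℝ≥0∞) := by exact_mod_cast hle
      _ = ∑ P ∈ hfin.toFinset, (P : Set (Space n)).indicator (1 : Space n → ℝ≥0∞) x := by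
          rw [Finset.sum_congr rfl (g := fun _ => (1 : ℝ≥0∞)), ncard_eq_toFinset_card B hfin]
          · simp
          · intro P hP
            rw [Finite.mem_toFinset] at hP
            exact indicator_of_mem (hP.2.1.1 hxQ) _
      _ = ∑' P : B, (P : Set (Space n)).indicator (1 : Space n → ℝ≥0∞) x := by
          have := Finset.tsum_subtype hfin.toFinset
            (fun P : Set (Space n) => P.indicator (1 : Space n → ℝ≥0∞) x)
          refine this.symm.trans ?_
          exact tsum_congr_set_coe (fun P : Set (Space n) => P.indicator (1 : Space n → ℝ≥0∞) x)
            hfin.coe_toFinset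
      _ ≤ _ := ENNReal.tsum_mono_subtype
          (fun P : Set (Space n) => P.indicator (1 : Space n → ℝ≥0∞) x) hBsub
  have hbound : ((2 * N : ℕ) : ℝ≥0∞) * volume U ≤ N * volume R := by
    calc ((2 * N : ℕ) : ℝ≥0∞) * volume U = ∫⁻ _ in U, ((2 * N : ℕ) : ℝ≥0∞) := by simp
      _ ≤ ∫⁻ x in U, ∑' P : {P ∈ F | P ⊆ R}, (P : Set (Space n)).indicator 1 x :=
          setLIntegral_mono' hUm hlow
      _ ≤ ∫⁻ x, ∑' P : {P ∈ F | P ⊆ R}, (P : Set (Space n)).indicator 1 x :=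
          setLIntegral_le_lintegral _ _
      _ = ∑' P : {P ∈ F | P ⊆ R}, volume (P : Set (Space n)) := by
          rw [lintegral_tsum]
          · refine tsum_congr fun P => ?_
            rw [lintegral_indicator_one (measurableSet_of_mem_shiftedGrid (hF P.2.1))]
          · exact fun P => (measurable_one.indicator
              (measurableSet_of_mem_shiftedGrid (hF P.2.1))).aemeasurable
      _ ≤ N * volume R := tsum_volume_le hF hE hd R
  have hN' : (N : ℝ≥0∞) ≠ 0 := by exact_mod_cast hN.ne'
  rw [Nat.cast_mul, mul_comm ((2 : ℕ) : ℝ≥0∞), mul_assoc,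
    ENNReal.mul_le_mul_iff_right hN' (ENNReal.natCast_ne_top N)] at hbound
  exact_mod_cast hbound

/-- A family with a Carleson condition is a finite union of sparse families. -/
lemma exists_sparse_cover (hn : 0 < n) {N : ℕ} (hN : 0 < N) {E : Set (Space n) → Set (Space n)}
    (hF : F ⊆ shiftedGrid σ)
    (hE : ∀ Q ∈ F, MeasurableSet (E Q) ∧ E Q ⊆ Q ∧ volume Q ≤ N * volume (E Q))
    (hd : F.PairwiseDisjoint E) :
    ∃ G : Option (Fin (2 * N)) → Set (Set (Space n)),
      (∀ i, G i ⊆ F ∧ IsSparse (G i)) ∧ F ⊆ ⋃ i, G i := by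
  set F' := {R ∈ F | (0 : Space n) ∉ R}
  have hF' : F' ⊆ F := fun R hR => hR.1
  refine ⟨fun o => o.elim {R ∈ F | (0 : Space n) ∈ R}
    fun i => {R ∈ F' | (ancestors F' R).ncard % (2 * N) = i}, ?_, ?_⟩
  · rintro (_ | i)
    · exact ⟨fun R hR => hR.1,
        isSparse_of_forall_zero_mem hn (fun R hR => hF hR.1) fun R hR => hR.2⟩
    · exact ⟨fun R hR => hR.1.1, isSparse_of_ncard_modEq hN (hF'.trans hF) (fun R hR => hR.2)
        (fun R hR => hE R hR.1) (hd.subset hF') i⟩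
  · intro R hR
    by_cases h : (0 : Space n) ∈ R
    · exact mem_iUnion.2 ⟨none, hR, h⟩
    · exact mem_iUnion.2 ⟨some ⟨_, Nat.mod_lt _ (by omega)⟩, ⟨hR, h⟩, rfl⟩

end Splitting

/-! ### The weak type estimate for the maximal function of a measure -/

/-- The points around which the measure `ν` of some ball exceeds `A` times the `n`-th power of its
radius. -/
def largeDensity {n : ℕ} (ν : Measure (Space n)) (A : ℝ≥0∞) : Set (Space n) :=
  {x | ∃ r : ℝ, 0 < r ∧ A * ENNReal.ofReal r ^ n < ν (Metric.closedBall x r)}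

lemma measure_closedBall_le_of_notMem {n : ℕ} {ν : Measure (Space n)} {A : ℝ≥0∞} {x : Space n}
    (hx : x ∉ largeDensity ν A) {r : ℝ} (hr : 0 < r) :
    ν (Metric.closedBall x r) ≤ A * ENNReal.ofReal r ^ n := by
  by_contra! h
  exact hx ⟨r, hr, h⟩

/-- Vitali covering: fivefold enlargements of disjoint balls of large density cover the set, and the
ν-measures of the disjoint balls add up to at most the total mass. -/
lemma volume_largeDensity_le {n : ℕ} (hn : 0 < n) (ν : Measure (Space n)) [IsFiniteMeasure ν]
    {A : ℝ≥0∞} (hA : A ≠ 0) (hA' : A ≠ ∞) :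
    A * volume (largeDensity ν A) ≤
      ENNReal.ofReal 5 ^ n * volume (Metric.ball (0 : Space n) 1) * ν univ := by
  have : Nonempty (Fin n) := ⟨⟨0, hn⟩⟩
  set t : Set (Space n × ℝ) :=
    {p | 0 < p.2 ∧ A * ENNReal.ofReal p.2 ^ n < ν (Metric.closedBall p.1 p.2)}
  -- Vitali needs bounded radii. They are bounded because ν is finite: a radius above 1 is at most
  -- its n-th power, hence at most ν(ℝⁿ)/A.
  have hbound : ∃ R : ℝ, ∀ p ∈ t, p.2 ≤ R := by
    refine ⟨max 1 (ν univ / A).toReal, fun p hp => ?_⟩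
    by_contra! hcon
    have h1 : 1 < p.2 := (le_max_left _ _).trans_lt hcon
    have h2 : (ν univ / A).toReal < p.2 := (le_max_right _ _).trans_lt hcon
    have h3 : ν univ / A < ENNReal.ofReal p.2 := by
      rw [← ENNReal.ofReal_toReal (ENNReal.div_ne_top (measure_ne_top ν univ) hA)]
      exact (ENNReal.ofReal_lt_ofReal_iff (by linarith)).2 h2
    have h4 : ENNReal.ofReal p.2 ≤ ENNReal.ofReal p.2 ^ n :=
      le_self_pow₀ (by simpa using h1.le) hn.ne'
    have h5 : ν univ < A * ENNReal.ofReal p.2 := by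
      rw [mul_comm]
      exact (ENNReal.div_lt_iff (Or.inl hA) (Or.inl hA')).1 h3
    have h6 : A * ENNReal.ofReal p.2 ≤ A * ENNReal.ofReal p.2 ^ n := by gcongr
    exact absurd (measure_mono (subset_univ _)) (not_le.2 (h5.trans_le (h6.trans hp.2.le)))
  obtain ⟨R, hR⟩ := hbound
  obtain ⟨u, hut, hdisj, hcov⟩ := Vitali.exists_disjoint_subfamily_covering_enlargement_closedBall
    t (fun p => p.1) (fun p => p.2) R hR 5 (by norm_num)
  have hcount : u.Countable := by
    refine hdisj.countable_of_nonempty_interior fun p hp => ?_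
    exact (Metric.nonempty_ball.2 (hut hp).1).mono Metric.ball_subset_interior_closedBall
  have : Countable u := hcount.to_subtype
  have hsub : largeDensity ν A ⊆ ⋃ p : u, Metric.closedBall p.1.1 (5 * p.1.2) := by
    rintro x ⟨r, hr, hxr⟩
    obtain ⟨b, hb, hb'⟩ := hcov (x, r) ⟨hr, hxr⟩
    exact mem_iUnion.2 ⟨⟨b, hb⟩, hb' (Metric.mem_closedBall_self hr.le)⟩
  calc A * volume (largeDensity ν A)
      ≤ A * ∑' p : u, volume (Metric.closedBall p.1.1 (5 * p.1.2)) := by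
        gcongr
        exact (measure_mono hsub).trans (measure_iUnion_le _)
    _ = ∑' p : u, A * volume (Metric.closedBall p.1.1 (5 * p.1.2)) := ENNReal.tsum_mul_left.symm
    _ ≤ ∑' p : u, ENNReal.ofReal 5 ^ n * volume (Metric.ball (0 : Space n) 1) *
          ν (Metric.closedBall p.1.1 p.1.2) := by
        refine ENNReal.tsum_le_tsum fun p => ?_
        have hp := hut p.2
        rw [Measure.addHaar_closedBall _ _ (by linarith [hp.1]), finrank_euclideanSpace_fin,
          mul_pow, ENNReal.ofReal_mul (by norm_num), ENNReal.ofReal_pow (by norm_num),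
          ENNReal.ofReal_pow hp.1.le]
        calc _ = ENNReal.ofReal 5 ^ n * volume (Metric.ball (0 : Space n) 1) *
              (A * ENNReal.ofReal p.1.2 ^ n) := by ring
          _ ≤ _ := by gcongr; exact hp.2.le
    _ = ENNReal.ofReal 5 ^ n * volume (Metric.ball (0 : Space n) 1) *
          ν (⋃ p : u, Metric.closedBall p.1.1 p.1.2) := by
        rw [ENNReal.tsum_mul_left, measure_iUnion]
        · intro p q hpq
          exact hdisj p.2 q.2 fun h => hpq (Subtype.ext h)
        · exact fun p => Metric.isClosed_closedBall.measurableSet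
    _ ≤ _ := by gcongr; exact subset_univ _

/-! ### The oscillation estimate for Schwartz functions -/

lemma tsum_fin_prod {m : ℕ} (f : Fin m → ℕ → ℝ≥0∞) :
    ∑' j : Fin m → ℕ, ∏ i, f i (j i) = ∏ i, ∑' k, f i k := by
  induction m with
  | zero => simp
  | succ m ih =>
    rw [← (Fin.consEquiv fun _ : Fin (m + 1) => ℕ).tsum_eq, Fin.prod_univ_succ, ← ih]
    have h : ∀ q : ℕ × (Fin m → ℕ),
        ∏ i, f i ((Fin.consEquiv fun _ : Fin (m + 1) => ℕ) q i) =
          f 0 q.1 * ∏ i, f (Fin.succ i) (q.2 i) := by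
      intro q
      rw [Fin.prod_univ_succ]
      rfl
    rw [tsum_congr h, ENNReal.tsum_prod (f := fun (a : ℕ) (b : Fin m → ℕ) => f 0 a * ∏ i, f (Fin.succ i) (b i))]
    simp_rw [ENNReal.tsum_mul_left, ENNReal.tsum_mul_right]

lemma lintegral_fin_prod {E : Type*} [MeasurableSpace E] {m : ℕ} (μ : Fin m → Measure E)
    [∀ i, SigmaFinite (μ i)] (f : Fin m → E → ℝ≥0∞) (hf : ∀ i, Measurable (f i)) :
    ∫⁻ y, ∏ i, f i (y i) ∂Measure.pi μ = ∏ i, ∫⁻ x, f i x ∂μ i := by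
  induction m with
  | zero => simp
  | succ m ih =>
    rw [← ((measurePreserving_piFinSuccAbove μ 0).symm).lintegral_comp_emb
      (MeasurableEquiv.measurableEmbedding _), Fin.prod_univ_succ,
      ← ih (fun i => μ i.succ) _ fun i => hf i.succ]
    simp only [MeasurableEquiv.piFinSuccAbove_symm_apply, Fin.prod_univ_succ, Fin.insertNthEquiv,
      Equiv.coe_fn_mk, Fin.insertNth_zero, Fin.cons_zero, Fin.cons_succ, Fin.zero_succAbove,
      cast_eq]
    rw [lintegral_prod_mul (g := fun z : Fin m → E => ∏ i, f (Fin.succ i) (z i))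
      (hf 0).aemeasurable]
    refine Measurable.aemeasurable ?_
    exact Finset.measurable_prod _ fun i _ => (hf _).comp (measurable_pi_apply i)

lemma enorm_finset_prod {ι : Type*} (s : Finset ι) (f : ι → ℂ) :
    ‖∏ i ∈ s, f i‖ₑ = ∏ i ∈ s, ‖f i‖ₑ := by
  simp only [enorm, nnnorm_prod, ENNReal.ofNNReal_finsetProd]

lemma eLpNorm_fin_prod {E : Type*} [MeasurableSpace E] {m : ℕ} (μ : Fin m → Measure E)
    [∀ i, SigmaFinite (μ i)] (f : Fin m → E → ℂ) (hf : ∀ i, Measurable (f i)) {p : ℝ}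
    (hp : 0 < p) :
    eLpNorm (fun y : Fin m → E => ∏ i, f i (y i)) (ENNReal.ofReal p) (Measure.pi μ) =
      ∏ i, eLpNorm (f i) (ENNReal.ofReal p) (μ i) := by
  have hp0 : ENNReal.ofReal p ≠ 0 := by simpa using hp
  simp_rw [eLpNorm_eq_lintegral_rpow_enorm_toReal hp0 ENNReal.ofReal_ne_top,
    ENNReal.toReal_ofReal hp.le]
  rw [ENNReal.prod_rpow_of_nonneg (by positivity), ← lintegral_fin_prod]
  · congr 2
    ext y
    rw [enorm_finset_prod, ← ENNReal.prod_rpow_of_nonneg hp.le]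
  · exact fun i => ((hf i).enorm.pow_const _)

/-! ### Annuli and the decay of the kernel difference. -/

lemma exists_mem_annulus {n : ℕ} (c : Space n) {r : ℝ} (hr : 0 < r) (y : Space n) :
    ∃ j, y ∈ annulus c r j := by
  have h : ∃ j : ℕ, y ∈ Metric.ball c (2 ^ j * r) := by
    obtain ⟨j, hj⟩ := pow_unbounded_of_one_lt (dist y c / r) (by norm_num : (1 : ℝ) < 2)
    exact ⟨j, by rwa [Metric.mem_ball, ← div_lt_iff₀ hr]⟩
  classical
  refine ⟨Nat.find h, ?_⟩
  rcases hk : Nat.find h with _ | k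
  · have := Nat.find_spec h
    rw [hk] at this
    simpa [annulus] using this
  · refine ⟨hk ▸ Nat.find_spec h, Nat.find_min h (by omega)⟩

lemma measurableSet_annulus {n : ℕ} (c : Space n) (r : ℝ) (j : ℕ) :
    MeasurableSet (annulus c r j) := by
  cases j with
  | zero => exact measurableSet_ball
  | succ j => exact measurableSet_ball.diff measurableSet_ball

lemma annulus_subset_ball {n : ℕ} (c : Space n) {r : ℝ} (hr : 0 < r) {j J : ℕ} (h : j ≤ J) :
    annulus c r j ⊆ Metric.ball c (2 ^ J * r) := by
  have : annulus c r j ⊆ Metric.ball c (2 ^ j * r) := by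
    cases j with
    | zero => simp [annulus]
    | succ j => exact sdiff_subset
  refine this.trans (Metric.ball_subset_ball ?_)
  gcongr
  norm_num

/-- After d ≤ r all powers of r cancel, since m (δ - n/p) + m n/p = mδ. The growth 2^(J m n/p) of
the norms uses up only part of the decay 2^(-mδJ), and the surplus from δ > n/p makes the sum over
annuli converge. -/
lemma kernel_constant_le {C V r d δ p : ℝ} {n m : ℕ} (J : ℕ) (hn : 0 < n) (hC : 0 < C)
    (hV : 0 < V) (hr : 0 < r) (hd : 0 ≤ d) (hdr : d ≤ r) (hδ : n / p < δ) :
    C * (d ^ (m * (δ - n / p)) / (r ^ n * V) ^ (m * δ / n)) * 2 ^ (-(m * δ * J)) *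
      ((2 ^ J * r) ^ (n / p)) ^ m ≤
    C * V ^ (-(m * δ / n)) * 2 ^ (-(m * (δ - n / p) * J)) := by
  have h2 : (r ^ n * V) ^ (m * δ / n) = r ^ (m * δ) * V ^ (m * δ / n) := by
    rw [Real.mul_rpow (by positivity) hV.le, ← Real.rpow_natCast r n, ← Real.rpow_mul hr.le]
    congr 2
    field_simp
  have h3 : ((2 ^ J * r) ^ (n / p)) ^ m = (2 : ℝ) ^ (J * (n / p) * m) * r ^ (n / p * m) := by
    rw [Real.mul_rpow (by positivity) hr.le, mul_pow, ← Real.rpow_natCast 2 J,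
      ← Real.rpow_mul (by norm_num), ← Real.rpow_natCast _ m, ← Real.rpow_natCast _ m,
      ← Real.rpow_mul (by norm_num), ← Real.rpow_mul hr.le]
  rw [h2, h3]
  calc _ ≤ C * (r ^ (m * (δ - n / p)) / (r ^ (m * δ) * V ^ (m * δ / n))) * 2 ^ (-(m * δ * J)) *
        ((2 : ℝ) ^ (J * (n / p) * m) * r ^ (n / p * m)) := by gcongr
    _ = C * (V ^ (m * δ / n))⁻¹ * ((r ^ (m * (δ - n / p)) * r ^ (n / p * m)) / r ^ (m * δ)) *
        (2 ^ (-(m * δ * J)) * (2 : ℝ) ^ (J * (n / p) * m)) := by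
        field_simp
    _ = _ := by
        rw [← Real.rpow_add hr, ← Real.rpow_add (by norm_num), ← Real.rpow_neg hV.le,
          show m * (δ - n / p) + n / p * m = m * δ by ring, div_self (by positivity), mul_one]
        congr 2
        ring

/-- The decay of the kernel difference over a product of annuli, tested against a tensor product. -/
lemma lintegral_annuli_le {n m : ℕ} {p : ℝ} (hp : 1 ≤ p) {F : (Fin m → Space n) → ℂ}
    (hF : AEStronglyMeasurable F volume) {φ : Fin m → Space n → ℂ} (hφ : ∀ i, Measurable (φ i))
    (c : Space n) (r : ℝ) (j : Fin m → ℕ) :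
    ∫⁻ y in univ.pi fun k => annulus c r (j k), ‖F y * ∏ i, φ i (y i)‖ₑ ≤
      eLpNorm F (ENNReal.ofReal p).conjExponent
        (volume.restrict (univ.pi fun k => annulus c r (j k))) *
      ∏ i, eLpNorm (φ i) (ENNReal.ofReal p) (volume.restrict (annulus c r (j i))) := by
  have : (ENNReal.ofReal p).HolderConjugate (ENNReal.ofReal p).conjExponent :=
    ENNReal.HolderConjugate.conjExponent (by simpa using hp)
  have : (ENNReal.ofReal p).conjExponent.HolderConjugate (ENNReal.ofReal p) := this.symm
  have hprod : Measurable fun y : Fin m → Space n => ∏ i, φ i (y i) :=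
    Finset.measurable_prod _ fun i _ => (hφ i).comp (measurable_pi_apply i)
  rw [← eLpNorm_fin_prod _ _ hφ (by linarith), ← Measure.restrict_pi_pi, ← volume_pi,
    ← eLpNorm_one_eq_lintegral_enorm]
  have key := eLpNorm_smul_le_mul_eLpNorm (hpqr := this)
    (hprod.aestronglyMeasurable (μ := volume.restrict (univ.pi fun k => annulus c r (j k))))
    hF.restrict
  exact key

/-- The sum of the weights attached to the annuli. -/
noncomputable def annulusWeight (ε : ℝ) : ℝ≥0∞ := ∑' k : ℕ, ENNReal.ofReal (2 ^ (-(ε * k)))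

lemma annulusWeight_ne_top {ε : ℝ} (hε : 0 < ε) : annulusWeight ε ≠ ∞ := by
  have h : ∀ k : ℕ, (2 : ℝ) ^ (-(ε * k)) = (2 ^ (-ε)) ^ k := by
    intro k
    rw [← Real.rpow_natCast, ← Real.rpow_mul (by norm_num)]
    ring_nf
  unfold annulusWeight
  simp_rw [h]
  rw [← ENNReal.ofReal_tsum_of_nonneg (fun k => by positivity)]
  · exact ENNReal.ofReal_ne_top
  · refine summable_geometric_of_lt_one (by positivity) ?_
    exact Real.rpow_lt_one_of_one_lt_of_neg (by norm_num) (by linarith)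

/-- Since m times the maximum dominates the sum of the indices, decay in the largest index becomes a
product, and the sum over multi-indices factors into geometric series. -/
lemma ofReal_rpow_sup_le {m : ℕ} {ε : ℝ} (hε : 0 < ε) (j : Fin m → ℕ) :
    ENNReal.ofReal (2 ^ (-(m * ε * (Finset.univ.sup j : ℕ)))) ≤
      ∏ i, ENNReal.ofReal (2 ^ (-(ε * j i))) := by
  rw [← ENNReal.ofReal_prod_of_nonneg fun i _ => by positivity,
    ← Real.rpow_sum_of_pos (by norm_num)]
  refine ENNReal.ofReal_le_ofReal (Real.rpow_le_rpow_of_exponent_le (by norm_num) ?_)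
  rw [Finset.sum_neg_distrib, neg_le_neg_iff, ← Finset.mul_sum]
  have h : ∑ i, (j i : ℝ) ≤ ∑ _i : Fin m, ((Finset.univ.sup j : ℕ) : ℝ) :=
    Finset.sum_le_sum fun i _ => by exact_mod_cast Finset.le_sup (Finset.mem_univ i)
  simp only [Finset.sum_const, Finset.card_univ, Fintype.card_fin, nsmul_eq_mul] at h
  nlinarith

lemma volume_ball_toReal {n : ℕ} (hn : 0 < n) (c : Space n) {r : ℝ} (hr : 0 < r) :
    (volume (Metric.ball c r)).toReal =
      r ^ n * (volume (Metric.ball (0 : Space n) 1)).toReal := by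
  have : Nonempty (Fin n) := ⟨⟨0, hn⟩⟩
  rw [Measure.addHaar_ball _ _ hr.le, finrank_euclideanSpace_fin, ENNReal.toReal_mul,
    ENNReal.toReal_ofReal (by positivity)]

/-- The oscillation estimate for integrals against the kernel. -/
lemma exists_lintegral_kernel_le {n m : ℕ} (hn : 0 < n) {p : ℝ} (hp : 1 ≤ p)
    {K : Space n → (Fin m → Space n) → ℂ} (hK : ∀ x, AEStronglyMeasurable (K x) volume)
    (H2 : KernelRegularity p K) :
    ∃ C : ℝ≥0, ∀ (φ : Fin m → Space n → ℂ) (c : Space n) (r : ℝ) (w : Fin m → ℝ≥0∞) (i₀ : Fin m),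
      0 < r → (∀ i, Measurable (φ i)) → (∀ y ∈ Metric.ball c r, φ i₀ y = 0) →
      (∀ i (J : ℕ), eLpNorm (φ i) (ENNReal.ofReal p)
        (volume.restrict (Metric.ball c (2 ^ J * r))) ≤
          w i * ENNReal.ofReal (2 ^ J * r) ^ (n / p)) →
      ∀ x ∈ Metric.ball c (r / 2), ∀ x' ∈ Metric.ball c (r / 2),
        ∫⁻ y, ‖(K x y - K x' y) * ∏ i, φ i (y i)‖ₑ ≤ C * ∏ i, w i := by
  obtain ⟨δ, hδ, C, hC, H⟩ := H2
  set V := (volume (Metric.ball (0 : Space n) 1)).toReal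
  have hV : 0 < V := ENNReal.toReal_pos (Metric.measure_ball_pos _ _ one_pos).ne'
    measure_ball_lt_top.ne
  have hε : 0 < δ - n / p := by linarith
  set W := annulusWeight (δ - n / p)
  have hCfin : ENNReal.ofReal (C * V ^ (-(m * δ / n))) * W ^ m ≠ ∞ :=
    ENNReal.mul_ne_top ENNReal.ofReal_ne_top (ENNReal.pow_ne_top (annulusWeight_ne_top hε))
  refine ⟨(ENNReal.ofReal (C * V ^ (-(m * δ / n))) * W ^ m).toNNReal, ?_⟩
  intro φ c r w i₀ hr hφ hφ0 hw x hx x' hx'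
  rw [ENNReal.coe_toNNReal hCfin]
  have hmeas : AEStronglyMeasurable (fun y => K x y - K x' y) volume := (hK x).sub (hK x')
  have hdist : dist x x' ≤ r := by
    have := dist_triangle_right x x' c
    rw [Metric.mem_ball] at hx hx'
    linarith
  have hterm : ∀ j : Fin m → ℕ,
      ∫⁻ y in univ.pi fun k => annulus c r (j k), ‖(K x y - K x' y) * ∏ i, φ i (y i)‖ₑ ≤
        ENNReal.ofReal (C * V ^ (-(m * δ / n))) * (∏ i, w i) *
          ∏ i, ENNReal.ofReal (2 ^ (-((δ - n / p) * j i))) := by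
    intro j
    by_cases hj : j = 0
    -- The multi-index 0, about which `KernelRegularity` says nothing, contributes nothing because
    -- `φ i₀` vanishes on the ball.
    · refine le_of_eq_of_le ?_ zero_le
      refine (setLIntegral_congr_fun (g := 0) ?_ fun y hy => ?_).trans (by simp)
      · exact MeasurableSet.univ_pi fun k => measurableSet_annulus c r (j k)
      have hy0 : φ i₀ (y i₀) = 0 := hφ0 _ (by simpa [hj, annulus] using hy i₀ (mem_univ _))
      have hprod : ∏ i, φ i (y i) = 0 := Finset.prod_eq_zero (Finset.mem_univ i₀) hy0
      simp only [hprod, mul_zero, enorm_zero, Pi.zero_apply]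
    · set J := Finset.univ.sup j
      calc _ ≤ _ := lintegral_annuli_le hp hmeas hφ c r j
        _ ≤ ENNReal.ofReal (C * (dist x x' ^ (m * (δ - n / p)) /
              (volume (Metric.ball c r)).toReal ^ (m * δ / n)) * 2 ^ (-(m * δ * J))) *
            ∏ i, (w i * ENNReal.ofReal (2 ^ J * r) ^ (n / p)) := by
          refine mul_le_mul' (H c r hr x hx x' hx' j hj) (Finset.prod_le_prod' fun i _ => ?_)
          refine le_trans (eLpNorm_mono_measure _ (Measure.restrict_mono ?_ le_rfl)) (hw i J)
          exact annulus_subset_ball c hr (Finset.le_sup (Finset.mem_univ i))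
        _ = ENNReal.ofReal (C * (dist x x' ^ (m * (δ - n / p)) /
              (r ^ n * V) ^ (m * δ / n)) * 2 ^ (-(m * δ * J)) *
                ((2 ^ J * r) ^ (n / p)) ^ m) * ∏ i, w i := by
          rw [Finset.prod_mul_distrib, Finset.prod_const, Finset.card_univ, Fintype.card_fin,
            volume_ball_toReal hn c hr, ENNReal.ofReal_mul (q := ((2 ^ J * r) ^ (n / p)) ^ m),
            ENNReal.ofReal_pow, ENNReal.ofReal_rpow_of_pos]
          · ring
          all_goals positivity
        _ ≤ ENNReal.ofReal (C * V ^ (-(m * δ / n)) * 2 ^ (-(m * (δ - n / p) * J))) *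
              ∏ i, w i := by
          refine mul_le_mul_left (ENNReal.ofReal_le_ofReal ?_) _
          exact kernel_constant_le J hn hC hV hr dist_nonneg hdist hδ
        _ = ENNReal.ofReal (C * V ^ (-(m * δ / n))) * (∏ i, w i) *
              ENNReal.ofReal (2 ^ (-(m * (δ - n / p) * J))) := by
          rw [ENNReal.ofReal_mul (by positivity)]
          ring
        _ ≤ _ := by
          gcongr
          exact ofReal_rpow_sup_le hε j
  calc ∫⁻ y, ‖(K x y - K x' y) * ∏ i, φ i (y i)‖ₑ
      = ∫⁻ y in ⋃ j : Fin m → ℕ, univ.pi fun k => annulus c r (j k),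
          ‖(K x y - K x' y) * ∏ i, φ i (y i)‖ₑ := by
        have : (⋃ j : Fin m → ℕ, univ.pi fun k => annulus c r (j k)) = univ := by
          refine eq_univ_of_forall fun y => ?_
          choose j hj using fun k => exists_mem_annulus c hr (y k)
          exact mem_iUnion.2 ⟨j, fun k _ => hj k⟩
        rw [this, Measure.restrict_univ]
    _ ≤ ∑' j : Fin m → ℕ, ∫⁻ y in univ.pi fun k => annulus c r (j k),
          ‖(K x y - K x' y) * ∏ i, φ i (y i)‖ₑ := lintegral_iUnion_le _ _
    _ ≤ ∑' j : Fin m → ℕ, ENNReal.ofReal (C * V ^ (-(m * δ / n))) * (∏ i, w i) *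
          ∏ i, ENNReal.ofReal (2 ^ (-((δ - n / p) * j i))) := ENNReal.tsum_le_tsum hterm
    _ = ENNReal.ofReal (C * V ^ (-(m * δ / n))) * W ^ m * ∏ i, w i := by
        rw [ENNReal.tsum_mul_left,
          tsum_fin_prod (fun (_ : Fin m) k => ENNReal.ofReal (2 ^ (-((δ - n / p) * k))))]
        simp only [Finset.prod_const, Finset.card_univ, Fintype.card_fin]
        unfold W annulusWeight
        ring

/-! ### Consequences of the weak type bound -/

section Operator

variable {n m : ℕ} {p : ℝ} {Text : LpOperator n m p}

/-- `Text` is bounded from `L^p × ⋯ × L^p` to `L^{p/m,∞}` with constant `A`. -/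
def IsWeakBounded (Text : LpOperator n m p) (A : ℝ≥0) : Prop :=
  ∀ f, weakNorm (p / m) (Text f) ≤ A * ∏ i, eLpNorm (f i) (ENNReal.ofReal p) volume

lemma IsWeakBounded.mul_volume_rpow_le {A : ℝ≥0} (hA : IsWeakBounded Text A)
    (f : Fin m → Lp ℂ (ENNReal.ofReal p) (volume : Measure (Space n))) (t : ℝ≥0) :
    t * volume {x | (t : ℝ≥0∞) < ‖Text f x‖ₑ} ^ ((m : ℝ) / p) ≤
      A * ∏ i, eLpNorm (f i) (ENNReal.ofReal p) volume := by
  refine le_trans (le_of_eq ?_) ((le_iSup (fun t : ℝ≥0 => (t : ℝ≥0∞) *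
    volume {x | (t : ℝ≥0∞) < ‖Text f x‖ₑ} ^ (1 / (p / m))) t).trans (hA f))
  rw [one_div_div]

/-- The weak type bound at a height measured in units of the product of the sizes `w i`: a large
multiple Λ makes the superlevel set any prescribed fraction of V. -/
lemma IsWeakBounded.exists_volume_le (hm : 0 < m) (hp : 1 ≤ p) {A : ℝ≥0}
    (hA : IsWeakBounded Text A) {ε : ℝ≥0} (hε : 0 < ε) :
    ∃ Λ : ℝ≥0, 0 < Λ ∧ ∀ (g : Fin m → Lp ℂ (ENNReal.ofReal p) (volume : Measure (Space n)))
      (w : Fin m → ℝ≥0∞) (V : ℝ≥0∞), (∀ i, w i ≠ 0) →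
      (∀ i, eLpNorm (g i) (ENNReal.ofReal p) volume ≤ w i * V ^ (1 / p)) →
      volume {x | Λ * ∏ i, w i < ‖Text g x‖ₑ} ≤ ε * V := by
  have hmp : 0 < (m : ℝ) / p := by positivity
  have hεp : 0 < ε ^ ((m : ℝ) / p) := NNReal.rpow_pos hε
  -- What is needed is A ≤ Λ ε^(m/p); the summand 1 keeps Λ positive when A = 0.
  refine ⟨A / ε ^ ((m : ℝ) / p) + 1, by positivity, fun g w V hw hg => ?_⟩
  set Λ : ℝ≥0 := A / ε ^ ((m : ℝ) / p) + 1 with hΛ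
  have hΛ0 : (Λ : ℝ≥0∞) ≠ 0 := by
    rw [ENNReal.coe_ne_zero]
    positivity
  have hAΛ : (A : ℝ≥0∞) ≤ Λ * (ε : ℝ≥0∞) ^ ((m : ℝ) / p) := by
    rw [← ENNReal.coe_rpow_of_nonneg _ hmp.le]
    norm_cast
    rw [← div_le_iff₀ hεp, hΛ]
    exact le_self_add
  have hw0 : ∏ i, w i ≠ 0 := Finset.prod_ne_zero_iff.2 fun i _ => hw i
  by_cases htop : ∏ i, w i = ∞
  · have : {x | Λ * ∏ i, w i < ‖Text g x‖ₑ} = ∅ := by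
      refine eq_empty_of_forall_notMem fun x hx => ?_
      rw [mem_ofPred_eq, htop, ENNReal.mul_top hΛ0] at hx
      exact not_top_lt hx
    rw [this, measure_empty]
    exact zero_le
  have ht : Λ * ∏ i, w i ≠ ∞ := ENNReal.mul_ne_top ENNReal.coe_ne_top htop
  have key := hA.mul_volume_rpow_le g (Λ * ∏ i, w i).toNNReal
  rw [ENNReal.coe_toNNReal ht] at key
  set v := volume {x | Λ * ∏ i, w i < ‖Text g x‖ₑ}
  have h1 : Λ * (∏ i, w i) * v ^ ((m : ℝ) / p) ≤
      Λ * (∏ i, w i) * ((ε : ℝ≥0∞) * V) ^ ((m : ℝ) / p) := by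
    calc _ ≤ _ := key
      _ ≤ Λ * (ε : ℝ≥0∞) ^ ((m : ℝ) / p) * ∏ i, (w i * V ^ (1 / p)) := by
        gcongr with i
        exact hg i
      _ = _ := by
        rw [Finset.prod_mul_distrib, Finset.prod_const, Finset.card_univ, Fintype.card_fin,
          ENNReal.mul_rpow_of_nonneg _ _ hmp.le, ← ENNReal.rpow_natCast, ← ENNReal.rpow_mul,
          show 1 / p * (m : ℝ) = m / p by ring]
        ring
  rw [ENNReal.mul_le_mul_iff_right (mul_ne_zero hΛ0 hw0) ht] at h1
  exact (ENNReal.rpow_le_rpow_iff hmp).1 h1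

lemma ae_apply_eq_zero (Text : LpOperator n m p)
    (g : Fin m → Lp ℂ (ENNReal.ofReal p) (volume : Measure (Space n))) {i : Fin m}
    (hg : g i = 0) : ∀ᵐ x, Text g x = 0 := by
  rw [Text.map_coord_zero i hg]
  exact AEEqFun.coeFn_zero

/-- Separate continuity of `Text`, with convergence almost everywhere along a subsequence. -/
lemma IsWeakBounded.exists_seq_tendsto_ae [Fact (1 ≤ ENNReal.ofReal p)] (hm : 0 < m) (hp : 1 ≤ p)
    {A : ℝ≥0} (hA : IsWeakBounded Text A)
    (g : Fin m → Lp ℂ (ENNReal.ofReal p) (volume : Measure (Space n))) (i : Fin m)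
    {h : ℕ → Lp ℂ (ENNReal.ofReal p) (volume : Measure (Space n))}
    {h₀ : Lp ℂ (ENNReal.ofReal p) (volume : Measure (Space n))} (hh : Tendsto h atTop (𝓝 h₀)) :
    ∃ ns : ℕ → ℕ, ∀ᵐ x, Tendsto (fun k => Text (Function.update g i (h (ns k))) x) atTop
      (𝓝 (Text (Function.update g i h₀) x)) := by
  -- By multilinearity the difference is `Text` with `h k - h₀` in slot i. Its weak norm is at most
  -- a constant times ‖h k - h₀‖, which gives convergence in measure.
  suffices H : TendstoInMeasure volume (fun k => ⇑(Text (Function.update g i (h k)))) atTop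
      (Text (Function.update g i h₀)) by
    obtain ⟨ns, -, hns⟩ := H.exists_seq_tendsto_ae
    exact ⟨ns, hns⟩
  set B : ℕ → ℝ≥0∞ := fun k => A * ∏ j,
    eLpNorm (Function.update g i (h k - h₀) j) (ENNReal.ofReal p) volume with hB
  have hBlim : Tendsto B atTop (𝓝 0) := by
    have h1 : ∀ k, B k = A * ((∏ j ∈ Finset.univ.erase i,
        eLpNorm (g j) (ENNReal.ofReal p) volume) * ‖h k - h₀‖ₑ) := by
      intro k
      simp only [hB]
      rw [← Finset.prod_erase_mul _ _ (Finset.mem_univ i)]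
      congr 2
      · refine Finset.prod_congr rfl fun j hj => ?_
        rw [Function.update_of_ne (Finset.ne_of_mem_erase hj)]
      · rw [Function.update_self, Lp.enorm_def]
    rw [funext h1]
    have h2 : Tendsto (fun k => ‖h k - h₀‖ₑ) atTop (𝓝 0) := by
      have := (hh.sub_const h₀).enorm
      rwa [sub_self, enorm_zero] at this
    have hfin : ∏ j ∈ Finset.univ.erase i, eLpNorm (g j) (ENNReal.ofReal p) volume ≠ ∞ :=
      ENNReal.prod_ne_top fun j _ => Lp.eLpNorm_ne_top (g j)
    have h3 := ENNReal.Tendsto.const_mul h2 (Or.inr hfin)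
    have h4 := ENNReal.Tendsto.const_mul h3 (Or.inr (ENNReal.coe_ne_top (r := A)))
    simpa using h4
  intro ε hε
  obtain ⟨t, ht0, htε⟩ := ENNReal.lt_iff_exists_nnreal_btwn.1 hε
  have ht0' : (t : ℝ≥0∞) ≠ 0 := ht0.ne'
  refine tendsto_of_tendsto_of_tendsto_of_le_of_le tendsto_const_nhds
    (h := fun k => (B k / t) ^ (p / m)) ?_ (fun _ => zero_le) fun k => ?_
  · have h1 : Tendsto (fun k => B k / t) atTop (𝓝 0) := by
      simpa using ENNReal.Tendsto.div_const hBlim (Or.inr ht0')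
    have := (ENNReal.continuous_rpow_const (y := p / m)).tendsto 0 |>.comp h1
    rwa [ENNReal.zero_rpow_of_pos (by positivity)] at this
  · have h1 := hA.mul_volume_rpow_le (Function.update g i (h k - h₀)) t
    have h2 : volume {x | ε ≤ edist (Text (Function.update g i (h k)) x)
        (Text (Function.update g i h₀) x)} ≤
        volume {x | (t : ℝ≥0∞) < ‖Text (Function.update g i (h k - h₀)) x‖ₑ} := by
      refine measure_mono_ae ?_
      have h3 := AEEqFun.coeFn_sub (Text (Function.update g i (h k)))
        (Text (Function.update g i h₀))
      rw [← Text.map_update_sub] at h3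
      filter_upwards [h3] with x hx hx'
      change (t : ℝ≥0∞) < _
      rw [hx, Pi.sub_apply, ← edist_eq_enorm_sub]
      exact htε.trans_le hx'
    refine h2.trans ?_
    rw [← ENNReal.rpow_inv_le_iff (by positivity), inv_div]
    rw [ENNReal.le_div_iff_mul_le (Or.inl ht0') (Or.inl ENNReal.coe_ne_top), mul_comm]
    exact h1

/-! ### Density of Schwartz functions -/

lemma exists_schwartz_seq [Fact (1 ≤ ENNReal.ofReal p)]
    (g : Lp ℂ (ENNReal.ofReal p) (volume : Measure (Space n))) :
    ∃ φ : ℕ → 𝓢(Space n, ℂ),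
      Tendsto (fun k => (φ k).toLp (ENNReal.ofReal p) volume) atTop (𝓝 g) := by
  have h := SchwartzMap.denseRange_toLpCLM (E := Space n) (F := ℂ) (p := ENNReal.ofReal p)
    ENNReal.ofReal_ne_top (μ := volume)
  obtain ⟨x, hx, hlim⟩ := mem_closure_iff_seq_limit.1 (h g)
  choose φ hφ using hx
  refine ⟨φ, ?_⟩
  convert hlim using 2 with k
  exact hφ k

/-- Multiplication by 1 - b, where b is a bump function equal to 1 on the half ball, fixes g and
does not increase distances, so it turns any approximating sequence into one vanishing on the half
ball. -/
lemma exists_schwartz_seq_of_eq_zero [Fact (1 ≤ ENNReal.ofReal p)]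
    (g : Lp ℂ (ENNReal.ofReal p) (volume : Measure (Space n))) {c : Space n} {r : ℝ} (hr : 0 < r)
    (hg : ∀ᵐ y, y ∈ Metric.ball c r → g y = 0) :
    ∃ φ : ℕ → 𝓢(Space n, ℂ),
      Tendsto (fun k => (φ k).toLp (ENNReal.ofReal p) volume) atTop (𝓝 g) ∧
      ∀ k, ∀ y ∈ Metric.ball c (r / 2), φ k y = 0 := by
  obtain ⟨φ, hφ⟩ := exists_schwartz_seq g
  let b : ContDiffBump c := ⟨r / 2, r, by linarith, by linarith⟩
  have hb : Function.HasTemperateGrowth fun x => (1 : ℝ) - b x :=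
    (Function.HasTemperateGrowth.const 1).sub
      (b.hasCompactSupport.hasTemperateGrowth b.contDiff)
  refine ⟨fun k => SchwartzMap.smulLeftCLM ℂ (fun x => (1 : ℝ) - b x) (φ k), ?_, ?_⟩
  · rw [tendsto_iff_edist_tendsto_0] at hφ ⊢
    refine tendsto_of_tendsto_of_tendsto_of_le_of_le tendsto_const_nhds hφ
      (fun _ => zero_le) fun k => ?_
    rw [Lp.edist_def, Lp.edist_def]
    refine eLpNorm_mono_ae ?_
    filter_upwards [hg, (φ k).coeFn_toLp (ENNReal.ofReal p) volume,
      (SchwartzMap.smulLeftCLM ℂ (fun x => (1 : ℝ) - b x) (φ k)).coeFn_toLp (ENNReal.ofReal p)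
        volume] with x hx h1 h2
    rw [Pi.sub_apply, Pi.sub_apply, h1, h2, SchwartzMap.smulLeftCLM_apply_apply hb]
    have hgx : g x = ((1 : ℝ) - b x) • g x := by
      by_cases hxb : x ∈ Metric.ball c r
      · rw [hx hxb, smul_zero]
      · have : b x = 0 := b.zero_of_le_dist (by simpa using hxb)
        rw [this, sub_zero, one_smul]
    rw [hgx, ← smul_sub, norm_smul]
    refine (mul_le_of_le_one_left (norm_nonneg _) ?_).trans_eq (by rw [← hgx])
    rw [Real.norm_eq_abs, abs_le]
    constructor <;> linarith [b.nonneg' x, b.le_one (x := x)]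
  · intro k y hy
    rw [SchwartzMap.smulLeftCLM_apply_apply hb]
    have : b y = 1 := b.one_of_mem_closedBall (Metric.ball_subset_closedBall hy)
    rw [this, sub_self, zero_smul]

end Operator

/-! ### The oscillation estimate for functions in `L^p` -/

section Oscillation

variable {n m : ℕ} {p : ℝ} {Text : LpOperator n m p}

/-- The essential oscillation of `u` over `B` is at most `M`. -/
def OscLE (u : Space n →ₘ[volume] ℂ) (B : Set (Space n)) (M : ℝ≥0∞) : Prop :=
  ∀ᵐ x, ∀ᵐ x', x ∈ B → x' ∈ B → ‖u x - u x'‖ₑ ≤ M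

lemma OscLE.sum {ι : Type*} (s : Finset ι) {u : ι → Space n →ₘ[volume] ℂ} {B : Set (Space n)}
    {M : ι → ℝ≥0∞} (h : ∀ i ∈ s, OscLE (u i) B (M i)) :
    OscLE (∑ i ∈ s, u i) B (∑ i ∈ s, M i) := by
  classical
  induction s using Finset.induction_on with
  | empty =>
    have h0 := AEEqFun.coeFn_zero (μ := (volume : Measure (Space n))) (β := ℂ)
    filter_upwards [h0] with x hx
    filter_upwards [h0] with x' hx' _ _
    simp [hx, hx']
  | insert a s ha ih =>
    rw [Finset.sum_insert ha, Finset.sum_insert ha]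
    have hadd := AEEqFun.coeFn_add (u a) (∑ i ∈ s, u i)
    filter_upwards [hadd, h a (Finset.mem_insert_self a s),
      ih fun i hi => h i (Finset.mem_insert_of_mem hi)] with x hx h1 h2
    filter_upwards [hadd, h1, h2] with x' hx' h1' h2' hB hB'
    rw [hx, hx', Pi.add_apply, Pi.add_apply, add_sub_add_comm]
    exact (enorm_add_le _ _).trans (add_le_add (h1' hB hB') (h2' hB hB'))

lemma OscLE.of_tendsto [Fact (1 ≤ ENNReal.ofReal p)] (hm : 0 < m) (hp : 1 ≤ p)
    {A : ℝ≥0} (hA : IsWeakBounded Text A) {B : Set (Space n)} {M : ℝ≥0∞}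
    (g : Fin m → Lp ℂ (ENNReal.ofReal p) (volume : Measure (Space n))) (i : Fin m)
    {h : ℕ → Lp ℂ (ENNReal.ofReal p) (volume : Measure (Space n))}
    {h₀ : Lp ℂ (ENNReal.ofReal p) (volume : Measure (Space n))} (hh : Tendsto h atTop (𝓝 h₀))
    (H : ∀ k, OscLE (Text (Function.update g i (h k))) B M) :
    OscLE (Text (Function.update g i h₀)) B M := by
  obtain ⟨ns, hns⟩ := hA.exists_seq_tendsto_ae hm hp g i hh
  filter_upwards [hns, ae_all_iff.2 fun k => H (ns k)] with x hx hx2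
  filter_upwards [hns, ae_all_iff.2 hx2] with x' hx' hx2' hB hB'
  exact le_of_tendsto (hx.sub hx').enorm (Eventually.of_forall fun k => hx2' k hB hB')

/-- The slots pass to the closure one at a time, since only separate continuity is used; the
induction runs over the set of slots already passed. -/
lemma OscLE.of_mem_closure [Fact (1 ≤ ENNReal.ofReal p)] (hm : 0 < m) (hp : 1 ≤ p)
    {A : ℝ≥0} (hA : IsWeakBounded Text A) {B : Set (Space n)} {M : ℝ≥0∞}
    (S : Fin m → Set (Lp ℂ (ENNReal.ofReal p) (volume : Measure (Space n))))
    (H : ∀ g, (∀ i, g i ∈ S i) → OscLE (Text g) B M)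
    (g : Fin m → Lp ℂ (ENNReal.ofReal p) (volume : Measure (Space n)))
    (hg : ∀ i, g i ∈ closure (S i)) : OscLE (Text g) B M := by
  suffices key : ∀ s : Finset (Fin m), ∀ g, (∀ i ∈ s, g i ∈ closure (S i)) →
      (∀ i ∉ s, g i ∈ S i) → OscLE (Text g) B M from
    key Finset.univ g (fun i _ => hg i) fun i hi => absurd (Finset.mem_univ i) hi
  intro s
  induction s using Finset.induction_on with
  | empty => exact fun g _ h => H g fun i => h i (by simp)
  | insert a s ha ih =>
    intro g h1 h2
    obtain ⟨h, hS, hh⟩ := mem_closure_iff_seq_limit.1 (h1 a (Finset.mem_insert_self a s))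
    rw [← Function.update_eq_self a g]
    refine OscLE.of_tendsto hm hp hA g a hh fun k => ih _ (fun i hi => ?_) fun i hi => ?_
    · rw [Function.update_of_ne (by rintro rfl; exact ha hi)]
      exact h1 i (Finset.mem_insert_of_mem hi)
    · by_cases hia : i = a
      · subst hia
        rw [Function.update_self]
        exact hS k
      · rw [Function.update_of_ne hia]
        exact h2 i (by simp [hia, hi])

/-- Points of the half ball lie outside the support of `φ i₀`, so the kernel formula holds at almost
all of them and the difference of two values is an integral against `K x - K x'`. -/
lemma exists_oscLE_schwartz (hn : 0 < n) (hp : 1 ≤ p)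
    {T : SchwartzOperator n m} {K : Space n → (Fin m → Space n) → ℂ} (hK : HasKernel T K)
    (hT : ∀ f : Fin m → 𝓢(Space n, ℂ),
      IsGivenBy (T f) (Text fun i => (f i).toLp (ENNReal.ofReal p) volume))
    (H2 : KernelRegularity p K) :
    ∃ C : ℝ≥0, ∀ (φ : Fin m → 𝓢(Space n, ℂ)) (c : Space n) (r : ℝ) (w : Fin m → ℝ≥0∞)
      (i₀ : Fin m), 0 < r → (∀ y ∈ Metric.ball c r, φ i₀ y = 0) →
      (∀ i (J : ℕ), eLpNorm (φ i) (ENNReal.ofReal p)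
        (volume.restrict (Metric.ball c (2 ^ J * r))) ≤
          w i * ENNReal.ofReal (2 ^ J * r) ^ (n / p)) →
      OscLE (Text fun i => (φ i).toLp (ENNReal.ofReal p) volume) (Metric.ball c (r / 2))
        (C * ∏ i, w i) := by
  obtain ⟨C, hC⟩ := exists_lintegral_kernel_le hn hp hK.measurable H2
  refine ⟨C, fun φ c r w i₀ hr hφ hw => ?_⟩
  have hsupp : ∀ x ∈ Metric.ball c (r / 2), x ∉ ⋂ i, tsupport (φ i) := by
    intro x hx hx'
    have h1 : x ∈ tsupport (φ i₀) := mem_iInter.1 hx' i₀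
    have h2 : x ∈ Metric.ball c r := Metric.ball_subset_ball (by linarith) hx
    rw [tsupport, mem_closure_iff] at h1
    obtain ⟨y, hy, hy'⟩ := h1 _ Metric.isOpen_ball h2
    exact hy' (hφ y hy)
  have hrep := hK.representation φ _ (hT φ)
  filter_upwards [hrep] with x hx
  filter_upwards [hrep] with x' hx' hxB hxB'
  obtain ⟨hi, he⟩ := hx (hsupp x hxB)
  obtain ⟨hi', he'⟩ := hx' (hsupp x' hxB')
  rw [he, he', ← integral_sub hi hi']
  refine (enorm_integral_le_lintegral_enorm _).trans ?_
  simp_rw [← sub_mul]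
  exact hC (fun i => φ i) c r w i₀ hr (fun i => (φ i).continuous.measurable) hφ hw x hxB x' hxB'

/-- The passage to L^p loses half the radius, because the approximants vanish only on a half ball,
and a factor 2 in each size. Sizes different from 0 leave room for the approximation error. -/
lemma exists_oscLE [Fact (1 ≤ ENNReal.ofReal p)] (hn : 0 < n) (hm : 0 < m) (hp : 1 ≤ p)
    {A : ℝ≥0} (hA : IsWeakBounded Text A)
    {T : SchwartzOperator n m} {K : Space n → (Fin m → Space n) → ℂ} (hK : HasKernel T K)
    (hT : ∀ f : Fin m → 𝓢(Space n, ℂ),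
      IsGivenBy (T f) (Text fun i => (f i).toLp (ENNReal.ofReal p) volume))
    (H2 : KernelRegularity p K) :
    ∃ C : ℝ≥0, ∀ (g : Fin m → Lp ℂ (ENNReal.ofReal p) (volume : Measure (Space n)))
      (c : Space n) (r : ℝ) (w : Fin m → ℝ≥0∞) (i₀ : Fin m), 0 < r → (∀ i, w i ≠ 0) →
      (∀ᵐ y, y ∈ Metric.ball c r → g i₀ y = 0) →
      (∀ i (R : ℝ), r / 2 ≤ R → eLpNorm (g i) (ENNReal.ofReal p)
        (volume.restrict (Metric.ball c R)) ≤ w i * ENNReal.ofReal R ^ (n / p)) →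
      OscLE (Text g) (Metric.ball c (r / 4)) (C * ∏ i, w i) := by
  obtain ⟨C, hC⟩ := exists_oscLE_schwartz hn hp hK hT H2
  refine ⟨C * 2 ^ m, fun g c r w i₀ hr hw hg0 hg => ?_⟩
  set S : Fin m → Set (Lp ℂ (ENNReal.ofReal p) (volume : Measure (Space n))) := fun i =>
    {h | ∃ φ : 𝓢(Space n, ℂ), φ.toLp (ENNReal.ofReal p) volume = h ∧
      (i = i₀ → ∀ y ∈ Metric.ball c (r / 2), φ y = 0) ∧
      ∀ J : ℕ, eLpNorm φ (ENNReal.ofReal p)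
        (volume.restrict (Metric.ball c (2 ^ J * (r / 2)))) ≤
          2 * w i * ENNReal.ofReal (2 ^ J * (r / 2)) ^ (n / p)} with hS
  refine OscLE.of_mem_closure hm hp hA S (fun h hh => ?_) g fun i => ?_
  · choose φ hφ1 hφ2 hφ3 using hh
    have := hC φ c (r / 2) (fun i => 2 * w i) i₀ (by linarith) (hφ2 i₀ rfl) hφ3
    rw [Finset.prod_mul_distrib, Finset.prod_const, Finset.card_univ, Fintype.card_fin,
      show r / 2 / 2 = r / 4 by ring, ← mul_assoc, show (fun i =>
        (φ i).toLp (ENNReal.ofReal p) volume) = h from funext hφ1] at this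
    exact_mod_cast this
  · obtain ⟨φ, hφ, hφ0⟩ : ∃ φ : ℕ → 𝓢(Space n, ℂ),
        Tendsto (fun k => (φ k).toLp (ENNReal.ofReal p) volume) atTop (𝓝 (g i)) ∧
        (i = i₀ → ∀ k, ∀ y ∈ Metric.ball c (r / 2), φ k y = 0) := by
      by_cases hi : i = i₀
      · subst hi
        obtain ⟨φ, h1, h2⟩ := exists_schwartz_seq_of_eq_zero (g i) hr hg0
        exact ⟨φ, h1, fun _ => h2⟩
      · obtain ⟨φ, h1⟩ := exists_schwartz_seq (g i)
        exact ⟨φ, h1, fun h => absurd h hi⟩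
    refine mem_closure_of_tendsto hφ ?_
    have hpos : 0 < w i * ENNReal.ofReal (r / 2) ^ (n / p) := by
      refine ENNReal.mul_pos (hw i) (ENNReal.rpow_pos ?_ ENNReal.ofReal_ne_top).ne'
      simpa using hr
    -- An error that is admissible at the radius r/2 is admissible for all J at once, since the
    -- permitted bound increases with the radius.
    have hev := (tendsto_iff_edist_tendsto_0.1 hφ).eventually_le_const hpos
    filter_upwards [hev] with k hk
    refine ⟨φ k, rfl, fun hi => hφ0 hi k, fun J => ?_⟩
    set R := 2 ^ J * (r / 2)
    have hR : r / 2 ≤ R := le_mul_of_one_le_left (by linarith) (one_le_pow₀ (by norm_num))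
    set ν := (volume : Measure (Space n)).restrict (Metric.ball c R)
    set ψ := (φ k).toLp (ENNReal.ofReal p) volume with hψ
    calc eLpNorm (φ k) (ENNReal.ofReal p) ν = eLpNorm ψ (ENNReal.ofReal p) ν :=
          (eLpNorm_congr_ae (ae_restrict_of_ae
            ((φ k).coeFn_toLp (ENNReal.ofReal p) volume))).symm
      _ = eLpNorm ((⇑ψ - ⇑(g i)) + ⇑(g i)) (ENNReal.ofReal p) ν := by
          rw [sub_add_cancel]
      _ ≤ eLpNorm (⇑ψ - ⇑(g i)) (ENNReal.ofReal p) ν +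
            eLpNorm (g i) (ENNReal.ofReal p) ν :=
          eLpNorm_add_le ((Lp.aestronglyMeasurable ψ).restrict.sub
            (Lp.aestronglyMeasurable (g i)).restrict)
            (Lp.aestronglyMeasurable (g i)).restrict Fact.out
      _ ≤ w i * ENNReal.ofReal (r / 2) ^ (n / p) + w i * ENNReal.ofReal R ^ (n / p) := by
          refine add_le_add ?_ (hg i R hR)
          rw [Lp.edist_def] at hk
          exact (eLpNorm_mono_measure _ Measure.restrict_le_self).trans hk
      _ ≤ w i * ENNReal.ofReal R ^ (n / p) + w i * ENNReal.ofReal R ^ (n / p) := by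
          gcongr
      _ = _ := by ring

end Oscillation

/-! ### Truncations, and comparison of `Text g` with its truncation -/

section Truncation

variable {n m : ℕ} {p : ℝ}

/-- The truncation of `g` to the ball `B(c, R)`. -/
noncomputable def truncate (g : Lp ℂ (ENNReal.ofReal p) (volume : Measure (Space n)))
    (c : Space n) (R : ℝ) : Lp ℂ (ENNReal.ofReal p) (volume : Measure (Space n)) :=
  ((Lp.memLp g).indicator (measurableSet_ball (x := c) (ε := R))).toLp _

lemma coeFn_truncate (g : Lp ℂ (ENNReal.ofReal p) (volume : Measure (Space n)))
    (c : Space n) (R : ℝ) : truncate g c R =ᵐ[volume] (Metric.ball c R).indicator g :=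
  MemLp.coeFn_toLp _

lemma eLpNorm_truncate (g : Lp ℂ (ENNReal.ofReal p) (volume : Measure (Space n)))
    (c : Space n) (R : ℝ) : eLpNorm (truncate g c R) (ENNReal.ofReal p) volume =
      eLpNorm g (ENNReal.ofReal p) (volume.restrict (Metric.ball c R)) := by
  rw [eLpNorm_congr_ae (coeFn_truncate g c R), eLpNorm_indicator_eq_eLpNorm_restrict
    measurableSet_ball]

lemma eLpNorm_truncate_restrict_le (g : Lp ℂ (ENNReal.ofReal p) (volume : Measure (Space n)))
    (c : Space n) (R : ℝ) (B : Set (Space n)) :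
    eLpNorm (truncate g c R) (ENNReal.ofReal p) (volume.restrict B) ≤
      eLpNorm g (ENNReal.ofReal p) (volume.restrict B) := by
  rw [eLpNorm_congr_ae (ae_restrict_of_ae (coeFn_truncate g c R))]
  exact eLpNorm_indicator_le _

lemma eLpNorm_sub_truncate_restrict_le
    (g : Lp ℂ (ENNReal.ofReal p) (volume : Measure (Space n)))
    (c : Space n) (R : ℝ) (B : Set (Space n)) :
    eLpNorm (g - truncate g c R : Lp ℂ (ENNReal.ofReal p) (volume : Measure (Space n)))
      (ENNReal.ofReal p) (volume.restrict B) ≤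
      eLpNorm g (ENNReal.ofReal p) (volume.restrict B) := by
  refine eLpNorm_mono_ae (ae_restrict_of_ae ?_)
  filter_upwards [coeFn_truncate g c R, Lp.coeFn_sub g (truncate g c R)] with x h1 h2
  rw [h2, Pi.sub_apply, h1]
  by_cases hx : x ∈ Metric.ball c R
  · rw [indicator_of_mem hx, sub_self, norm_zero]
    exact norm_nonneg _
  · rw [indicator_of_notMem hx, sub_zero]

lemma sub_truncate_eq_zero (g : Lp ℂ (ENNReal.ofReal p) (volume : Measure (Space n)))
    (c : Space n) (R : ℝ) : ∀ᵐ y, y ∈ Metric.ball c R →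
      (g - truncate g c R : Lp ℂ (ENNReal.ofReal p) (volume : Measure (Space n))) y = 0 := by
  filter_upwards [coeFn_truncate g c R, Lp.coeFn_sub g (truncate g c R)] with x h1 h2 hx
  rw [h2, Pi.sub_apply, h1, indicator_of_mem hx, sub_self]

lemma truncate_truncate (g : Lp ℂ (ENNReal.ofReal p) (volume : Measure (Space n)))
    {c c' : Space n} {R R' : ℝ} (h : Metric.ball c R ⊆ Metric.ball c' R') :
    truncate (truncate g c' R') c R = truncate g c R := by
  refine Lp.ext ?_
  filter_upwards [coeFn_truncate (truncate g c' R') c R, coeFn_truncate g c' R',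
    coeFn_truncate g c R] with x h1 h2 h3
  rw [h1, h3]
  by_cases hx : x ∈ Metric.ball c R
  · rw [indicator_of_mem hx, indicator_of_mem hx, h2, indicator_of_mem (h hx)]
  · rw [indicator_of_notMem hx, indicator_of_notMem hx]

variable {Text : LpOperator n m p}

/-- With g = t + h and t the truncation, the difference expands into terms having some entry `h i`,
which vanishes near P, so its oscillation over P is controlled. The subsets of P where `Text g` or
`Text t` is large have measure at most |P|/4 each. Comparing with a point outside both turns the
oscillation bound into a bound for the difference. -/
lemma exists_enorm_sub_truncate_le [Fact (1 ≤ ENNReal.ofReal p)] (hn : 0 < n) (hm : 0 < m)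
    (hp : 1 ≤ p) {A : ℝ≥0} (hA : IsWeakBounded Text A)
    {T : SchwartzOperator n m} {K : Space n → (Fin m → Space n) → ℂ} (hK : HasKernel T K)
    (hT : ∀ f : Fin m → 𝓢(Space n, ℂ),
      IsGivenBy (T f) (Text fun i => (f i).toLp (ENNReal.ofReal p) volume))
    (H2 : KernelRegularity p K) (Λ : ℝ≥0) :
    ∃ C : ℝ≥0, ∀ (g : Fin m → Lp ℂ (ENNReal.ofReal p) (volume : Measure (Space n)))
      (P : Set (Space n)) (a : Space n) (s : ℝ) (w : Fin m → ℝ≥0∞), 0 < s → (∀ i, w i ≠ 0) →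
      (∀ x ∈ P, dist x a ≤ n * s) → volume P = ENNReal.ofReal s ^ n →
      (∀ i (R : ℝ), s ≤ R → eLpNorm (g i) (ENNReal.ofReal p)
        (volume.restrict (Metric.ball a R)) ≤ w i * ENNReal.ofReal R ^ (n / p)) →
      4 * volume (P ∩ {x | Λ * ∏ i, w i < ‖Text g x‖ₑ}) ≤ volume P →
      ∀ᵐ x, x ∈ P →
        ‖Text g x - Text (fun i => truncate (g i) a (8 * n * s)) x‖ₑ ≤ C * ∏ i, w i := by
  have hn1 : (1 : ℝ) ≤ n := by exact_mod_cast hn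
  obtain ⟨C₁, hC₁⟩ := exists_oscLE hn hm hp hA hK hT H2
  -- Chosen so that 4 ε r^n = s^n = |P| for the truncation radius r = 8ns.
  set ε : ℝ≥0 := (4 * (8 * n) ^ n)⁻¹ with hε
  obtain ⟨Λ₁, -, hΛ₁⟩ := hA.exists_volume_le hm hp (ε := ε) (by positivity)
  refine ⟨2 ^ m * C₁ + Λ + Λ₁, fun g P a s w hs hw hP hvol hg hbad => ?_⟩
  have hns : s ≤ n * s := le_mul_of_one_le_left hs.le hn1
  set r : ℝ := 8 * n * s with hr
  have hr0 : 0 < r := by positivity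
  set t : Fin m → Lp ℂ (ENNReal.ofReal p) (volume : Measure (Space n)) :=
    fun i => truncate (g i) a r with ht
  set h : Fin m → Lp ℂ (ENNReal.ofReal p) (volume : Measure (Space n)) :=
    fun i => g i - t i with hh
  have hPball : P ⊆ Metric.ball a (r / 4) := by
    intro x hx
    have := hP x hx
    rw [Metric.mem_ball]
    linarith
  have hsum : Text g - Text t =
      ∑ S ∈ Finset.univ.erase (Finset.univ : Finset (Fin m)), Text (S.piecewise t h) := by
    have h1 : g = t + h := by
      ext1 i
      simp [hh]
    have h2 := Text.map_add_univ t h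
    rw [← h1, ← Finset.add_sum_erase _ _ (Finset.mem_univ Finset.univ),
      Finset.piecewise_univ] at h2
    rw [h2, add_sub_cancel_left]
  have hosc : OscLE (Text g - Text t) (Metric.ball a (r / 4)) (2 ^ m * C₁ * ∏ i, w i) := by
    rw [hsum]
    have h1 : OscLE (∑ S ∈ Finset.univ.erase (Finset.univ : Finset (Fin m)),
        Text (S.piecewise t h)) (Metric.ball a (r / 4))
        (∑ S ∈ Finset.univ.erase (Finset.univ : Finset (Fin m)), C₁ * ∏ i, w i) := by
      refine OscLE.sum _ fun S hS => ?_
      obtain ⟨i₀, hi₀⟩ : ∃ i₀, i₀ ∉ S := by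
        by_contra! hcon
        exact Finset.ne_of_mem_erase hS (Finset.eq_univ_of_forall hcon)
      refine hC₁ _ a r w i₀ hr0 hw ?_ fun i R hR => ?_
      · rw [Finset.piecewise_eq_of_notMem _ _ _ hi₀]
        exact sub_truncate_eq_zero (g i₀) a r
      · refine le_trans ?_ (hg i R (by linarith))
        by_cases hi : i ∈ S
        · rw [Finset.piecewise_eq_of_mem _ _ _ hi]
          exact eLpNorm_truncate_restrict_le _ _ _ _
        · rw [Finset.piecewise_eq_of_notMem _ _ _ hi]
          exact eLpNorm_sub_truncate_restrict_le _ _ _ _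
    filter_upwards [h1] with x hx
    filter_upwards [hx] with x' hx' hB hB'
    refine (hx' hB hB').trans ?_
    rw [Finset.sum_const, nsmul_eq_mul, mul_assoc]
    gcongr
    have := Finset.card_erase_le (s := Finset.univ) (a := (Finset.univ : Finset (Fin m)))
    rw [Finset.card_univ, Fintype.card_finset, Fintype.card_fin] at this
    exact_mod_cast this
  have hbad₁ : 4 * volume (P ∩ {x | Λ₁ * ∏ i, w i < ‖Text t x‖ₑ}) ≤ volume P := by
    have h1 := hΛ₁ t w (ENNReal.ofReal r ^ n) hw fun i => by
      rw [ht, eLpNorm_truncate, ← ENNReal.rpow_natCast, ← ENNReal.rpow_mul, mul_one_div]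
      exact hg i r (by linarith)
    have h2 : 4 * (ε * ENNReal.ofReal r ^ n) = volume P := by
      have h3 : ENNReal.ofReal r = ((8 * n : ℝ≥0) : ℝ≥0∞) * ENNReal.ofReal s := by
        rw [hr, ENNReal.ofReal_mul (by positivity)]
        congr 1
        rw [ENNReal.ofReal_mul (by norm_num)]
        simp
      have h4 : (4 : ℝ≥0) * ε * (8 * n) ^ n = 1 := by
        rw [hε]
        field_simp
      rw [hvol, h3, mul_pow, ← mul_assoc, ← mul_assoc]
      have h5 : (4 : ℝ≥0∞) * ε * ((8 * n : ℝ≥0) : ℝ≥0∞) ^ n = 1 := by exact_mod_cast h4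
      rw [h5, one_mul]
    calc _ ≤ 4 * volume {x | Λ₁ * ∏ i, w i < ‖Text t x‖ₑ} := by
          gcongr
          exact inter_subset_right
      _ ≤ 4 * (ε * ENNReal.ofReal r ^ n) := by gcongr
      _ = _ := h2
  set b := P ∩ {x | Λ * ∏ i, w i < ‖Text g x‖ₑ} with hb
  set b₁ := P ∩ {x | Λ₁ * ∏ i, w i < ‖Text t x‖ₑ} with hb₁
  have hP0 : volume P ≠ 0 := by
    rw [hvol]
    exact pow_ne_zero _ (by simpa using hs)
  have hPtop : volume P ≠ ∞ := by
    rw [hvol]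
    exact ENNReal.pow_ne_top ENNReal.ofReal_ne_top
  have hgood : volume (P \ (b ∪ b₁)) ≠ 0 := by
    intro h0
    have h1 : volume P ≤ volume b + volume b₁ := by
      calc volume P ≤ volume (P \ (b ∪ b₁)) + volume (b ∪ b₁) := by
            refine (measure_mono ?_).trans (measure_union_le _ _)
            simp
        _ ≤ volume b + volume b₁ := by
            rw [h0, zero_add]
            exact measure_union_le _ _
    have h2 : 4 * volume P ≤ 2 * volume P := by
      calc 4 * volume P ≤ 4 * (volume b + volume b₁) := by gcongr
        _ = 4 * volume b + 4 * volume b₁ := mul_add _ _ _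
        _ ≤ volume P + volume P := add_le_add hbad hbad₁
        _ = 2 * volume P := (two_mul _).symm
    rw [ENNReal.mul_le_mul_iff_left hP0 hPtop] at h2
    norm_num at h2
  have hsub := AEEqFun.coeFn_sub (Text g) (Text t)
  filter_upwards [hosc, hsub] with x hx hxs hxP
  obtain ⟨x', hx'g, hx', hxs'⟩ := Measure.exists_mem_of_measure_ne_zero_of_ae hgood
    (ae_restrict_of_ae (hx.and hsub))
  have h1 := hx' (hPball hxP) (hPball hx'g.1)
  rw [hxs, hxs', Pi.sub_apply, Pi.sub_apply] at h1
  have h2 : ‖Text g x'‖ₑ ≤ Λ * ∏ i, w i := by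
    by_contra! hcon
    exact hx'g.2 (Or.inl ⟨hx'g.1, hcon⟩)
  have h3 : ‖Text t x'‖ₑ ≤ Λ₁ * ∏ i, w i := by
    by_contra! hcon
    exact hx'g.2 (Or.inr ⟨hx'g.1, hcon⟩)
  calc ‖Text g x - Text t x‖ₑ
      = ‖(Text g x - Text t x - (Text g x' - Text t x')) + (Text g x' - Text t x')‖ₑ := by
        rw [sub_add_cancel]
    _ ≤ 2 ^ m * C₁ * ∏ i, w i + (Λ * ∏ i, w i + Λ₁ * ∏ i, w i) :=
        (enorm_add_le _ _).trans (add_le_add h1 (enorm_sub_le.trans (add_le_add h2 h3)))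
    _ = _ := by
        push_cast
        ring

end Truncation

/-! ### Stopping cubes -/

section Stopping

variable {n m : ℕ} {p : ℝ}

/-- The maximal dyadic cubes contained in `Ω`, as far as they are proper subcubes of `Q`. -/
def stoppingCubes (σ : Fin n → ℤˣ) (Ω : Set (Space n)) (Q : ℤ × (Fin n → ℤ)) :
    Set (ℤ × (Fin n → ℤ)) :=
  {P | P.1 < Q.1 ∧ gridCube σ P ⊆ gridCube σ Q ∧ gridCube σ P ⊆ Ω ∧
    ∀ R : ℤ × (Fin n → ℤ), P.1 < R.1 → gridCube σ P ⊆ gridCube σ R → ¬ gridCube σ R ⊆ Ω}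

lemma pairwiseDisjoint_stoppingCubes (σ : Fin n → ℤˣ) (Ω : Set (Space n))
    (Q : ℤ × (Fin n → ℤ)) : (stoppingCubes σ Ω Q).PairwiseDisjoint (gridCube σ) := by
  intro P hP R hR hne
  by_contra hcon
  obtain ⟨x, hxP, hxR⟩ := not_disjoint_iff.1 hcon
  rcases lt_trichotomy P.1 R.1 with h | h | h
  · exact hP.2.2.2 R h (gridCube_subset_of_mem h.le hxP hxR) hR.2.2.1
  · exact hne (Prod.ext h ((hxP : _ = _).symm.trans (h ▸ (hxR : _ = _))))
  · exact hR.2.2.2 P h (gridCube_subset_of_mem h.le hxR hxP) hP.2.2.1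

/-- If some grid cube around x were contained in Ω, the largest such cube would be a stopping cube.
The point x itself may belong to Ω; a point off Ω nearby at every scale is enough for the
differentiation argument. -/
lemma exists_notMem_of_notMem_stoppingCubes {σ : Fin n → ℤˣ} {Ω : Set (Space n)}
    {Q : ℤ × (Fin n → ℤ)} (hQ : ¬ gridCube σ Q ⊆ Ω) {x : Space n} (hx : x ∈ gridCube σ Q)
    (hx' : ∀ P ∈ stoppingCubes σ Ω Q, x ∉ gridCube σ P) (k : ℤ) :
    ∃ y ∈ gridCube σ (k, gridIndex σ k x), y ∉ Ω := by
  rw [← not_subset]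
  intro hk
  have hbdd : ∀ l : ℤ, gridCube σ (l, gridIndex σ l x) ⊆ Ω → l ≤ Q.1 := by
    intro l hl
    by_contra! hcon
    exact hQ ((gridCube_subset_of_mem (R := (l, gridIndex σ l x)) hcon.le hx rfl).trans hl)
  obtain ⟨l, hl, hmax⟩ := Int.exists_greatest_of_bdd (P := fun l =>
    gridCube σ (l, gridIndex σ l x) ⊆ Ω) ⟨Q.1, hbdd⟩ ⟨k, hk⟩
  have hlQ : l < Q.1 := by
    refine lt_of_le_of_ne (hbdd l hl) fun h => hQ ?_
    have : gridCube σ Q = gridCube σ (l, gridIndex σ l x) := by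
      congr 1
      exact Prod.ext h.symm (by rw [h]; exact (hx : _ = _).symm)
    rw [this]
    exact hl
  refine hx' (l, gridIndex σ l x) ⟨hlQ, gridCube_subset_of_mem hlQ.le rfl hx, hl, ?_⟩ rfl
  intro R hlR hR hRΩ
  have hxR : gridIndex σ R.1 x = R.2 := hR (mem_gridCube_gridIndex σ l x)
  refine absurd (hmax R.1 ?_) (not_le.2 hlR)
  rw [hxR]
  exact hRΩ

/-- By maximality the parent of a stopping cube is not contained in Ω. -/
lemma exists_notMem_near_stoppingCube {σ : Fin n → ℤˣ} {Ω : Set (Space n)}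
    {Q P : ℤ × (Fin n → ℤ)} (hP : P ∈ stoppingCubes σ Ω Q) :
    ∃ y, y ∉ Ω ∧ ∀ x ∈ gridCube σ P, dist x y ≤ 2 * n * 2 ^ P.1 := by
  set R : ℤ × (Fin n → ℤ) := (P.1 + 1, gridIndex σ (P.1 + 1) (gridCorner σ P)) with hR
  have hsub : gridCube σ P ⊆ gridCube σ R :=
    gridCube_subset_of_mem (by simp [hR]) (gridCorner_mem σ P) rfl
  obtain ⟨y, hyR, hy⟩ := not_subset.1 (hP.2.2.2 R (by simp [hR]) hsub)
  refine ⟨y, hy, fun x hx => (dist_le_of_mem_gridCube (hsub hx) hyR).trans_eq ?_⟩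
  rw [hR, zpow_add_one₀ (by norm_num)]
  ring

/-! ### The exceptional set -/

variable {Text : LpOperator n m p}

/-- Ω consists of the points where the maximal density of some |g_i|^p, or of the superlevel set of
`Text g`, is large. The second condition yields points at every scale where `Text g` is small. -/
lemma exists_exceptional_set (hn : 0 < n) (hm : 0 < m) (hp : 1 ≤ p) {A : ℝ≥0}
    (hA : IsWeakBounded Text A) :
    ∃ B Λ : ℝ≥0, 1 ≤ B ∧ ∀ (g : Fin m → Lp ℂ (ENNReal.ofReal p) (volume : Measure (Space n)))
      (u : Fin m → ℝ≥0∞) (s : ℝ), 0 < s → (∀ i, u i ≠ 0) → (∀ i, u i ≠ ∞) →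
      (∀ i, eLpNorm (g i) (ENNReal.ofReal p) volume ≤ u i * ENNReal.ofReal s ^ (n / p)) →
      ∃ Ω : Set (Space n), 4 * volume Ω ≤ ENNReal.ofReal s ^ n ∧ ∀ y ∉ Ω, ∀ R : ℝ, 0 < R →
        (∀ i, eLpNorm (g i) (ENNReal.ofReal p) (volume.restrict (Metric.closedBall y R)) ≤
          B * u i * ENNReal.ofReal R ^ (n / p)) ∧
        4 * volume (Metric.closedBall y (2 * n * R) ∩ {x | Λ * ∏ i, u i < ‖Text g x‖ₑ}) ≤
          ENNReal.ofReal R ^ n := by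
  have hp0 : 0 < p := by linarith
  have hp0' : ENNReal.ofReal p ≠ 0 := by simpa using hp0
  have hκtop : ENNReal.ofReal 5 ^ n * volume (Metric.ball (0 : Space n) 1) ≠ ∞ :=
    ENNReal.mul_ne_top (ENNReal.pow_ne_top ENNReal.ofReal_ne_top) measure_ball_lt_top.ne
  obtain ⟨κ, hκ⟩ : ∃ κ : ℝ≥0,
      (κ : ℝ≥0∞) = ENNReal.ofReal 5 ^ n * volume (Metric.ball (0 : Space n) 1) :=
    ⟨_, ENNReal.coe_toNNReal hκtop⟩
  have hκ0 : 0 < κ := by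
    rw [← ENNReal.coe_pos, hκ]
    exact ENNReal.mul_pos (pow_ne_zero _ (by simp)) (Metric.measure_ball_pos _ _ one_pos).ne'
  have hmax : ∀ (ν : Measure (Space n)) [IsFiniteMeasure ν] (a : ℝ≥0∞), a ≠ 0 → a ≠ ∞ →
      a * volume (largeDensity ν a) ≤ κ * ν univ := by
    intro ν _ a ha ha'
    rw [hκ]
    exact volume_largeDensity_le hn ν ha ha'
  -- D makes the set belonging to each of the m functions have measure at most V/(8m), and ε makes
  -- the set belonging to the operator have measure at most V/8, together V/4. The threshold τ turns
  -- the density bound at radius 2nR into R^n/4.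
  set D : ℝ≥0 := 8 * m * κ + 1 with hD
  set τ : ℝ≥0 := (4 * (2 * n) ^ n)⁻¹ with hτ
  have hτ0 : 0 < τ := by positivity
  set ε : ℝ≥0 := τ / (8 * κ) with hε
  have hε0 : 0 < ε := by positivity
  obtain ⟨Λ, -, hΛ⟩ := hA.exists_volume_le hm hp hε0
  refine ⟨D ^ (1 / p), Λ, NNReal.one_le_rpow (by rw [hD]; exact le_add_self) (by positivity), ?_⟩
  intro g u s hs hu hu' hg
  set V : ℝ≥0∞ := ENNReal.ofReal s ^ n with hV
  have hVtop : V ≠ ∞ := ENNReal.pow_ne_top ENNReal.ofReal_ne_top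
  have hVp : ENNReal.ofReal s ^ ((n : ℝ) / p) = V ^ (1 / p) := by
    rw [hV, ← ENNReal.rpow_natCast, ← ENNReal.rpow_mul, mul_one_div]
  set E : Set (Space n) := {x | Λ * ∏ i, u i < ‖Text g x‖ₑ} with hE
  have hEvol : volume E ≤ ε * V := hΛ g u V hu fun i => hVp ▸ hg i
  set ν : Fin m → Measure (Space n) := fun i =>
    volume.withDensity fun x => ‖g i x‖ₑ ^ p with hν
  have hνball : ∀ i (S : Set (Space n)), MeasurableSet S →
      ν i S = eLpNorm (g i) (ENNReal.ofReal p) (volume.restrict S) ^ p := by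
    intro i S hS
    rw [hν, withDensity_apply _ hS, eLpNorm_eq_lintegral_rpow_enorm_toReal hp0'
      ENNReal.ofReal_ne_top, ENNReal.toReal_ofReal hp0.le, ← ENNReal.rpow_mul,
      one_div_mul_cancel hp0.ne', ENNReal.rpow_one]
  have hνuniv : ∀ i, ν i univ ≤ u i ^ p * V := by
    intro i
    rw [hνball i univ MeasurableSet.univ, Measure.restrict_univ]
    refine (ENNReal.rpow_le_rpow (hg i) hp0.le).trans_eq ?_
    rw [hVp, ENNReal.mul_rpow_of_nonneg _ _ hp0.le, ← ENNReal.rpow_mul,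
      one_div_mul_cancel hp0.ne', ENNReal.rpow_one]
  have hup : ∀ i, u i ^ p ≠ 0 := fun i => (ENNReal.rpow_pos (pos_iff_ne_zero.2 (hu i)) (hu' i)).ne'
  have hup' : ∀ i, u i ^ p ≠ ∞ := fun i => ENNReal.rpow_ne_top_of_nonneg hp0.le (hu' i)
  have hD0 : (D : ℝ≥0∞) ≠ 0 := by
    rw [ENNReal.coe_ne_zero]
    positivity
  have hΩi : ∀ i, 8 * m * volume (largeDensity (ν i) (D * u i ^ p)) ≤ V := by
    intro i
    have : IsFiniteMeasure (ν i) :=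
      ⟨(hνuniv i).trans_lt (ENNReal.mul_lt_top (hup' i).lt_top hVtop.lt_top)⟩
    have h1 := hmax (ν i) (D * u i ^ p) (mul_ne_zero hD0 (hup i))
      (ENNReal.mul_ne_top ENNReal.coe_ne_top (hup' i))
    set v := volume (largeDensity (ν i) (D * u i ^ p))
    have h2 : (u i ^ p * κ) * (8 * m * v) ≤ (u i ^ p * κ) * V := by
      calc (u i ^ p * κ) * (8 * m * v) = u i ^ p * ((8 * m * κ : ℝ≥0) : ℝ≥0∞) * v := by
            push_cast
            ring
        _ ≤ u i ^ p * (D : ℝ≥0∞) * v := by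
            gcongr
            rw [hD]
            exact le_self_add
        _ = D * u i ^ p * v := by ring
        _ ≤ κ * (u i ^ p * V) := h1.trans (by gcongr; exact hνuniv i)
        _ = _ := by ring
    rwa [ENNReal.mul_le_mul_iff_right (mul_ne_zero (hup i) (by simpa using hκ0.ne'))
      (ENNReal.mul_ne_top (hup' i) ENNReal.coe_ne_top)] at h2
  have hΩ0 : 8 * volume (largeDensity (volume.restrict E) τ) ≤ V := by
    have : IsFiniteMeasure (volume.restrict E) := by
      refine ⟨?_⟩
      rw [Measure.restrict_apply_univ]
      exact hEvol.trans_lt (ENNReal.mul_lt_top ENNReal.coe_lt_top hVtop.lt_top)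
    have h1 := hmax (volume.restrict E) τ (by simpa using hτ0.ne') ENNReal.coe_ne_top
    rw [Measure.restrict_apply_univ] at h1
    set v := volume (largeDensity (volume.restrict E) τ)
    have h2 : (τ : ℝ≥0∞) * (8 * v) ≤ τ * V := by
      calc (τ : ℝ≥0∞) * (8 * v) = 8 * (τ * v) := by ring
        _ ≤ 8 * (κ * (ε * V)) :=
            mul_le_mul_right (h1.trans (mul_le_mul_right hEvol _)) _
        _ = ((8 * κ * ε : ℝ≥0) : ℝ≥0∞) * V := by push_cast; ring
        _ = τ * V := by
            congr 2
            rw [hε]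
            field_simp
    rwa [ENNReal.mul_le_mul_iff_right (by simpa using hτ0.ne') ENNReal.coe_ne_top] at h2
  refine ⟨largeDensity (volume.restrict E) τ ∪ ⋃ i, largeDensity (ν i) (D * u i ^ p), ?_, ?_⟩
  · set v₀ := volume (largeDensity (volume.restrict E) τ)
    set v := fun i => volume (largeDensity (ν i) (D * u i ^ p))
    have h1 : 8 * ∑ i, v i ≤ V := by
      have h2 : (m : ℝ≥0∞) * (8 * ∑ i, v i) ≤ m * V := by
        calc (m : ℝ≥0∞) * (8 * ∑ i, v i) = ∑ i, 8 * m * v i := by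
              rw [← Finset.mul_sum]
              ring
          _ ≤ ∑ _i : Fin m, V := Finset.sum_le_sum fun i _ => hΩi i
          _ = m * V := by simp
      rwa [ENNReal.mul_le_mul_iff_right (by exact_mod_cast hm.ne') (ENNReal.natCast_ne_top m)]
        at h2
    have h3 : 2 * (4 * (v₀ + ∑ i, v i)) ≤ 2 * V := by
      calc 2 * (4 * (v₀ + ∑ i, v i)) = 8 * v₀ + 8 * ∑ i, v i := by ring
        _ ≤ V + V := add_le_add hΩ0 h1
        _ = 2 * V := (two_mul _).symm
    rw [ENNReal.mul_le_mul_iff_right (by norm_num) (by norm_num)] at h3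
    refine le_trans ?_ h3
    gcongr
    refine (measure_union_le _ _).trans ?_
    gcongr
    refine (measure_iUnion_le _).trans ?_
    rw [tsum_fintype]
  · intro y hy R hR
    rw [mem_union, not_or, mem_iUnion, not_exists] at hy
    constructor
    · intro i
      have h1 := measure_closedBall_le_of_notMem (hy.2 i) hR
      rw [hνball i _ Metric.isClosed_closedBall.measurableSet] at h1
      have h2 := ENNReal.rpow_le_rpow h1 (z := 1 / p) (by positivity)
      rw [← ENNReal.rpow_mul, mul_one_div_cancel hp0.ne', ENNReal.rpow_one,
        ENNReal.mul_rpow_of_nonneg _ _ (by positivity),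
        ENNReal.mul_rpow_of_nonneg _ _ (by positivity), ← ENNReal.rpow_mul,
        mul_one_div_cancel hp0.ne', ENNReal.rpow_one, ← ENNReal.rpow_natCast,
        ← ENNReal.rpow_mul, mul_one_div, ← ENNReal.coe_rpow_of_nonneg _ (by positivity)] at h2
      exact h2
    · have h1 := measure_closedBall_le_of_notMem hy.1 (r := 2 * n * R) (by positivity)
      rw [Measure.restrict_apply Metric.isClosed_closedBall.measurableSet] at h1
      calc _ ≤ 4 * (τ * ENNReal.ofReal (2 * n * R) ^ n) := by gcongr
        _ = ((4 * τ * (2 * n) ^ n : ℝ≥0) : ℝ≥0∞) * ENNReal.ofReal R ^ n := by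
            rw [ENNReal.ofReal_mul (by positivity), mul_pow,
              show ENNReal.ofReal (2 * (n : ℝ)) = ((2 * n : ℝ≥0) : ℝ≥0∞) by
                rw [ENNReal.ofReal_mul (by norm_num)]
                simp]
            push_cast
            ring
        _ = ENNReal.ofReal R ^ n := by
            have h2 : 4 * τ * (2 * (n : ℝ≥0)) ^ n = 1 := by
              rw [hτ]
              field_simp
            rw [h2, ENNReal.coe_one, one_mul]

end Stopping

/-! ### The stopping time step -/

section Step

variable {n m : ℕ} {p : ℝ}

/-- The truncation of `f` to a large ball around the cube `Q`. -/
noncomputable def cubeTrunc (σ : Fin n → ℤˣ)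
    (f : Fin m → Lp ℂ (ENNReal.ofReal p) (volume : Measure (Space n)))
    (Q : ℤ × (Fin n → ℤ)) (i : Fin m) : Lp ℂ (ENNReal.ofReal p) (volume : Measure (Space n)) :=
  truncate (f i) (gridCorner σ Q) (8 * n * 2 ^ Q.1)

/-- The normalized `L^p` norm of `f` on a large ball around the cube `Q`. -/
noncomputable def cubeSize (σ : Fin n → ℤˣ)
    (f : Fin m → Lp ℂ (ENNReal.ofReal p) (volume : Measure (Space n)))
    (Q : ℤ × (Fin n → ℤ)) (i : Fin m) : ℝ≥0∞ :=
  eLpNorm (f i) (ENNReal.ofReal p)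
    (volume.restrict (Metric.ball (gridCorner σ Q) (8 * n * 2 ^ Q.1))) /
      ENNReal.ofReal (2 ^ Q.1) ^ (n / p)

lemma ball_subset_ball_of_gridCube_subset {σ : Fin n → ℤˣ} {P Q : ℤ × (Fin n → ℤ)}
    (h : P.1 < Q.1) (hPQ : gridCube σ P ⊆ gridCube σ Q) :
    Metric.ball (gridCorner σ P) (8 * n * 2 ^ P.1) ⊆
      Metric.ball (gridCorner σ Q) (8 * n * 2 ^ Q.1) := by
  refine Metric.ball_subset_ball' ?_
  have h1 := dist_le_of_mem_gridCube (hPQ (gridCorner_mem σ P)) (gridCorner_mem σ Q)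
  have h2 : (2 : ℝ) ^ P.1 * 2 ≤ 2 ^ Q.1 := by
    rw [← zpow_add_one₀ (by norm_num)]
    exact zpow_le_zpow_right₀ (by norm_num) h
  have h3 : (n : ℝ) * (2 ^ P.1 * 2) ≤ n * 2 ^ Q.1 := by gcongr
  have h4 : (0 : ℝ) ≤ n * 2 ^ Q.1 := by positivity
  linarith

/-- The estimate on a child of Q involves the truncated functions of Q; truncating them again gives
the functions from which the step at the child starts. -/
lemma cubeTrunc_cubeTrunc {σ : Fin n → ℤˣ}
    (f : Fin m → Lp ℂ (ENNReal.ofReal p) (volume : Measure (Space n))) {P Q : ℤ × (Fin n → ℤ)}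
    (h : P.1 < Q.1) (hPQ : gridCube σ P ⊆ gridCube σ Q) :
    cubeTrunc σ (cubeTrunc σ f Q) P = cubeTrunc σ f P :=
  funext fun i => truncate_truncate (f i) (ball_subset_ball_of_gridCube_subset h hPQ)

lemma ofReal_side_rpow_ne_zero (k : ℤ) (q : ℝ) : ENNReal.ofReal ((2 : ℝ) ^ k) ^ q ≠ 0 := by
  refine (ENNReal.rpow_pos ?_ ENNReal.ofReal_ne_top).ne'
  rw [ENNReal.ofReal_pos]
  positivity

lemma ofReal_side_rpow_ne_top (k : ℤ) (q : ℝ) : ENNReal.ofReal ((2 : ℝ) ^ k) ^ q ≠ ∞ :=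
  ENNReal.rpow_ne_top_of_ne_zero (by simp; positivity) ENNReal.ofReal_ne_top

lemma eLpNorm_cubeTrunc (σ : Fin n → ℤˣ)
    (f : Fin m → Lp ℂ (ENNReal.ofReal p) (volume : Measure (Space n)))
    (Q : ℤ × (Fin n → ℤ)) (i : Fin m) :
    eLpNorm (cubeTrunc σ f Q i) (ENNReal.ofReal p) volume =
      cubeSize σ f Q i * ENNReal.ofReal (2 ^ Q.1) ^ (n / p) := by
  rw [cubeTrunc, eLpNorm_truncate, cubeSize, ENNReal.div_mul_cancel
    (ofReal_side_rpow_ne_zero _ _) (ofReal_side_rpow_ne_top _ _)]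

lemma cubeSize_ne_top (σ : Fin n → ℤˣ)
    (f : Fin m → Lp ℂ (ENNReal.ofReal p) (volume : Measure (Space n)))
    (Q : ℤ × (Fin n → ℤ)) (i : Fin m) : cubeSize σ f Q i ≠ ∞ := by
  refine ENNReal.div_ne_top ?_ (ofReal_side_rpow_ne_zero _ _)
  exact ((Lp.memLp (f i)).restrict _).eLpNorm_ne_top

variable {Text : LpOperator n m p}

lemma eq_zero_of_eLpNorm_eq_zero (hp : 0 < p)
    {g : Lp ℂ (ENNReal.ofReal p) (volume : Measure (Space n))}
    (h : eLpNorm g (ENNReal.ofReal p) volume = 0) : g = 0 := by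
  rw [Lp.eq_zero_iff_ae_eq_zero]
  exact (eLpNorm_eq_zero_iff (Lp.aestronglyMeasurable _) (by simpa using hp)).1 h

lemma truncate_zero (c : Space n) (R : ℝ) :
    truncate (0 : Lp ℂ (ENNReal.ofReal p) (volume : Measure (Space n))) c R = 0 := by
  refine Lp.ext ?_
  filter_upwards [coeFn_truncate (0 : Lp ℂ (ENNReal.ofReal p) (volume : Measure (Space n))) c R,
    Lp.coeFn_zero ℂ (ENNReal.ofReal p) (volume : Measure (Space n))] with x h1 h2
  rw [h1, h2]
  by_cases hx : x ∈ Metric.ball c R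
  · rw [indicator_of_mem hx, h2]
  · rw [indicator_of_notMem hx, Pi.zero_apply]

/-- Comparison of `Text g` with its truncation to a cube in terms of global norms. -/
lemma exists_enorm_sub_cubeTrunc_le [Fact (1 ≤ ENNReal.ofReal p)] (hn : 0 < n) (hm : 0 < m)
    (hp : 1 ≤ p) {A : ℝ≥0} (hA : IsWeakBounded Text A)
    {T : SchwartzOperator n m} {K : Space n → (Fin m → Space n) → ℂ} (hK : HasKernel T K)
    (hT : ∀ f : Fin m → 𝓢(Space n, ℂ),
      IsGivenBy (T f) (Text fun i => (f i).toLp (ENNReal.ofReal p) volume))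
    (H2 : KernelRegularity p K) (σ : Fin n → ℤˣ) :
    ∃ C : ℝ≥0, ∀ (g : Fin m → Lp ℂ (ENNReal.ofReal p) (volume : Measure (Space n)))
      (P : ℤ × (Fin n → ℤ)) (w : Fin m → ℝ≥0∞),
      (∀ i, eLpNorm (g i) (ENNReal.ofReal p) volume ≤
        w i * ENNReal.ofReal (2 ^ P.1) ^ (n / p)) →
      ∀ᵐ x, x ∈ gridCube σ P →
        ‖Text g x - Text (cubeTrunc σ g P) x‖ₑ ≤ C * ∏ i, w i := by
  have hp0 : 0 < p := by linarith
  obtain ⟨Λ, -, hΛ⟩ := hA.exists_volume_le hm hp (ε := 4⁻¹) (by positivity)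
  obtain ⟨C, hC⟩ := exists_enorm_sub_truncate_le hn hm hp hA hK hT H2 Λ
  refine ⟨C, fun g P w hg => ?_⟩
  by_cases hw : ∀ i, w i ≠ 0
  · refine hC g (gridCube σ P) (gridCorner σ P) (2 ^ P.1) w (by positivity) hw
      (fun x hx => dist_le_of_mem_gridCube hx (gridCorner_mem σ P)) (volume_gridCube σ P)
      (fun i R hR => ?_) ?_
    · refine (eLpNorm_mono_measure _ Measure.restrict_le_self).trans ((hg i).trans ?_)
      gcongr
    · have h1 := hΛ g w (ENNReal.ofReal (2 ^ P.1) ^ n) hw fun i => by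
        rw [← ENNReal.rpow_natCast, ← ENNReal.rpow_mul, mul_one_div]
        exact hg i
      calc _ ≤ 4 * volume {x | Λ * ∏ i, w i < ‖Text g x‖ₑ} := by
            gcongr
            exact inter_subset_right
        _ ≤ 4 * (((4⁻¹ : ℝ≥0) : ℝ≥0∞) * ENNReal.ofReal (2 ^ P.1) ^ n) := by gcongr
        _ = _ := by
            rw [← mul_assoc, volume_gridCube]
            have h2 : (4 : ℝ≥0∞) * ((4⁻¹ : ℝ≥0) : ℝ≥0∞) = 1 := by
              have : (4 : ℝ≥0) * 4⁻¹ = 1 := by norm_num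
              exact_mod_cast this
            rw [h2, one_mul]
  -- An entry of size 0 is the zero function, and then both values of `Text` vanish.
  · push Not at hw
    obtain ⟨i, hi⟩ := hw
    have hgi : g i = 0 := eq_zero_of_eLpNorm_eq_zero hp0
      (le_antisymm ((hg i).trans_eq (by rw [hi, zero_mul])) zero_le)
    filter_upwards [ae_apply_eq_zero Text g hgi, ae_apply_eq_zero Text (cubeTrunc σ g P)
      (i := i) (by rw [cubeTrunc, hgi, truncate_zero])] with x h1 h2 _
    rw [h1, h2, sub_zero, enorm_zero]
    exact zero_le

/-- Density theorem: at almost every point of E the density of E tends to 1, which rules out density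
at most 1/2 along the radii n 2^k. -/
lemma ae_notMem_of_volume_inter_closedBall_le (hn : 0 < n) (E : Set (Space n)) :
    ∀ᵐ x, (∀ k : ℤ, 2 * volume (E ∩ Metric.closedBall x (n * 2 ^ k)) ≤
      volume (Metric.closedBall x (n * 2 ^ k))) → x ∉ E := by
  have h := ae_imp_of_ae_restrict (Besicovitch.ae_tendsto_measure_inter_div
    (volume : Measure (Space n)) E)
  filter_upwards [h] with x hx hk hxE
  have hlim : Tendsto (fun j : ℕ => (n : ℝ) * 2 ^ (-(j : ℤ))) atTop (𝓝[>] 0) := by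
    refine tendsto_nhdsWithin_iff.2 ⟨?_, Eventually.of_forall fun j => by
      change 0 < (n : ℝ) * 2 ^ (-(j : ℤ)); positivity⟩
    have := (tendsto_pow_atTop_nhds_zero_of_lt_one (r := (2 : ℝ)⁻¹) (by norm_num)
      (by norm_num)).const_mul (n : ℝ)
    simpa [zpow_neg] using this
  have h1 := ((hx hxE).comp hlim).eventually (lt_mem_nhds ENNReal.one_half_lt_one)
  obtain ⟨j, hj⟩ := h1.exists
  simp only [Function.comp_apply] at hj
  have h2 := hk (-(j : ℤ))
  refine absurd hj (not_lt.2 ?_)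
  refine ENNReal.div_le_of_le_mul ?_
  rw [mul_comm 2] at h2
  rwa [mul_comm 2⁻¹, ← div_eq_mul_inv, ENNReal.le_div_iff_mul_le (by simp) (by simp)]

/-- The children are the stopping cubes of the exceptional set. For a child P, a point off Ω near P
supplies the hypotheses of `exists_enorm_sub_truncate_le` on P with the sizes taken over Q. -/
lemma exists_stopping_family [Fact (1 ≤ ENNReal.ofReal p)] (hn : 0 < n) (hm : 0 < m)
    (hp : 1 ≤ p) {A : ℝ≥0} (hA : IsWeakBounded Text A)
    {T : SchwartzOperator n m} {K : Space n → (Fin m → Space n) → ℂ} (hK : HasKernel T K)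
    (hT : ∀ f : Fin m → 𝓢(Space n, ℂ),
      IsGivenBy (T f) (Text fun i => (f i).toLp (ENNReal.ofReal p) volume))
    (H2 : KernelRegularity p K) (σ : Fin n → ℤˣ) :
    ∃ C : ℝ≥0, ∀ (f : Fin m → Lp ℂ (ENNReal.ofReal p) (volume : Measure (Space n)))
      (Q : ℤ × (Fin n → ℤ)), ∃ ch : Set (ℤ × (Fin n → ℤ)),
      (∀ P ∈ ch, P.1 < Q.1 ∧ gridCube σ P ⊆ gridCube σ Q) ∧
      ch.PairwiseDisjoint (gridCube σ) ∧
      4 * volume (⋃ P ∈ ch, gridCube σ P) ≤ volume (gridCube σ Q) ∧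
      (∀ᵐ x, x ∈ gridCube σ Q → (∀ P ∈ ch, x ∉ gridCube σ P) →
        ‖Text (cubeTrunc σ f Q) x‖ₑ ≤ C * ∏ i, cubeSize σ f Q i) ∧
      ∀ P ∈ ch, ∀ᵐ x, x ∈ gridCube σ P →
        ‖Text (cubeTrunc σ f Q) x - Text (cubeTrunc σ f P) x‖ₑ ≤
          C * ∏ i, cubeSize σ f Q i := by
  have hp0 : 0 < p := by linarith
  obtain ⟨B, Λ, hB, hex⟩ := exists_exceptional_set hn hm hp hA
  obtain ⟨C, hC⟩ := exists_enorm_sub_truncate_le hn hm hp hA hK hT H2 Λ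
  -- Covers the change of centre from the corner of P to a point y off Ω: a ball of radius R ≥
  -- 2^(P.1) about the corner lies in the ball of radius (1 + 2n) R about y.
  set B' : ℝ≥0 := B * (1 + 2 * n) ^ (n / p) with hB'
  have hB'1 : 1 ≤ B' := one_le_mul hB (NNReal.one_le_rpow le_self_add (by positivity))
  refine ⟨Λ + C * B' ^ m, fun f Q => ?_⟩
  set g := cubeTrunc σ f Q with hg
  set u := cubeSize σ f Q with hu
  by_cases hu0 : ∀ i, u i ≠ 0
  swap
  · push Not at hu0
    obtain ⟨i, hi⟩ := hu0
    have hgi : g i = 0 := eq_zero_of_eLpNorm_eq_zero hp0 (by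
      rw [hg, eLpNorm_cubeTrunc, ← hu, hi, zero_mul])
    refine ⟨∅, by simp, by simp, by simp, ?_, by simp⟩
    filter_upwards [ae_apply_eq_zero Text g hgi] with x hx _ _
    rw [hx, enorm_zero]
    exact zero_le
  have hside : (0 : ℝ) < 2 ^ Q.1 := by positivity
  obtain ⟨Ω, hΩvol, hΩ⟩ := hex g u (2 ^ Q.1) hside hu0 (cubeSize_ne_top σ f Q)
    fun i => (eLpNorm_cubeTrunc σ f Q i).le
  rw [← volume_gridCube σ Q] at hΩvol
  have hQΩ : ¬ gridCube σ Q ⊆ Ω := by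
    intro hsub
    have h1 : 4 * volume (gridCube σ Q) ≤ 1 * volume (gridCube σ Q) := by
      rw [one_mul]
      exact le_trans (by gcongr) hΩvol
    rw [ENNReal.mul_le_mul_iff_left (volume_gridCube_pos σ Q) (volume_gridCube_ne_top σ Q)] at h1
    norm_num at h1
  set E : Set (Space n) := {x | Λ * ∏ i, u i < ‖Text g x‖ₑ} with hE
  refine ⟨stoppingCubes σ Ω Q, fun P hP => ⟨hP.1, hP.2.1⟩, pairwiseDisjoint_stoppingCubes σ Ω Q,
    ?_, ?_, ?_⟩
  · refine le_trans ?_ hΩvol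
    gcongr
    exact iUnion₂_subset fun P hP => hP.2.2.1
  · filter_upwards [ae_notMem_of_volume_inter_closedBall_le hn E] with x hx hxQ hxch
    have hxE : x ∉ E := by
      refine hx fun k => ?_
      obtain ⟨y, hy, hyΩ⟩ := exists_notMem_of_notMem_stoppingCubes hQΩ hxQ hxch k
      have hd := dist_le_of_mem_gridCube (mem_gridCube_gridIndex σ k x) hy
      simp only at hd
      have h1 := (hΩ y hyΩ (2 ^ k) (by positivity)).2
      calc 2 * volume (E ∩ Metric.closedBall x (n * 2 ^ k))
          ≤ 4 * volume (Metric.closedBall y (2 * n * 2 ^ k) ∩ E) := by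
            refine mul_le_mul' (by norm_num) (measure_mono ?_)
            · refine fun z hz => ⟨Metric.closedBall_subset_closedBall' ?_ hz.2, hz.1⟩
              linarith
        _ ≤ volume (gridCube σ (k, gridIndex σ k x)) := by
            rw [volume_gridCube]
            exact h1
        _ ≤ _ := by
            refine measure_mono fun z hz => ?_
            exact dist_le_of_mem_gridCube hz (mem_gridCube_gridIndex σ k x)
    have h1 : ‖Text g x‖ₑ ≤ Λ * ∏ i, u i := not_lt.1 hxE
    refine h1.trans ?_
    gcongr
    exact le_self_add
  · intro P hP
    obtain ⟨y, hyΩ, hy⟩ := exists_notMem_near_stoppingCube hP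
    have hsP : (0 : ℝ) < 2 ^ P.1 := by positivity
    have hprod : ∏ i, (B' * u i) = (B' : ℝ≥0∞) ^ m * ∏ i, u i := by
      rw [Finset.prod_mul_distrib, Finset.prod_const, Finset.card_univ, Fintype.card_fin]
    have key := hC g (gridCube σ P) (gridCorner σ P) (2 ^ P.1) (fun i => B' * u i) hsP
      (fun i => mul_ne_zero (by simpa using (zero_lt_one.trans_le hB'1).ne') (hu0 i))
      (fun x hx => dist_le_of_mem_gridCube hx (gridCorner_mem σ P)) (volume_gridCube σ P)
      (fun i R hR => ?_) ?_
    · have htr : (fun i => truncate (g i) (gridCorner σ P) (8 * n * 2 ^ P.1)) =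
          cubeTrunc σ f P := cubeTrunc_cubeTrunc f hP.1 hP.2.1
      rw [htr, hprod] at key
      filter_upwards [key] with x hx hxP
      refine (hx hxP).trans ?_
      rw [← mul_assoc]
      gcongr
      push_cast
      exact le_add_self
    · have hR0 : 0 < R := hsP.trans_le hR
      have h1 := (hΩ y hyΩ ((1 + 2 * n) * R) (by positivity)).1 i
      calc _ ≤ eLpNorm (g i) (ENNReal.ofReal p)
            (volume.restrict (Metric.closedBall y ((1 + 2 * n) * R))) := by
            refine eLpNorm_mono_measure _ (Measure.restrict_mono ?_ le_rfl)
            refine Metric.ball_subset_closedBall.trans (Metric.closedBall_subset_closedBall' ?_)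
            have := hy _ (gridCorner_mem σ P)
            have h2 : 2 * (n : ℝ) * 2 ^ P.1 ≤ 2 * n * R := by gcongr
            linarith
        _ ≤ _ := h1
        _ = _ := by
            rw [ENNReal.ofReal_mul (by positivity), ENNReal.mul_rpow_of_nonneg _ _ (by positivity),
              hB', show ENNReal.ofReal (1 + 2 * n) = ((1 + 2 * n : ℝ≥0) : ℝ≥0∞) by
                rw [ENNReal.ofReal_add (by norm_num) (by positivity),
                  ENNReal.ofReal_mul (by norm_num)]
                simp, ← ENNReal.coe_rpow_of_nonneg _ (by positivity)]
            push_cast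
            ring
    · have h1 := (hΩ y hyΩ (2 ^ P.1) hsP).2
      rw [volume_gridCube]
      refine le_trans ?_ h1
      gcongr
      · exact fun x hx => hy x hx
      · refine fun x hx => lt_of_le_of_lt (b := Λ * ∏ i, (B' * u i)) ?_ hx
        rw [hprod, ← mul_assoc]
        gcongr
        refine le_mul_of_one_le_right zero_le ?_
        exact one_le_pow₀ (by exact_mod_cast hB'1)

end Step

/-! ### The tree of stopping cubes -/

section Tree

variable {n m : ℕ} {p : ℝ} {σ : Fin n → ℤˣ}

/-- The cube of side `2 ^ M` containing the origin. -/
noncomputable def originCube (σ : Fin n → ℤˣ) (M : ℕ) : ℤ × (Fin n → ℤ) :=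
  ((M : ℤ), gridIndex σ M 0)

/-- The cubes that are reached from the cubes `originCube σ M` by passing to children. -/
def cubeTree (σ : Fin n → ℤˣ) (c : ℤ × (Fin n → ℤ) → Set (ℤ × (Fin n → ℤ))) :
    Set (ℤ × (Fin n → ℤ)) :=
  {Q | ∃ M, Relation.ReflTransGen (fun Q P => P ∈ c Q) (originCube σ M) Q}

/-- The part of a cube that is not covered by its children. -/
def ownPart (σ : Fin n → ℤˣ) (c : ℤ × (Fin n → ℤ) → Set (ℤ × (Fin n → ℤ)))
    (Q : ℤ × (Fin n → ℤ)) : Set (Space n) :=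
  gridCube σ Q \ ⋃ P ∈ c Q, gridCube σ P

/-- The properties of a choice of children for every cube. -/
structure IsChildMap (σ : Fin n → ℤˣ) (c : ℤ × (Fin n → ℤ) → Set (ℤ × (Fin n → ℤ))) : Prop where
  lt : ∀ Q, ∀ P ∈ c Q, P.1 < Q.1
  subset : ∀ Q, ∀ P ∈ c Q, gridCube σ P ⊆ gridCube σ Q
  disjoint : ∀ Q, (c Q).PairwiseDisjoint (gridCube σ)
  volume_le : ∀ Q, volume (gridCube σ Q) ≤ 4 * volume (ownPart σ c Q)
  origin : ∀ M, originCube σ M ∈ c (originCube σ (M + 1))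

variable {c : ℤ × (Fin n → ℤ) → Set (ℤ × (Fin n → ℤ))}

lemma measurableSet_ownPart (Q : ℤ × (Fin n → ℤ)) : MeasurableSet (ownPart σ c Q) :=
  (measurableSet_gridCube σ Q).diff
    (MeasurableSet.biUnion (to_countable _) fun P _ => measurableSet_gridCube σ P)

namespace IsChildMap

variable (hc : IsChildMap σ c)
include hc

lemma gridCube_subset {Q P : ℤ × (Fin n → ℤ)}
    (h : Relation.ReflTransGen (fun Q P => P ∈ c Q) Q P) : gridCube σ P ⊆ gridCube σ Q := by
  induction h with
  | refl => exact le_rfl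
  | tail _ hbc ih => exact (hc.subset _ _ hbc).trans ih

lemma reflTransGen_mem {Q P : ℤ × (Fin n → ℤ)} {x : Space n} (hx : x ∈ gridCube σ P)
    (h : Relation.ReflTransGen (fun Q P => P ∈ c Q) Q P) :
    Relation.ReflTransGen (fun Q P => P ∈ c Q ∧ x ∈ gridCube σ P) Q P := by
  induction h with
  | refl => exact .refl
  | tail _ hbc ih => exact (ih (hc.subset _ _ hbc hx)).tail ⟨hbc, hx⟩

lemma reflTransGen_origin {M M' : ℕ} (h : M ≤ M') :
    Relation.ReflTransGen (fun Q P => P ∈ c Q) (originCube σ M') (originCube σ M) := by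
  induction M', h using Nat.le_induction with
  | base => exact .refl
  | succ M' _ ih => exact ih.head (hc.origin M')

/-- Any two cubes of the tree descend from a common origin cube. The descending path of cubes
containing x is unique and cannot continue below a cube whose own part contains x, so x lies in at
most one own part. -/
lemma pairwiseDisjoint_ownPart : (cubeTree σ c).PairwiseDisjoint (ownPart σ c) := by
  rintro Q ⟨M, hM⟩ R ⟨M', hM'⟩ hne
  refine disjoint_left.2 fun x hxQ hxR => hne ?_
  have h1 := hc.reflTransGen_mem hxQ.1 ((hc.reflTransGen_origin (le_max_left M M')).trans hM)
  have h2 := hc.reflTransGen_mem hxR.1 ((hc.reflTransGen_origin (le_max_right M M')).trans hM')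
  have huniq : Relator.RightUnique (fun Q P => P ∈ c Q ∧ x ∈ gridCube σ P) := by
    intro Q P P' hP hP'
    by_contra hne
    exact disjoint_left.1 (hc.disjoint Q hP.1 hP'.1 hne) hP.2 hP'.2
  have hterm : ∀ {Q R}, x ∈ ownPart σ c Q →
      Relation.ReflTransGen (fun Q P => P ∈ c Q ∧ x ∈ gridCube σ P) Q R → Q = R := by
    intro Q R hQ h
    rcases h.cases_head with h | ⟨P, hP, -⟩
    · exact h
    · exact absurd (mem_biUnion hP.1 hP.2) hQ.2
  rcases Relation.ReflTransGen.total_of_right_unique huniq h1 h2 with h | h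
  · exact hterm hxQ h
  · exact (hterm hxR h).symm

/-- The own parts are disjoint and carry a quarter of each cube, so the volumes below one origin
cube are summable and Borel–Cantelli applies. -/
lemma ae_finite (M : ℕ) : ∀ᵐ x, {Q | Q ∈ cubeTree σ c ∧ gridCube σ Q ⊆
    gridCube σ (originCube σ M) ∧ x ∈ gridCube σ Q}.Finite := by
  set S := {Q | Q ∈ cubeTree σ c ∧ gridCube σ Q ⊆ gridCube σ (originCube σ M)}
  have hsum : ∑' Q : S, volume (gridCube σ (Q : ℤ × (Fin n → ℤ))) ≠ ∞ := by
    refine ne_top_of_le_ne_top (ENNReal.mul_ne_top (by norm_num : (4 : ℝ≥0∞) ≠ ∞)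
      (volume_gridCube_ne_top σ (originCube σ M))) ?_
    calc ∑' Q : S, volume (gridCube σ (Q : ℤ × (Fin n → ℤ)))
        ≤ ∑' Q : S, 4 * volume (ownPart σ c Q) :=
          ENNReal.tsum_le_tsum fun Q => hc.volume_le Q
      _ = 4 * volume (⋃ Q : S, ownPart σ c Q) := by
          rw [ENNReal.tsum_mul_left, measure_iUnion]
          · intro Q R hQR
            exact hc.pairwiseDisjoint_ownPart Q.2.1 R.2.1 fun h => hQR (Subtype.ext h)
          · exact fun Q => measurableSet_ownPart _
      _ ≤ _ := by
          gcongr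
          exact iUnion_subset fun Q => sdiff_subset.trans Q.2.2
  filter_upwards [ae_finite_setOfPred_mem hsum] with x hx
  refine (hx.image Subtype.val).subset ?_
  rintro Q ⟨h1, h2, h3⟩
  exact ⟨⟨Q, h1, h2⟩, h3, rfl⟩

/-- Summation of a telescoping estimate along the tree. -/
lemma ae_enorm_le {F : ℤ × (Fin n → ℤ) → Space n → ℂ} {a : ℤ × (Fin n → ℤ) → ℝ≥0∞} {C : ℝ≥0∞}
    (hF : ∀ Q, ∀ᵐ x, x ∈ ownPart σ c Q → ‖F Q x‖ₑ ≤ C * a Q)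
    (hF' : ∀ Q, ∀ P ∈ c Q, ∀ᵐ x, x ∈ gridCube σ P → ‖F Q x - F P x‖ₑ ≤ C * a Q) :
    ∀ᵐ x, ∀ M : ℕ, x ∈ gridCube σ (originCube σ M) →
      ‖F (originCube σ M) x‖ₑ ≤
        C * ∑' Q, {Q | Q ∈ cubeTree σ c ∧ x ∈ gridCube σ Q}.indicator a Q := by
  have hF'' : ∀ᵐ x, ∀ Q, ∀ P ∈ c Q, x ∈ gridCube σ P → ‖F Q x - F P x‖ₑ ≤ C * a Q :=
    ae_all_iff.2 fun Q => (ae_ball_iff (to_countable _)).2 (hF' Q)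
  filter_upwards [ae_all_iff.2 hF, hF'', ae_all_iff.2 hc.ae_finite] with x h1 h2 h3 M hxM
  set r : ℤ × (Fin n → ℤ) → ℤ × (Fin n → ℤ) → Prop := fun Q P => P ∈ c Q ∧ x ∈ gridCube σ P
    with hr
  have hrr : ∀ {Q P}, Relation.ReflTransGen r Q P →
      Relation.ReflTransGen (fun Q P => P ∈ c Q) Q P := fun h =>
    Relation.ReflTransGen.mono (r := r) (fun _ _ (h : r _ _) => h.1) _ _ h
  have hrx : ∀ {Q P}, x ∈ gridCube σ Q → Relation.ReflTransGen r Q P → x ∈ gridCube σ P := by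
    intro Q P hQ h
    rcases h.cases_tail with h | ⟨R, -, hR⟩
    · exact h ▸ hQ
    · exact hR.2
  have hfin : {Q | Relation.ReflTransGen r (originCube σ M) Q}.Finite :=
    (h3 M).subset fun Q hQ => ⟨⟨M, hrr hQ⟩, hc.gridCube_subset (hrr hQ), hrx hxM hQ⟩
  -- W is the last cube on the path through x. No child of W contains x, so the bound on own parts
  -- ends the telescoping.
  obtain ⟨W, hW, hWmin⟩ := exists_min_image _ (fun Q => Q.1) hfin ⟨originCube σ M, .refl⟩
  have hWown : x ∈ ownPart σ c W := by
    refine ⟨hrx hxM hW, fun hcon => ?_⟩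
    obtain ⟨P, hP, hxP⟩ := mem_iUnion₂.1 hcon
    exact absurd (hWmin P (Relation.ReflTransGen.tail hW ⟨hP, hxP⟩)) (not_le.2 (hc.lt W P hP))
  set B : ℤ → Set (ℤ × (Fin n → ℤ)) := fun k =>
    {Q | Q ∈ cubeTree σ c ∧ x ∈ gridCube σ Q ∧ Q.1 ≤ k} with hB
  -- Sums up to level k: levels strictly decrease along the path, so each new cube adds a term not
  -- yet counted.
  set T : ℤ → ℝ≥0∞ := fun k => ∑' Q, (B k).indicator a Q with hT
  have hstep : ∀ Q ∈ cubeTree σ c, x ∈ gridCube σ Q → ∀ k < Q.1, a Q + T k ≤ T Q.1 := by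
    intro Q hQ hxQ k hk
    have h4 : a Q = ∑' R, ({Q} : Set (ℤ × (Fin n → ℤ))).indicator a R := by
      rw [tsum_eq_single Q fun R hR => indicator_of_notMem (by simpa using hR) a,
        indicator_of_mem (mem_singleton Q)]
    rw [h4, hT, ← ENNReal.tsum_add]
    refine ENNReal.tsum_le_tsum fun R => ?_
    by_cases hRQ : R = Q
    · subst hRQ
      rw [indicator_of_mem (mem_singleton R), indicator_of_notMem (fun h => not_le.2 hk h.2.2),
        add_zero, indicator_of_mem (show R ∈ B R.1 from ⟨hQ, hxQ, le_rfl⟩)]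
    · rw [indicator_of_notMem (by simpa using hRQ), zero_add]
      have hsub : B k ⊆ B Q.1 := fun R hR => ⟨hR.1, hR.2.1, hR.2.2.trans hk.le⟩
      exact indicator_le_indicator_of_subset hsub (fun _ => zero_le) R
  have hmain : ∀ Q, Relation.ReflTransGen r Q W → Q ∈ cubeTree σ c → x ∈ gridCube σ Q →
      ‖F Q x‖ₑ ≤ C * T Q.1 := by
    intro Q hQW
    induction hQW using Relation.ReflTransGen.head_induction_on with
    | refl =>
      intro hWS hxW
      refine (h1 W hWown).trans ?_
      gcongr
      exact le_self_add.trans (hstep W hWS hxW (W.1 - 1) (by simp))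
    | @head Q P hQP _ ih =>
      intro hQS hxQ
      obtain ⟨M', hM'⟩ := hQS
      have hPS : P ∈ cubeTree σ c := ⟨M', hM'.tail hQP.1⟩
      calc ‖F Q x‖ₑ = ‖(F Q x - F P x) + F P x‖ₑ := by rw [sub_add_cancel]
        _ ≤ C * a Q + C * T P.1 :=
          (enorm_add_le _ _).trans (add_le_add (h2 Q P hQP.1 hQP.2) (ih hPS hQP.2))
        _ ≤ C * T Q.1 := by
          rw [← mul_add]
          gcongr
          exact hstep Q ⟨M', hM'⟩ hxQ P.1 (hc.lt Q P hQP.1)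
  refine (hmain _ hW ⟨M, .refl⟩ hxM).trans ?_
  have hsub : B (originCube σ M).1 ⊆ {Q | Q ∈ cubeTree σ c ∧ x ∈ gridCube σ Q} :=
    fun R hR => ⟨hR.1, hR.2.1⟩
  exact mul_le_mul_right (ENNReal.tsum_le_tsum fun Q =>
    indicator_le_indicator_of_subset hsub (fun _ => zero_le) Q) C

end IsChildMap

/-- Add the chain of cubes containing the origin to a choice of children. -/
def insertOrigin (σ : Fin n → ℤˣ) (ch : ℤ × (Fin n → ℤ) → Set (ℤ × (Fin n → ℤ)))
    (Q : ℤ × (Fin n → ℤ)) : Set (ℤ × (Fin n → ℤ)) :=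
  {P | (∃ M, Q = originCube σ (M + 1) ∧ P = originCube σ M) ∨
    (P ∈ ch Q ∧ ∀ M, Q = originCube σ (M + 1) →
      Disjoint (gridCube σ P) (gridCube σ (originCube σ M)))}

lemma originCube_injective : Function.Injective (originCube σ) := fun M M' h => by
  have : (M : ℤ) = M' := congrArg Prod.fst h
  exact_mod_cast this

lemma gridCube_originCube_subset (M : ℕ) :
    gridCube σ (originCube σ M) ⊆ gridCube σ (originCube σ (M + 1)) :=
  gridCube_subset_of_mem (x := 0) (by simp [originCube]) rfl rfl

lemma two_mul_volume_originCube_le (hn : 0 < n) (M : ℕ) :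
    2 * volume (gridCube σ (originCube σ M)) ≤ volume (gridCube σ (originCube σ (M + 1))) := by
  have h2 : ENNReal.ofReal ((2 : ℝ) ^ ((M + 1 : ℕ) : ℤ)) = 2 * ENNReal.ofReal (2 ^ (M : ℤ)) := by
    rw [← ENNReal.ofReal_ofNat 2, ← ENNReal.ofReal_mul (by norm_num)]
    congr 1
    rw [zpow_natCast, zpow_natCast, pow_succ']
  rw [volume_gridCube, volume_gridCube]
  simp only [originCube]
  rw [h2, mul_pow]
  gcongr
  exact le_self_pow₀ (by norm_num) hn.ne'

/-- The given children cover at most a quarter of a cube and the inserted origin cube at most half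
of it, so at least a quarter is left over. -/
lemma isChildMap_insertOrigin (hn : 0 < n) {ch : ℤ × (Fin n → ℤ) → Set (ℤ × (Fin n → ℤ))}
    (hch : ∀ Q, ∀ P ∈ ch Q, P.1 < Q.1 ∧ gridCube σ P ⊆ gridCube σ Q)
    (hd : ∀ Q, (ch Q).PairwiseDisjoint (gridCube σ))
    (hv : ∀ Q, 4 * volume (⋃ P ∈ ch Q, gridCube σ P) ≤ volume (gridCube σ Q)) :
    IsChildMap σ (insertOrigin σ ch) where
  lt := by
    rintro Q P (⟨M, rfl, rfl⟩ | ⟨hP, -⟩)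
    · simp [originCube]
    · exact (hch Q P hP).1
  subset := by
    rintro Q P (⟨M, rfl, rfl⟩ | ⟨hP, -⟩)
    · exact gridCube_originCube_subset M
    · exact (hch Q P hP).2
  disjoint := by
    rintro Q P (⟨M, hQ, rfl⟩ | ⟨hP, hPd⟩) P' (⟨M', hQ', rfl⟩ | ⟨hP', hPd'⟩) hne
    · have := originCube_injective (hQ.symm.trans hQ')
      rw [Nat.add_right_cancel this] at hne
      exact absurd rfl hne
    · exact (hPd' M hQ).symm
    · exact hPd M' hQ'
    · exact hd Q hP hP' hne
  volume_le := by
    intro Q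
    set U := ⋃ P ∈ ch Q, gridCube σ P
    set U' := ⋃ P ∈ insertOrigin σ ch Q, gridCube σ P
    have hfin := volume_gridCube_ne_top σ Q
    have hU' : 4 * volume U' ≤ 3 * volume (gridCube σ Q) := by
      by_cases hQ : ∃ M, Q = originCube σ (M + 1)
      · obtain ⟨M, hQ⟩ := hQ
        have hsub : U' ⊆ gridCube σ (originCube σ M) ∪ U := by
          refine iUnion₂_subset ?_
          rintro P (⟨M', hQ', rfl⟩ | ⟨hP, -⟩)
          · rw [Nat.add_right_cancel (originCube_injective (hQ.symm.trans hQ'))]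
            exact subset_union_left
          · exact (subset_biUnion_of_mem (u := fun P => gridCube σ P) hP).trans
              subset_union_right
        calc 4 * volume U' ≤ 4 * (volume (gridCube σ (originCube σ M)) + volume U) := by
              gcongr
              exact (measure_mono hsub).trans (measure_union_le _ _)
          _ = 2 * (2 * volume (gridCube σ (originCube σ M))) + 4 * volume U := by ring
          _ ≤ 2 * volume (gridCube σ Q) + volume (gridCube σ Q) := by
              gcongr
              · rw [hQ]
                exact two_mul_volume_originCube_le hn M
              · exact hv Q
          _ = _ := by ring
      · have hsub : U' ⊆ U := by
          refine iUnion₂_subset ?_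
          rintro P (⟨M', hQ', rfl⟩ | ⟨hP, -⟩)
          · exact absurd ⟨M', hQ'⟩ hQ
          · exact subset_biUnion_of_mem (u := fun P => gridCube σ P) hP
        calc 4 * volume U' ≤ 4 * volume U := by gcongr
          _ ≤ 1 * volume (gridCube σ Q) := by rw [one_mul]; exact hv Q
          _ ≤ _ := by gcongr; norm_num
    have h1 : volume (gridCube σ Q) ≤ volume (ownPart σ (insertOrigin σ ch) Q) + volume U' := by
      refine (measure_mono ?_).trans (measure_union_le _ _)
      unfold ownPart
      simp [U']
    have h2 : volume (gridCube σ Q) + 3 * volume (gridCube σ Q) ≤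
        4 * volume (ownPart σ (insertOrigin σ ch) Q) + 3 * volume (gridCube σ Q) := by
      calc _ = 4 * volume (gridCube σ Q) := by ring
        _ ≤ 4 * (volume (ownPart σ (insertOrigin σ ch) Q) + volume U') := by gcongr
        _ = 4 * volume (ownPart σ (insertOrigin σ ch) Q) + 4 * volume U' := mul_add _ _ _
        _ ≤ _ := by gcongr
    exact (ENNReal.add_le_add_iff_right (ENNReal.mul_ne_top (by norm_num) hfin)).1 h2
  origin := fun M => Or.inl ⟨M, rfl, rfl⟩

end Tree

/-! ### Pointwise sparse domination -/

section Domination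

variable {n m : ℕ} {p : ℝ} {Text : LpOperator n m p}

lemma tendsto_inv_ofReal_side_rpow_pow (hn : 0 < n) (hm : 0 < m) (hp : 0 < p) :
    Tendsto (fun M : ℕ => ((ENNReal.ofReal ((2 : ℝ) ^ (M : ℤ)) ^ ((n : ℝ) / p))⁻¹) ^ m) atTop
      (𝓝 0) := by
  have h1 : Tendsto (fun M : ℕ => ENNReal.ofReal ((2 : ℝ) ^ (M : ℤ))) atTop (𝓝 ∞) := by
    simp_rw [zpow_natCast]
    exact ENNReal.tendsto_ofReal_atTop.comp (tendsto_pow_atTop_atTop_of_one_lt (by norm_num))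
  have h2 := ((ENNReal.continuous_rpow_const (y := (n : ℝ) / p)).tendsto ∞).comp h1
  rw [ENNReal.top_rpow_of_pos (by positivity)] at h2
  have h3 := tendsto_inv_iff.2 h2
  rw [ENNReal.inv_top] at h3
  have h4 := ENNReal.Tendsto.pow (n := m) h3
  rwa [zero_pow hm.ne'] at h4

/-- The tree controls `Text` of the truncation to any origin cube around x. The error against `Text
f` is of order 2^(-M n m/p), and M → ∞ removes it. -/
lemma exists_tree_bound [Fact (1 ≤ ENNReal.ofReal p)] (hn : 0 < n) (hm : 0 < m)
    (hp : 1 ≤ p) {A : ℝ≥0} (hA : IsWeakBounded Text A)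
    {T : SchwartzOperator n m} {K : Space n → (Fin m → Space n) → ℂ} (hK : HasKernel T K)
    (hT : ∀ f : Fin m → 𝓢(Space n, ℂ),
      IsGivenBy (T f) (Text fun i => (f i).toLp (ENNReal.ofReal p) volume))
    (H2 : KernelRegularity p K) (σ : Fin n → ℤˣ) :
    ∃ C : ℝ≥0, ∀ f : Fin m → Lp ℂ (ENNReal.ofReal p) (volume : Measure (Space n)),
      ∃ c : ℤ × (Fin n → ℤ) → Set (ℤ × (Fin n → ℤ)), IsChildMap σ c ∧
        ∀ᵐ x, ‖Text f x‖ₑ ≤ C * ∑' Q, {Q | Q ∈ cubeTree σ c ∧ x ∈ gridCube σ Q}.indicator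
          (fun Q => ∏ i, cubeSize σ f Q i) Q := by
  have hp0 : 0 < p := by linarith
  obtain ⟨C₁, hC₁⟩ := exists_stopping_family hn hm hp hA hK hT H2 σ
  obtain ⟨C₂, hC₂⟩ := exists_enorm_sub_cubeTrunc_le hn hm hp hA hK hT H2 σ
  set D : ℝ≥0 := 2 ^ ((n : ℝ) / p) with hD
  refine ⟨C₁ + C₂ * D ^ m, fun f => ?_⟩
  choose ch h1 h2 h3 h4 h5 using hC₁ f
  have hc := isChildMap_insertOrigin hn h1 h2 h3
  refine ⟨insertOrigin σ ch, hc, ?_⟩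
  set u : ℤ × (Fin n → ℤ) → ℝ≥0∞ := fun Q => ∏ i, cubeSize σ f Q i with hu
  have hF : ∀ Q, ∀ᵐ x, x ∈ ownPart σ (insertOrigin σ ch) Q →
      ‖Text (cubeTrunc σ f Q) x‖ₑ ≤ ((C₁ + C₂ * D ^ m : ℝ≥0) : ℝ≥0∞) * u Q := by
    intro Q
    by_cases hQ : ∃ M, Q = originCube σ (M + 1)
    · obtain ⟨M, hQ⟩ := hQ
      filter_upwards [h4 Q] with x hx hxQ
      refine (hx hxQ.1 fun P hP hxP => hxQ.2 ?_).trans ?_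
      -- A child dropped in favour of the origin cube is contained in it, so the own part still
      -- avoids all the original children.
      · by_cases hdisj : Disjoint (gridCube σ P) (gridCube σ (originCube σ M))
        · refine mem_biUnion (Or.inr ⟨hP, fun M' hM' => ?_⟩) hxP
          rwa [← Nat.add_right_cancel (originCube_injective (hQ.symm.trans hM'))]
        · obtain ⟨y, hy, hy'⟩ := not_disjoint_iff.1 hdisj
          refine mem_biUnion (Or.inl ⟨M, hQ, rfl⟩) (gridCube_subset_of_mem ?_ hy hy' hxP)
          have := (h1 Q P hP).1
          rw [hQ] at this
          simp only [originCube] at this ⊢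
          omega
      · gcongr
        exact le_self_add
    · filter_upwards [h4 Q] with x hx hxQ
      refine (hx hxQ.1 fun P hP hxP => hxQ.2 ?_).trans ?_
      · exact mem_biUnion (Or.inr ⟨hP, fun M hM => absurd ⟨M, hM⟩ hQ⟩) hxP
      · gcongr
        exact le_self_add
  have hF' : ∀ Q, ∀ P ∈ insertOrigin σ ch Q, ∀ᵐ x, x ∈ gridCube σ P →
      ‖Text (cubeTrunc σ f Q) x - Text (cubeTrunc σ f P) x‖ₑ ≤
        ((C₁ + C₂ * D ^ m : ℝ≥0) : ℝ≥0∞) * u Q := by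
    rintro Q P (⟨M, rfl, rfl⟩ | ⟨hP, -⟩)
    -- The inserted child need not be a stopping cube. As its side is half that of its parent, the
    -- comparison in terms of global norms suffices, at the cost of 2^(n/p) for each entry.
    · have hlt : (originCube σ M).1 < (originCube σ (M + 1)).1 := by simp [originCube]
      have key := hC₂ (cubeTrunc σ f (originCube σ (M + 1))) (originCube σ M)
        (fun i => D * cubeSize σ f (originCube σ (M + 1)) i) fun i => by
          rw [eLpNorm_cubeTrunc]
          have hside : ENNReal.ofReal ((2 : ℝ) ^ (originCube σ (M + 1)).1) =
              2 * ENNReal.ofReal (2 ^ (originCube σ M).1) := by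
            rw [← ENNReal.ofReal_ofNat 2, ← ENNReal.ofReal_mul (by norm_num)]
            congr 1
            simp only [originCube]
            rw [zpow_natCast, zpow_natCast, pow_succ']
          rw [hside, ENNReal.mul_rpow_of_nonneg _ _ (by positivity), hD,
            ENNReal.coe_rpow_of_nonneg _ (by positivity)]
          apply le_of_eq
          push_cast
          ring
      rw [cubeTrunc_cubeTrunc f hlt (gridCube_originCube_subset M)] at key
      filter_upwards [key] with x hx hxP
      refine (hx hxP).trans ?_
      rw [Finset.prod_mul_distrib, Finset.prod_const, Finset.card_univ, Fintype.card_fin,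
        ← mul_assoc]
      gcongr
      push_cast
      exact le_add_self
    · filter_upwards [h5 Q P hP] with x hx hxP
      refine (hx hxP).trans ?_
      gcongr
      exact le_self_add
  have hglob : ∀ M : ℕ, ∀ᵐ x, x ∈ gridCube σ (originCube σ M) →
      ‖Text f x - Text (cubeTrunc σ f (originCube σ M)) x‖ₑ ≤
        C₂ * ((∏ i, eLpNorm (f i) (ENNReal.ofReal p) volume) *
          ((ENNReal.ofReal ((2 : ℝ) ^ (M : ℤ)) ^ ((n : ℝ) / p))⁻¹) ^ m) := by
    intro M
    have key := hC₂ f (originCube σ M) (fun i => eLpNorm (f i) (ENNReal.ofReal p) volume *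
      (ENNReal.ofReal ((2 : ℝ) ^ (M : ℤ)) ^ ((n : ℝ) / p))⁻¹) fun i => by
        simp only [originCube]
        rw [mul_assoc, ENNReal.inv_mul_cancel (ofReal_side_rpow_ne_zero _ _)
          (ofReal_side_rpow_ne_top _ _), mul_one]
    simpa only [Finset.prod_mul_distrib, Finset.prod_const, Finset.card_univ,
      Fintype.card_fin] using key
  filter_upwards [hc.ae_enorm_le hF hF', ae_all_iff.2 hglob] with x hx hxg
  set L := ((C₁ + C₂ * D ^ m : ℝ≥0) : ℝ≥0∞) *
    ∑' Q, {Q | Q ∈ cubeTree σ (insertOrigin σ ch) ∧ x ∈ gridCube σ Q}.indicator u Q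
  have hlim : Tendsto (fun M : ℕ => C₂ * ((∏ i, eLpNorm (f i) (ENNReal.ofReal p) volume) *
      ((ENNReal.ofReal ((2 : ℝ) ^ (M : ℤ)) ^ ((n : ℝ) / p))⁻¹) ^ m) + L) atTop (𝓝 L) := by
    have h6 := ENNReal.Tendsto.const_mul (tendsto_inv_ofReal_side_rpow_pow hn hm hp0)
      (Or.inr (ENNReal.prod_ne_top fun i _ => Lp.eLpNorm_ne_top (f i)) :
        (0 : ℝ≥0∞) ≠ 0 ∨ ∏ i, eLpNorm (f i) (ENNReal.ofReal p) volume ≠ ∞)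
    have h7 := (ENNReal.Tendsto.const_mul h6
      (Or.inr (ENNReal.coe_ne_top (r := C₂)))).add_const L
    simpa using h7
  refine ge_of_tendsto hlim ?_
  have hev := tendsto_natCast_atTop_atTop.eventually (gridIndex_eventually_eq σ x)
  filter_upwards [hev] with M hM
  have hxM : x ∈ gridCube σ (originCube σ M) := hM
  calc ‖Text f x‖ₑ = ‖(Text f x - Text (cubeTrunc σ f (originCube σ M)) x) +
        Text (cubeTrunc σ f (originCube σ M)) x‖ₑ := by rw [sub_add_cancel]
    _ ≤ _ := (enorm_add_le _ _).trans (add_le_add (hxg M hxM) (hx M hxM))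

/-! ### From a tree in one grid to sparse families in the shifted grids. -/

lemma average_eq (hp : 0 < p) (f : Lp ℂ (ENNReal.ofReal p) (volume : Measure (Space n)))
    {X : Set (Space n)} (h0 : volume X ≠ 0) (htop : volume X ≠ ∞) :
    eLpNorm f (ENNReal.ofReal p) (volume.restrict X) =
      volume X ^ (1 / p) * average p f X := by
  have hp0' : ENNReal.ofReal p ≠ 0 := by simpa using hp
  rw [average, ← ENNReal.mul_rpow_of_nonneg _ _ (by positivity), ← mul_assoc,
    ENNReal.mul_inv_cancel h0 htop, one_mul, eLpNorm_eq_lintegral_rpow_enorm_toReal hp0'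
      ENNReal.ofReal_ne_top, ENNReal.toReal_ofReal hp.le]

lemma cubeSize_le (hp : 0 < p) (σ τ : Fin n → ℤˣ)
    (f : Fin m → Lp ℂ (ENNReal.ofReal p) (volume : Measure (Space n)))
    {Q R : ℤ × (Fin n → ℤ)} {N : ℕ} (hR : R.1 = Q.1 + N)
    (hsub : Metric.ball (gridCorner σ Q) (8 * n * 2 ^ Q.1) ⊆ gridCube τ R) (i : Fin m) :
    cubeSize σ f Q i ≤ ((2 ^ N : ℝ≥0) ^ ((n : ℝ) / p) : ℝ≥0) * average p (f i) (gridCube τ R) := by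
  refine ENNReal.div_le_of_le_mul ?_
  refine (eLpNorm_mono_measure _ (Measure.restrict_mono hsub le_rfl)).trans ?_
  rw [average_eq hp (f i) (volume_gridCube_pos τ R) (volume_gridCube_ne_top τ R), volume_gridCube,
    hR, zpow_add₀ (by norm_num), ENNReal.ofReal_mul (by positivity), ← ENNReal.rpow_natCast,
    ← ENNReal.rpow_mul, mul_one_div, ENNReal.mul_rpow_of_nonneg _ _ (by positivity),
    ENNReal.coe_rpow_of_nonneg _ (by positivity), zpow_natCast]
  apply le_of_eq
  rw [ENNReal.ofReal_pow (by norm_num), ENNReal.ofReal_ofNat]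
  push_cast
  ring

lemma measurable_sparseOperator {σ : Fin n → ℤˣ} {S : Set (Set (Space n))}
    (hS : S ⊆ shiftedGrid σ) (f : Fin m → Space n → ℂ) : Measurable (sparseOperator p S f) := by
  have : Countable S := ((countable_shiftedGrid σ).mono hS).to_subtype
  refine Measurable.tsum fun Q => ?_
  exact measurable_const.indicator (measurableSet_of_mem_shiftedGrid (hS Q.2))

/-- The passage from a tree of cubes to sparse families in finitely many grids. -/
lemma exists_sparse_families (hn : 0 < n) (m : ℕ) (hp : 0 < p) (σ : Fin n → ℤˣ) :
    ∃ (N : ℕ) (C : ℝ≥0), ∀ c : ℤ × (Fin n → ℤ) → Set (ℤ × (Fin n → ℤ)), IsChildMap σ c →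
      ∃ G : (Fin n → ℤˣ) → Option (Fin N) → Set (Set (Space n)),
        (∀ τ o, G τ o ⊆ shiftedGrid τ ∧ IsSparse (G τ o)) ∧
        ∀ (f : Fin m → Lp ℂ (ENNReal.ofReal p) (volume : Measure (Space n))) (x : Space n),
          ∑' Q, {Q | Q ∈ cubeTree σ c ∧ x ∈ gridCube σ Q}.indicator
            (fun Q => ∏ i, cubeSize σ f Q i) Q ≤
          C * ∑ τ, ∑ o, sparseOperator p (G τ o) (fun i => f i) x := by
  -- With 48n < 2^N₀ a ball of radius 8n 2^k fits into a cube N₀ levels higher in some shifted grid.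
  obtain ⟨N₀, hN₀⟩ := pow_unbounded_of_one_lt (6 * (8 * (n : ℝ))) (by norm_num : (1 : ℝ) < 2)
  have hex : ∀ Q : ℤ × (Fin n → ℤ), ∃ (τ : Fin n → ℤˣ) (R : ℤ × (Fin n → ℤ)), R.1 = Q.1 + N₀ ∧
      Metric.ball (gridCorner σ Q) (8 * n * 2 ^ Q.1) ⊆ gridCube τ R := fun Q => by
    refine exists_ball_subset_gridCube _ (Q.1 + N₀) ?_
    rw [zpow_add₀ (by norm_num), zpow_natCast, mul_comm ((2 : ℝ) ^ Q.1), ← mul_assoc]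
    gcongr
  choose τ R hR hball using hex
  -- Carleson constant of the enlarged cubes: the volume grows by (2^N₀)^n, and the own part is at
  -- least a quarter of the original cube.
  set N : ℕ := (2 ^ N₀) ^ n * 4 with hN
  set D : ℝ≥0 := (2 ^ N₀ : ℝ≥0) ^ ((n : ℝ) / p) with hD
  refine ⟨2 * N, D ^ m, fun c hc => ?_⟩
  have hsubR : ∀ Q, gridCube σ Q ⊆ gridCube (τ Q) (R Q) := fun Q => by
    refine Subset.trans (fun x hx => ?_) (hball Q)
    refine (dist_le_of_mem_gridCube hx (gridCorner_mem σ Q)).trans_lt ?_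
    have : (0 : ℝ) < n * 2 ^ Q.1 := by positivity
    linarith
  have hvol : ∀ (Q : ℤ × (Fin n → ℤ)) (τ' : Fin n → ℤˣ), volume (gridCube τ' (R Q)) =
      ((2 ^ N₀ : ℕ) : ℝ≥0∞) ^ n * volume (gridCube σ Q) := fun Q τ' => by
    rw [volume_gridCube, volume_gridCube, hR, zpow_add₀ (by norm_num),
      ENNReal.ofReal_mul (by positivity), mul_pow, mul_comm, zpow_natCast,
      ENNReal.ofReal_pow (by norm_num), ENNReal.ofReal_ofNat]
    push_cast
    rfl
  set F : (Fin n → ℤˣ) → Set (Set (Space n)) := fun τ' =>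
    {X | ∃ Q ∈ cubeTree σ c, τ Q = τ' ∧ gridCube τ' (R Q) = X} with hF
  have hFgrid : ∀ τ', F τ' ⊆ shiftedGrid τ' := by
    rintro τ' _ ⟨Q, -, -, rfl⟩
    exact ⟨R Q, rfl⟩
  have hcover : ∀ τ', ∃ G : Option (Fin (2 * N)) → Set (Set (Space n)),
      (∀ o, G o ⊆ F τ' ∧ IsSparse (G o)) ∧ F τ' ⊆ ⋃ o, G o := by
    intro τ'
    classical
    -- Several tree cubes may have the same enlargement; the own part of one of them serves as the
    -- disjoint set.
    have hsel : ∀ X : Set (Space n), ∃ Q, X ∈ F τ' →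
        Q ∈ cubeTree σ c ∧ τ Q = τ' ∧ gridCube τ' (R Q) = X := by
      intro X
      by_cases hX : X ∈ F τ'
      · obtain ⟨Q, hQ⟩ := hX
        exact ⟨Q, fun _ => hQ⟩
      · exact ⟨(0, 0), fun h => absurd h hX⟩
    choose q hq using hsel
    refine exists_sparse_cover hn (by positivity : 0 < N) (E := fun X => ownPart σ c (q X))
      (hFgrid τ') (fun X hX => ?_) fun X hX Y hY hne => ?_
    · obtain ⟨h1, h2, h3⟩ := hq X hX
      refine ⟨measurableSet_ownPart _, ?_, ?_⟩
      · have := hsubR (q X)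
        rw [h2, h3] at this
        exact sdiff_subset.trans this
      · calc volume X = ((2 ^ N₀ : ℕ) : ℝ≥0∞) ^ n * volume (gridCube σ (q X)) := by
              exact (congrArg volume h3).symm.trans (hvol (q X) τ')
          _ ≤ ((2 ^ N₀ : ℕ) : ℝ≥0∞) ^ n * (4 * volume (ownPart σ c (q X))) := by
              gcongr
              exact hc.volume_le _
          _ = _ := by
              rw [hN]
              push_cast
              ring
    · refine hc.pairwiseDisjoint_ownPart (hq X hX).1 (hq Y hY).1 fun h => hne ?_
      rw [← (hq X hX).2.2, ← (hq Y hY).2.2, h]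
  choose G hG hGF using hcover
  refine ⟨G, fun τ' o => ⟨(hG τ' o).1.trans (hFgrid τ'), (hG τ' o).2⟩, fun f x => ?_⟩
  set u : ℤ × (Fin n → ℤ) → ℝ≥0∞ := fun Q => ∏ i, cubeSize σ f Q i with hu
  set b : Set (Space n) → ℝ≥0∞ := fun X =>
    X.indicator (fun _ => ∏ i, average p (f i) X) x with hb
  set B : (Fin n → ℤˣ) → Set (ℤ × (Fin n → ℤ)) := fun τ' =>
    {Q | Q ∈ cubeTree σ c ∧ τ Q = τ' ∧ x ∈ gridCube σ Q} with hB
  have hBunion : {Q | Q ∈ cubeTree σ c ∧ x ∈ gridCube σ Q} = ⋃ τ', B τ' := by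
    ext Q
    simp [hB]
  have hone : ∀ τ', ∑' Q : B τ', u Q ≤ D ^ m * ∑ o, sparseOperator p (G τ' o) (fun i => f i) x := by
    intro τ'
    have hub : ∀ Q ∈ B τ', u Q ≤ D ^ m * b (gridCube τ' (R Q)) := by
      rintro Q ⟨-, rfl, hxQ⟩
      rw [hb]
      simp only
      rw [indicator_of_mem (hsubR Q hxQ)]
      calc u Q ≤ ∏ i, ((D : ℝ≥0∞) * average p (f i) (gridCube (τ Q) (R Q))) :=
            Finset.prod_le_prod' fun i _ => cubeSize_le hp σ (τ Q) f (hR Q) (hball Q) i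
        _ = _ := by
            rw [Finset.prod_mul_distrib, Finset.prod_const, Finset.card_univ, Fintype.card_fin]
    set φ : B τ' → F τ' := fun Q => ⟨gridCube τ' (R Q), Q, Q.2.1, Q.2.2.1, rfl⟩ with hφ
    -- No overcounting at a fixed x: the enlarged cube determines the side of Q, and the side
    -- together with x determines Q.
    have hinj : Function.Injective φ := by
      intro Q Q' h
      have h1 : R Q = R Q' := gridCube_injective hn τ' (congrArg Subtype.val h)
      have h2 : (Q : ℤ × (Fin n → ℤ)).1 = (Q' : ℤ × (Fin n → ℤ)).1 := by
        have := congrArg Prod.fst h1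
        rw [hR, hR] at this
        omega
      refine Subtype.ext (Prod.ext h2 ?_)
      have h3 : gridIndex σ (Q : ℤ × (Fin n → ℤ)).1 x = (Q : ℤ × (Fin n → ℤ)).2 := Q.2.2.2
      have h4 : gridIndex σ (Q' : ℤ × (Fin n → ℤ)).1 x = (Q' : ℤ × (Fin n → ℤ)).2 := Q'.2.2.2
      rw [← h3, ← h4, h2]
    calc ∑' Q : B τ', u Q ≤ ∑' Q : B τ', D ^ m * b (φ Q : Set (Space n)) :=
          ENNReal.tsum_le_tsum fun Q => hub Q Q.2
      _ = D ^ m * ∑' Q : B τ', b (φ Q : Set (Space n)) := ENNReal.tsum_mul_left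
      _ ≤ D ^ m * ∑' X : F τ', b X := by
          gcongr
          exact ENNReal.tsum_comp_le_tsum_of_injective hinj fun X : F τ' => b X
      _ ≤ D ^ m * ∑' X : ⋃ o, G τ' o, b X := by
          gcongr
          exact ENNReal.tsum_mono_subtype b (hGF τ')
      _ ≤ D ^ m * ∑ o, ∑' X : G τ' o, b X := by
          gcongr
          exact ENNReal.tsum_iUnion_le b _
  calc _ = ∑' Q : ⋃ τ', B τ', u Q := by
        rw [← hBunion, tsum_subtype]
    _ ≤ ∑ τ', ∑' Q : B τ', u Q := ENNReal.tsum_iUnion_le u B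
    _ ≤ ∑ τ', D ^ m * ∑ o, sparseOperator p (G τ' o) (fun i => f i) x :=
        Finset.sum_le_sum fun τ' _ => hone τ'
    _ = _ := by
        rw [← Finset.mul_sum]
        push_cast
        rfl

/-! ### The estimate in quasi-Banach function spaces -/

lemma QuasiBanachFunctionSpace.rho_sum_le (X : QuasiBanachFunctionSpace n) {κ : ℝ≥0}
    (hκ : 1 ≤ κ) (hX : X.const ≤ κ) {ι : Type*} (s : Finset ι) (g : ι → Space n → ℝ≥0∞)
    (hg : ∀ i ∈ s, Measurable (g i)) :
    X.rho (fun x => ∑ i ∈ s, g i x) ≤ (κ : ℝ≥0∞) ^ s.card * ∑ i ∈ s, X.rho (g i) := by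
  classical
  induction s using Finset.induction_on with
  | empty =>
    have := X.smul_eq 0 (fun _ => 0) measurable_const
    simpa using this.le
  | insert a s ha ih =>
    have h1 : Measurable fun x => ∑ i ∈ s, g i x :=
      Finset.measurable_sum _ fun i hi => hg i (Finset.mem_insert_of_mem hi)
    have h2 := X.add_le (g a) _ (hg a (Finset.mem_insert_self a s)) h1
    simp_rw [Finset.sum_insert ha]
    rw [Finset.card_insert_of_notMem ha]
    have h3 := ih fun i hi => hg i (Finset.mem_insert_of_mem hi)
    have h4 : (1 : ℝ≥0∞) ≤ (κ : ℝ≥0∞) ^ s.card := one_le_pow₀ (by exact_mod_cast hκ)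
    calc _ ≤ _ := h2
      _ ≤ (κ : ℝ≥0∞) * ((κ : ℝ≥0∞) ^ s.card * X.rho (g a) +
            (κ : ℝ≥0∞) ^ s.card * ∑ i ∈ s, X.rho (g i)) := by
          gcongr
          exact le_mul_of_one_le_left zero_le h4
      _ = _ := by ring

end Domination

end SparseDomination

/-! ### Conclusion: from the pointwise bound to the quasi-norm. -/

open SparseDomination
theorem mainTheorem2 (n m : ℕ) (hn : 0 < n) (hm : 0 < m) (p₀ : ℝ) (hp₀ : 1 ≤ p₀)
    (T : SchwartzOperator n m) (Text : LpOperator n m p₀)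
    (K : Space n → (Fin m → Space n) → ℂ) (hK : HasKernel T K)
    (H1 : IsWeakBoundedExtension p₀ T Text) (H2 : KernelRegularity p₀ K) :
    ∀ κ : ℝ≥0, ∃ C : ℝ≥0, ∀ X : QuasiBanachFunctionSpace n, X.const ≤ κ →
      ∀ f : Fin m → Lp ℂ (ENNReal.ofReal p₀) (volume : Measure (Space n)),
        X.rho (fun x => ‖Text f x‖ₑ) ≤
          C * ⨆ (D : Set (Set (Space n))) (_ : IsDyadicGrid D)
            (S : Set (Set (Space n))) (_ : S ⊆ D) (_ : IsSparse S),
              X.rho (sparseOperator p₀ S fun i => f i) := by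
  intro κ
  have : Fact (1 ≤ ENNReal.ofReal p₀) := ⟨by simpa using hp₀⟩
  obtain ⟨A, hA⟩ := H1.bounded
  -- Any one grid will do for the tree; the other shifts enter only through the enlarged cubes.
  obtain ⟨C₁, hC₁⟩ := exists_tree_bound hn hm hp₀ hA hK H1.agrees H2 1
  obtain ⟨N, C₂, hC₂⟩ := exists_sparse_families hn m (by linarith : 0 < p₀) (1 : Fin n → ℤˣ)
  set k := (Finset.univ : Finset ((Fin n → ℤˣ) × Option (Fin N))).card
  -- `rho_sum_le` asks for a constant of at least 1, hence `κ + 1`. The number k of pairs of a grid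
  -- and a sparse class is fixed before X and f.
  refine ⟨C₁ * C₂ * ((κ + 1) ^ k * k), fun X hX f => ?_⟩
  obtain ⟨c, hc, hTf⟩ := hC₁ f
  obtain ⟨G, hG, hsum⟩ := hC₂ c hc
  have hmeas : ∀ j : (Fin n → ℤˣ) × Option (Fin N),
      Measurable (sparseOperator p₀ (G j.1 j.2) fun i => f i) :=
    fun j => measurable_sparseOperator (hG j.1 j.2).1 _
  have hmeas' : Measurable fun x => ∑ j : (Fin n → ℤˣ) × Option (Fin N),
      sparseOperator p₀ (G j.1 j.2) (fun i => f i) x :=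
    Finset.measurable_sum _ fun j _ => hmeas j
  set s := ⨆ (D : Set (Set (Space n))) (_ : IsDyadicGrid D)
    (S : Set (Set (Space n))) (_ : S ⊆ D) (_ : IsSparse S),
      X.rho (sparseOperator p₀ S fun i => f i) with hs
  have hle : ∀ j : (Fin n → ℤˣ) × Option (Fin N),
      X.rho (sparseOperator p₀ (G j.1 j.2) fun i => f i) ≤ s := by
    intro j
    rw [hs]
    refine le_iSup₂_of_le (shiftedGrid j.1) (isDyadicGrid_shiftedGrid hn j.1) ?_
    exact le_iSup₂_of_le (G j.1 j.2) (hG j.1 j.2).1 (le_iSup_of_le (hG j.1 j.2).2 le_rfl)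
  calc X.rho (fun x => ‖Text f x‖ₑ)
      ≤ X.rho (fun x => ((C₁ * C₂ : ℝ≥0) : ℝ≥0∞) * ∑ j : (Fin n → ℤˣ) × Option (Fin N),
          sparseOperator p₀ (G j.1 j.2) (fun i => f i) x) := by
        refine X.mono _ _ (AEEqFun.measurable _).enorm (hmeas'.const_mul _) ?_
        filter_upwards [hTf] with x hx
        refine hx.trans ?_
        rw [Fintype.sum_prod_type, ENNReal.coe_mul, mul_assoc]
        gcongr
        exact hsum f x
    _ = ((C₁ * C₂ : ℝ≥0) : ℝ≥0∞) * X.rho (fun x => ∑ j : (Fin n → ℤˣ) × Option (Fin N),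
          sparseOperator p₀ (G j.1 j.2) (fun i => f i) x) := X.smul_eq _ _ hmeas'
    _ ≤ ((C₁ * C₂ : ℝ≥0) : ℝ≥0∞) * (((κ + 1 : ℝ≥0) : ℝ≥0∞) ^ k *
          ∑ j : (Fin n → ℤˣ) × Option (Fin N),
            X.rho (sparseOperator p₀ (G j.1 j.2) fun i => f i)) := by
        gcongr
        exact X.rho_sum_le le_add_self (hX.trans le_self_add) _ _ fun j _ => hmeas j
    _ ≤ ((C₁ * C₂ : ℝ≥0) : ℝ≥0∞) * (((κ + 1 : ℝ≥0) : ℝ≥0∞) ^ k * (k * s)) := by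
        gcongr
        refine (Finset.sum_le_sum fun j _ => hle j).trans_eq ?_
        rw [Finset.sum_const, nsmul_eq_mul]
    _ = _ := by
        push_cast
        ring
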